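/- Let $L>0$, $-L<l_1<l_2<L$, $\omega=(l_1,l_2)$ and $T>0$. Let $\psi\in C^3([-L,L])$ be real-valued with 1. $\psi>0$ in $[-L,L]$; 2. $|\psi'|>0$, $\psi''<0$ and $\psi'\psi'''<0$ in $[-L,L]\setminus\omega$; 3. $\psi'(-L)<0$ and $\psi'(L)>0$; 4. for some $l_3\in[l_1,l_2]$, $\min_{[l_1,l_2]}\psi=\psi(l_3)<\max_{[l_1,l_2]}\psi=\psi(l_1)=\psi(l_2)$, and $\max_{[-L,L]}\psi=\psi(-L)=\psi(L)$; 5. $\psi(-L)\le\frac43\psi(l_3)$, with $l_3$ as in 4. Let $A=\partial_x^2-\partial_x^3$ be the operator in the real space $L^2(-L,L)$ with domain $D(A)=\{f\in H^3(-L,L): f(-L)=f(L)=f_x(L)=0\}$. For $u_0\in L^2(-L,L)$, the solution on $[0,T]$ of $u_t=Au$, $u(0)=u_0$, is the mild (semigroup) solution: $u\in C([0,T];L^2(-L,L))$ with $\int_0^tu(\tau)\,d\tau\in D(A)$ and $u(t)=u_0+A\int_0^tu(\tau)\,d\tau$ for all $t\in[0,T]$. Then there are constants $s_0>0$ and $C>0$,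 depending only on $T$, $L$, $\omega$ and $\psi$, such that for all $s\ge s_0$ and all $u_0\in L^2(-L,L)$ the solution $u$ satisfies $u(t)\in H^3(-L,L)$ for almost every $t\in(0,T)$, and $$\begin{aligned} &\int_0^T\!\!\int_{-L}^{L}\Big\{\tfrac{s^5\psi^5}{t^5(T-t)^5}|u|^2+\tfrac{s^3\psi^3}{t^3(T-t)^3}|u_x|^2+\tfrac{s\psi}{t(T-t)}|u_{xx}|^2\Big\}e^{-\frac{2s\psi(x)}{t(T-t)}}\,dx\,dt\\ &\quad+\int_0^T\Big\{\tfrac{s^3\psi(L)^3}{t^3(T-t)^3}|u_x(t,-L)|^2+\tfrac{s\psi(L)}{t(T-t)}|u_{xx}(t,-L)|^2\Big\}e^{-\frac{2s\psi(L)}{t(T-t)}}\,dt\\ &\le C\int_0^T\!\!\int_{\omega}\Big\{\tfrac{s^5\psi^5}{t^5(T-t)^5}|u|^2+\tfrac{s^3\psi^3}{t^3(T-t)^3}|u_x|^2+\tfrac{s\psi}{t(T-t)}|u_{xx}|^2\Big\}e^{-\frac{2s\psi(x)}{t(T-t)}}\,dx\,dt<\infty . \end{aligned}$$ -/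

import Mathlib

open MeasureTheory Set
open scoped ENNReal ContDiff

namespace KdVB

/-- The Hilbert space `L²(-L, L)` of real-valued functions. -/
abbrev L2 (L : ℝ) : Type := Lp ℝ 2 (volume.restrict (Ioo (-L) L))

/-- `g ∈ L²(-L, L)` is the weak derivative of `f ∈ L²(-L, L)` on the open interval `(-L, L)`. -/
def HasWeakDeriv (L : ℝ) (f g : L2 L) : Prop :=
  ∀ η : ℝ → ℝ, ContDiff ℝ ∞ η → HasCompactSupport η → tsupport η ⊆ Ioo (-L) L →
    ∫ x in Ioo (-L) L, f x * deriv η x = - ∫ x in Ioo (-L) L, g x * η x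

/-- The function class `f` has a representative continuous on `[-L, L]` whose value at `a` is `c`.
For `f ∈ H¹(-L, L)` and `a = ±L` this says that the trace of `f` at `a` is `c`. -/
def HasTrace (L : ℝ) (f : L2 L) (a c : ℝ) : Prop :=
  ∃ g : ℝ → ℝ, ContinuousOn g (Icc (-L) L) ∧
    (∀ᵐ x ∂(volume.restrict (Ioo (-L) L)), f x = g x) ∧ g a = c

/-- `f ∈ H³(-L, L)`. -/
def MemH3 (L : ℝ) (f : L2 L) : Prop :=
  ∃ f₁ f₂ f₃ : L2 L, HasWeakDeriv L f f₁ ∧ HasWeakDeriv L f₁ f₂ ∧ HasWeakDeriv L f₂ f₃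

open Classical in
/-- The weak derivative `f_x` of `f` (with value `0` if there is none in `L²(-L, L)`). -/
noncomputable def weakDeriv (L : ℝ) (f : L2 L) : L2 L :=
  if h : ∃ g, HasWeakDeriv L f g then h.choose else 0

open Classical in
/-- The boundary value of `f` at `a` (with value `0` if there is none). -/
noncomputable def trace (L : ℝ) (f : L2 L) (a : ℝ) : ℝ :=
  if h : ∃ c, HasTrace L f a c then h.choose else 0

/-- The graph of the operator `A = ∂ₓ² - ∂ₓ³` in `L²(-L, L)` with domain
`D(A) = {f ∈ H³(-L, L) : f(-L) = f(L) = f_x(L) = 0}`: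
the proposition says that `f ∈ D(A)` and `A f = h`. -/
def GraphA (L : ℝ) (f h : L2 L) : Prop :=
  ∃ f₁ f₂ f₃ : L2 L,
    HasWeakDeriv L f f₁ ∧ HasWeakDeriv L f₁ f₂ ∧ HasWeakDeriv L f₂ f₃ ∧
    HasTrace L f (-L) 0 ∧ HasTrace L f L 0 ∧ HasTrace L f₁ L 0 ∧
    h = f₂ - f₃

/-- `u` is the (mild) solution on `[0, T]` of `u_t = A u`, `u(0) = u₀`, for `u₀ ∈ L²(-L, L)`, that
is, `u` is the trajectory `t ↦ S(t) u₀` of the semigroup generated by `A`: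
`u ∈ C([0, T]; L²(-L, L))` and `u(t) = u₀ + A ∫₀ᵗ u(τ) dτ` for all `t ∈ [0, T]`. -/
structure IsSolution (L T : ℝ) (u₀ : L2 L) (u : ℝ → L2 L) : Prop where
  continuousOn : ContinuousOn u (Icc 0 T)
  initial : u 0 = u₀
  mild : ∀ t ∈ Icc 0 T, GraphA L (∫ τ in (0 : ℝ)..t, u τ) (u t - u₀)

/-- `k`-th derivative of `ψ` on the closed interval `[-L, L]` (one-sided at the endpoints). -/
noncomputable def D (L : ℝ) (k : ℕ) (ψ : ℝ → ℝ) (x : ℝ) : ℝ :=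
  iteratedDerivWithin k ψ (Icc (-L) L) x

/-- The conditions on the weight `ψ ∈ C³([-L, L])` relative to `ω = (l₁, l₂)`. -/
structure IsWeight (L l₁ l₂ : ℝ) (ψ : ℝ → ℝ) : Prop where
  contDiffOn : ContDiffOn ℝ 3 ψ (Icc (-L) L)
  pos : ∀ x ∈ Icc (-L) L, 0 < ψ x
  off_omega : ∀ x ∈ Icc (-L) L \ Ioo l₁ l₂,
    0 < |D L 1 ψ x| ∧ D L 2 ψ x < 0 ∧ D L 1 ψ x * D L 3 ψ x < 0
  deriv_left : D L 1 ψ (-L) < 0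
  deriv_right : 0 < D L 1 ψ L
  max_omega : IsMaxOn ψ (Icc l₁ l₂) l₁ ∧ ψ l₁ = ψ l₂
  max_all : IsMaxOn ψ (Icc (-L) L) (-L) ∧ ψ (-L) = ψ L
  min_omega : ∃ l₃ ∈ Icc l₁ l₂, IsMinOn ψ (Icc l₁ l₂) l₃ ∧ ψ l₃ < ψ l₁ ∧
    ψ (-L) ≤ 4 / 3 * ψ l₃

/-- `∫₀ᵀ ∫_E { s⁵ψ⁵/(t⁵(T-t)⁵) |u|² + s³ψ³/(t³(T-t)³) |u_x|² + sψ/(t(T-t)) |u_xx|² }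
e^{-2sψ/(t(T-t))} dx dt`, as an element of `[0, ∞]`. -/
noncomputable def interiorIntegral (L T : ℝ) (ψ : ℝ → ℝ) (s : ℝ) (u : ℝ → L2 L) (E : Set ℝ) :
    ℝ≥0∞ :=
  ∫⁻ t in Ioo 0 T, ∫⁻ x in E, ENNReal.ofReal
    ((s ^ 5 * ψ x ^ 5 / (t ^ 5 * (T - t) ^ 5) * |u t x| ^ 2
      + s ^ 3 * ψ x ^ 3 / (t ^ 3 * (T - t) ^ 3) * |weakDeriv L (u t) x| ^ 2
      + s * ψ x / (t * (T - t)) * |weakDeriv L (weakDeriv L (u t)) x| ^ 2)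
      * Real.exp (-(2 * s * ψ x / (t * (T - t)))))

/-- `∫₀ᵀ { s³ψ(L)³/(t³(T-t)³) |u_x(-L)|² + sψ(L)/(t(T-t)) |u_xx(-L)|² } e^{-2sψ(L)/(t(T-t))} dt`,
as an element of `[0, ∞]`. -/
noncomputable def boundaryIntegral (L T : ℝ) (ψ : ℝ → ℝ) (s : ℝ) (u : ℝ → L2 L) : ℝ≥0∞ :=
  ∫⁻ t in Ioo 0 T, ENNReal.ofReal
    ((s ^ 3 * ψ L ^ 3 / (t ^ 3 * (T - t) ^ 3) * |trace L (weakDeriv L (u t)) (-L)| ^ 2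
      + s * ψ L / (t * (T - t)) * |trace L (weakDeriv L (weakDeriv L (u t))) (-L)| ^ 2)
      * Real.exp (-(2 * s * ψ L / (t * (T - t)))))

end KdVB

/-! The inequality comes from one pointwise identity for smooth functions; regularity theory then
makes it available for every mild solution.

Carleman part. Put `ρ = s/(t(T-t))`, `θ = ρψ`, `v = e^{-θ}u`, `a = ρψ'`, `b = ρψ''`. The equation
for `v` says that `P₁ = v_t + v_xxx + 3a²v_x` and `P₂ = 3a v_xx + a³v + 3b v_x` add up to terms of
lower order in `ρ`. Hence `P₁P₂ ≤ (P₁ + P₂)²/2` is of lower order. Integration by parts writes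
`P₁P₂` as `∂ₓQ + ∂ₜg - (9/2)b v_xx² - (15/2)a⁴b v²` plus lower terms. Off `ω`, `b ≤ -κ₀ρ` and `|a| ≥
κ₀ρ`, so for large `ρ` both squares are controlled there, up to `∂ₓQ + ∂ₜg`; adding a multiple of
`∂ₓ(ρ³v v_x)` controls `ρ³v_x²` too. On `ω` the squares go to the right-hand side. The signs of `ψ'`
at `±L` make the boundary flux favourable and yield the traces at `-L`. This is
`carlemanDiv_sub_le`, `carlemanFlux_left_le` and `carleman_slice`. Integrating in time
(`carleman_flow`), `∫g` vanishes at `t = 0` and `t = T`, because the exponential weight beats every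
power of `1/(t(T-t))`, provided that `u`, `u_x`, `u_xx` grow at most polynomially as `t → 0`.

Regularity part. The inverse `K` of `A` is explicit, so `u` is mild iff `∫ₛᵗ u = K(u(t) - u(s))`.
Dissipation (`inner_K_le`) and an interpolation inequality (`exists_interpolation`) give `y' ≤ -c
y^{9/8}` for `y = ‖Au‖²` along regular solutions, hence `‖Au(t)‖ ≤ C M/t⁴` if `‖u‖ ≤ M`. Triple
Steklov averages of a mild solution are regular; the bound applied to their differences shows that
they converge in the graph norm, so `u = K w` with `w` continuous for `t > 0`. Repeating this for
`w` gives `w = K z` and `w' = z`. Thus `u`, `u_x`, `u_xx`, `u_t` and `u_tx` have representatives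
continuous on `(0, T) × [-L, L]`, which is all that the Carleman argument needs. -/

namespace KdVB

/-! ### Weak derivatives of functions on an interval -/

/-- `g` is the weak derivative of `f` on the open interval `(a, b)`. -/
def IsWeakDeriv (a b : ℝ) (f g : ℝ → ℝ) : Prop :=
  ∀ η : ℝ → ℝ, ContDiff ℝ ∞ η → HasCompactSupport η → tsupport η ⊆ Ioo a b →
    ∫ x in Ioo a b, f x * deriv η x = - ∫ x in Ioo a b, g x * η x

theorem intervalIntegrable_of_integrableOn_Ioo {a b : ℝ} (hab : a ≤ b) {h : ℝ → ℝ}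
    (hh : IntegrableOn h (Ioo a b)) : IntervalIntegrable h volume a b := by
  rw [intervalIntegrable_iff_integrableOn_Ioc_of_le hab]
  exact hh.congr_set_ae Ioo_ae_eq_Ioc.symm

theorem setIntegral_Ioo_eq {a b : ℝ} (hab : a ≤ b) (h : ℝ → ℝ) :
    ∫ x in Ioo a b, h x = ∫ x in a..b, h x := by
  rw [intervalIntegral.integral_of_le hab, integral_Ioc_eq_integral_Ioo]

/-- The primitive of `-h` vanishing at `b`. -/
noncomputable def tail (b : ℝ) (h : ℝ → ℝ) (x : ℝ) : ℝ := ∫ y in x..b, h y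

@[simp] theorem tail_self (b : ℝ) (h : ℝ → ℝ) : tail b h b = 0 := by simp [tail]

theorem tail_eq_neg (b : ℝ) (h : ℝ → ℝ) : tail b h = fun x => -∫ y in b..x, h y := by
  funext x; rw [tail, intervalIntegral.integral_symm]

theorem absolutelyContinuous_tail {a b : ℝ} {h : ℝ → ℝ} (hh : IntervalIntegrable h volume a b) :
    AbsolutelyContinuousOnInterval (tail b h) a b := by
  rw [tail_eq_neg]
  exact (hh.absolutelyContinuousOnInterval_intervalIntegral right_mem_uIcc).neg

theorem continuousOn_tail {a b : ℝ} (hab : a ≤ b) {h : ℝ → ℝ}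
    (hh : IntervalIntegrable h volume a b) : ContinuousOn (tail b h) (Icc a b) := by
  have := (absolutelyContinuous_tail hh).continuousOn
  rwa [uIcc_of_le hab] at this

theorem ae_hasDerivAt_tail {a b : ℝ} {h : ℝ → ℝ} (hh : IntervalIntegrable h volume a b) :
    ∀ᵐ x, x ∈ uIcc a b → HasDerivAt (tail b h) (-h x) x := by
  filter_upwards [hh.ae_hasDerivAt_integral] with x hx hx'
  rw [tail_eq_neg]
  exact (hx hx' b right_mem_uIcc).neg

theorem hasDerivAt_tail {a b : ℝ} {h : ℝ → ℝ} (hh : ContinuousOn h (Icc a b)) {x : ℝ}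
    (hx : x ∈ Ioo a b) : HasDerivAt (tail b h) (-h x) x := by
  rw [tail_eq_neg]
  refine (intervalIntegral.integral_hasDerivAt_right ?_ ?_ ?_).neg
  · refine (ContinuousOn.intervalIntegrable ?_).symm
    exact hh.mono (by rw [uIcc_of_le hx.2.le]; exact Icc_subset_Icc_left hx.1.le)
  · exact (hh.mono Ioo_subset_Icc_self).stronglyMeasurableAtFilter isOpen_Ioo _ hx
  · exact (hh.mono Ioo_subset_Icc_self).continuousAt (isOpen_Ioo.mem_nhds hx)

theorem eq_zero_of_tsupport_subset {a b : ℝ} {η : ℝ → ℝ} (h : tsupport η ⊆ Ioo a b) {x : ℝ}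
    (hx : x ∉ Ioo a b) : η x = 0 :=
  image_eq_zero_of_notMem_tsupport fun h' => hx (h h')

/-- A primitive of `-h` has the weak derivative `-h`. -/
theorem isWeakDeriv_tail {a b : ℝ} (hab : a ≤ b) {h : ℝ → ℝ} (hh : IntegrableOn h (Ioo a b)) :
    IsWeakDeriv a b (tail b h) (fun x => -h x) := by
  intro η hη _ hs
  have hi := intervalIntegrable_of_integrableOn_Ioo hab hh
  have h1 : AbsolutelyContinuousOnInterval η a b :=
    ((hη.of_le (by norm_cast)).contDiffOn).absolutelyContinuousOnInterval
  have h2 := (absolutelyContinuous_tail hi).integral_mul_deriv_eq_deriv_mul h1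
  rw [setIntegral_Ioo_eq hab, setIntegral_Ioo_eq hab, h2,
    eq_zero_of_tsupport_subset hs (x := a) (by simp),
    eq_zero_of_tsupport_subset hs (x := b) (by simp)]
  simp only [mul_zero, sub_zero, zero_sub]
  congr 1
  apply intervalIntegral.integral_congr_ae
  filter_upwards [ae_hasDerivAt_tail hi] with x hx hx'
  rw [(hx (uIoc_subset_uIcc hx')).deriv]

theorem exists_Icc_of_tsupport_subset {a b : ℝ} (hab : a < b) {η : ℝ → ℝ}
    (hc : HasCompactSupport η) (hs : tsupport η ⊆ Ioo a b) :
    ∃ c d, a < c ∧ c ≤ d ∧ d < b ∧ tsupport η ⊆ Icc c d := by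
  obtain ⟨m, hm⟩ := nonempty_Ioo.2 hab
  -- Inserting a point of the interval provides extreme points even when the support is empty.
  have hK : IsCompact (insert m (tsupport η)) := hc.insert m
  have hK' : insert m (tsupport η) ⊆ Ioo a b := insert_subset hm hs
  obtain ⟨c, hc1, hc2⟩ := hK.exists_isLeast ⟨m, mem_insert _ _⟩
  obtain ⟨d, hd1, hd2⟩ := hK.exists_isGreatest ⟨m, mem_insert _ _⟩
  exact ⟨c, d, (hK' hc1).1, hc2 hd1, (hK' hd1).2,
    fun x hx => ⟨hc2 (mem_insert_of_mem _ hx), hd2 (mem_insert_of_mem _ hx)⟩⟩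

/-- A test function with integral zero is the derivative of a test function. -/
theorem exists_test_primitive {a b : ℝ} (hab : a < b) {ζ : ℝ → ℝ} (hζ : ContDiff ℝ ∞ ζ)
    (hc : HasCompactSupport ζ) (hs : tsupport ζ ⊆ Ioo a b) (h0 : ∫ x in Ioo a b, ζ x = 0) :
    ∃ η : ℝ → ℝ, ContDiff ℝ ∞ η ∧ HasCompactSupport η ∧ tsupport η ⊆ Ioo a b ∧ deriv η = ζ := by
  obtain ⟨c, d, hac, hcd, hdb, hs'⟩ := exists_Icc_of_tsupport_subset hab hc hs
  have hz : ∀ x, x ∉ Icc c d → ζ x = 0 := fun x hx =>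
    image_eq_zero_of_notMem_tsupport fun h' => hx (hs' h')
  have hcont := hζ.continuous
  have hd : deriv (fun x => ∫ y in a..x, ζ y) = ζ := by
    funext x; exact hcont.deriv_integral _ _ _
  have hdiff : Differentiable ℝ (fun x => ∫ y in a..x, ζ y) := fun x =>
    (hcont.integral_hasStrictDerivAt a x).hasDerivAt.differentiableAt
  have hsup : tsupport (fun x => ∫ y in a..x, ζ y) ⊆ Icc c d := by
    refine closure_minimal (fun x hx => ?_) isClosed_Icc
    by_contra hx'
    apply hx
    rw [mem_Icc, not_and_or, not_le, not_le] at hx'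
    rcases hx' with hx' | hx'
    · beta_reduce
      rw [← intervalIntegral.integral_zero (a := a) (b := x)]
      apply intervalIntegral.integral_congr
      intro y hy
      refine hz y fun hy' => ?_
      have := hy.2
      rcases le_max_iff.1 this with h | h <;> linarith [hy'.1]
    · beta_reduce
      rw [← intervalIntegral.integral_add_adjacent_intervals (b := b)
        (hcont.intervalIntegrable _ _) (hcont.intervalIntegrable _ _), ← setIntegral_Ioo_eq hab.le,
        h0, zero_add, ← intervalIntegral.integral_zero (a := b) (b := x)]
      apply intervalIntegral.integral_congr
      intro y hy
      refine hz y fun hy' => ?_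
      have := hy.1
      rcases min_le_iff.1 this with h | h <;> linarith [hy'.2]
  refine ⟨fun x => ∫ y in a..x, ζ y, ?_, ?_, ?_, hd⟩
  · rw [contDiff_infty_iff_deriv, hd]
    exact ⟨hdiff, hζ⟩
  · exact HasCompactSupport.of_support_subset_isCompact isCompact_Icc
      (subset_tsupport _ |>.trans hsup)
  · exact hsup.trans (fun x hx => ⟨hac.trans_le hx.1, hx.2.trans_lt hdb⟩)

theorem exists_test_integral_eq_one {a b : ℝ} (hab : a < b) :
    ∃ η : ℝ → ℝ, ContDiff ℝ ∞ η ∧ HasCompactSupport η ∧ tsupport η ⊆ Ioo a b ∧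
      ∫ x in Ioo a b, η x = 1 := by
  let f : ContDiffBump ((a + b) / 2) :=
    ⟨(b - a) / 8, (b - a) / 4, by linarith, by linarith⟩
  have hs : tsupport (f.normed volume) ⊆ Ioo a b := by
    rw [f.tsupport_normed_eq, Real.closedBall_eq_Icc]
    intro x hx
    simp only [f, mem_Icc] at hx
    constructor <;> linarith [hx.1, hx.2]
  refine ⟨f.normed volume, f.contDiff_normed, f.hasCompactSupport_normed, hs, ?_⟩
  rw [setIntegral_eq_integral_of_forall_compl_eq_zero, f.integral_normed]
  exact fun x hx => eq_zero_of_tsupport_subset hs hx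

theorem integrableOn_mul_test {a b : ℝ} {f η : ℝ → ℝ} (hf : IntegrableOn f (Ioo a b))
    (hη : Continuous η) (hc : HasCompactSupport η) :
    IntegrableOn (fun x => f x * η x) (Ioo a b) := by
  obtain ⟨C, hC⟩ := hc.exists_bound_of_continuous hη
  exact hf.mul_bdd (c := C) hη.aestronglyMeasurable (Filter.Eventually.of_forall hC)

theorem ae_eq_zero_of_forall_test {a b : ℝ} {f : ℝ → ℝ} (hf : IntegrableOn f (Ioo a b))
    (h : ∀ η : ℝ → ℝ, ContDiff ℝ ∞ η → HasCompactSupport η → tsupport η ⊆ Ioo a b →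
      ∫ x in Ioo a b, f x * η x = 0) : ∀ᵐ x ∂(volume.restrict (Ioo a b)), f x = 0 := by
  rw [ae_restrict_iff' measurableSet_Ioo]
  refine isOpen_Ioo.ae_eq_zero_of_integral_contDiff_smul_eq_zero hf.locallyIntegrableOn ?_
  intro η h1 h2 h3
  rw [← h η h1 h2 h3, setIntegral_eq_integral_of_forall_compl_eq_zero]
  · simp_rw [smul_eq_mul, mul_comm]
  · intro x hx
    rw [eq_zero_of_tsupport_subset h3 hx, mul_zero]

theorem IsWeakDeriv.ae_unique {a b : ℝ} {f g g' : ℝ → ℝ} (h : IsWeakDeriv a b f g)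
    (h' : IsWeakDeriv a b f g') (hg : IntegrableOn g (Ioo a b)) (hg' : IntegrableOn g' (Ioo a b)) :
    ∀ᵐ x ∂(volume.restrict (Ioo a b)), g x = g' x := by
  have := ae_eq_zero_of_forall_test (hg.sub hg') fun η h1 h2 h3 => by
    have e := (h η h1 h2 h3).symm.trans (h' η h1 h2 h3)
    simp only [Pi.sub_apply, sub_mul]
    rw [integral_sub (integrableOn_mul_test hg h1.continuous h2)
      (integrableOn_mul_test hg' h1.continuous h2)]
    linarith
  filter_upwards [this] with x hx
  simpa [sub_eq_zero] using hx

/-- The lemma of du Bois-Reymond. -/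
theorem IsWeakDeriv.exists_eq_sub_tail {a b : ℝ} (hab : a < b) {f g : ℝ → ℝ}
    (h : IsWeakDeriv a b f g) (hf : IntegrableOn f (Ioo a b)) (hg : IntegrableOn g (Ioo a b)) :
    ∃ c, ∀ᵐ x ∂(volume.restrict (Ioo a b)), f x = c - tail b g x := by
  obtain ⟨η₀, e1, e2, e3, e4⟩ := exists_test_integral_eq_one hab
  have ht : IntegrableOn (tail b g) (Ioo a b) :=
    ((continuousOn_tail hab.le
      (intervalIntegrable_of_integrableOn_Ioo hab.le hg)).integrableOn_Icc).mono_set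
      Ioo_subset_Icc_self
  set q : ℝ → ℝ := fun x => f x + tail b g x with hq
  have hqi : IntegrableOn q (Ioo a b) := hf.add ht
  have hq0 : ∀ η : ℝ → ℝ, ContDiff ℝ ∞ η → HasCompactSupport η → tsupport η ⊆ Ioo a b →
      ∫ x in Ioo a b, q x * deriv η x = 0 := by
    intro η h1 h2 h3
    have hdc : Continuous (deriv η) := h1.continuous_deriv (by norm_cast)
    simp only [hq, add_mul]
    rw [integral_add (integrableOn_mul_test hf hdc h2.deriv)
      (integrableOn_mul_test ht hdc h2.deriv), h η h1 h2 h3, isWeakDeriv_tail hab.le hg η h1 h2 h3]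
    simp only [neg_mul]
    rw [integral_neg]
    ring
  refine ⟨∫ x in Ioo a b, q x * η₀ x, ?_⟩
  set c := ∫ x in Ioo a b, q x * η₀ x with hc
  have := ae_eq_zero_of_forall_test (f := fun x => q x - c)
      (hqi.sub (integrableOn_const (by simp))) fun ζ h1 h2 h3 => by
    have i1 : IntegrableOn ζ (Ioo a b) := (h1.continuous.integrable_of_hasCompactSupport h2).integrableOn
    have i0 : IntegrableOn η₀ (Ioo a b) :=
      (e1.continuous.integrable_of_hasCompactSupport e2).integrableOn
    set I := ∫ x in Ioo a b, ζ x with hI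
    have hcs : HasCompactSupport (fun x => ζ x - I * η₀ x) := h2.sub (e2.mul_left (f := fun _ => I))
    -- Subtracting `I η₀` removes the mean of `ζ`, so the difference is the derivative of a test
    -- function, and `q` annihilates such derivatives.
    obtain ⟨η, t1, t2, t3, t4⟩ := exists_test_primitive hab (ζ := fun x => ζ x - I * η₀ x)
      (h1.sub (contDiff_const.mul e1)) hcs
      ((tsupport_sub _ _).trans (union_subset h3
        ((tsupport_mul_subset_right (f := fun _ => I)).trans e3)))
      (by rw [integral_sub i1 (i0.const_mul I), integral_const_mul, e4]; ring)
    have := hq0 η t1 t2 t3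
    rw [t4] at this
    have e : ∀ x, q x * (ζ x - I * η₀ x) = q x * ζ x - I * (q x * η₀ x) := fun x => by ring
    simp only [e] at this
    rw [integral_sub (integrableOn_mul_test hqi h1.continuous h2)
      ((integrableOn_mul_test hqi e1.continuous e2).const_mul I), integral_const_mul] at this
    simp only [sub_mul]
    rw [integral_sub (integrableOn_mul_test hqi h1.continuous h2) (i1.const_mul c),
      integral_const_mul]
    linarith
  filter_upwards [this] with x hx
  simp only [hq] at hx
  linarith

/-! ### The solution operator of the boundary value problem `F'' - F''' = h` -/

theorem tail_congr {a b : ℝ} {f g : ℝ → ℝ} (h : ∀ᵐ x ∂(volume.restrict (Ioo a b)), f x = g x)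
    {x : ℝ} (hx : x ∈ Icc a b) : tail b f x = tail b g x := by
  have h' := ae_restrict_of_ae_restrict_of_subset (Ioo_subset_Ioo_left hx.1) h
  rw [tail, tail, ← setIntegral_Ioo_eq hx.2, ← setIntegral_Ioo_eq hx.2]
  exact integral_congr_ae h'

/-- The combination `α f + g` records additivity and homogeneity in one identity; it is carried
through all the primitives up to `exists_clm_of_bound`. -/
theorem tail_mul_add {a b : ℝ} {f g : ℝ → ℝ} (hf : IntegrableOn f (Ioo a b))
    (hg : IntegrableOn g (Ioo a b)) (α : ℝ) {x : ℝ} (hx : x ∈ Icc a b) :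
    tail b (fun y => α * f y + g y) x = α * tail b f x + tail b g x := by
  have hf' := intervalIntegrable_of_integrableOn_Ioo hx.2 (hf.mono_set (Ioo_subset_Ioo_left hx.1))
  have hg' := intervalIntegrable_of_integrableOn_Ioo hx.2 (hg.mono_set (Ioo_subset_Ioo_left hx.1))
  simp only [tail]
  rw [intervalIntegral.integral_add (hf'.const_mul α) hg', intervalIntegral.integral_const_mul]

theorem abs_tail_le {a b : ℝ} {f : ℝ → ℝ} (hf : IntegrableOn f (Ioo a b)) {x : ℝ}
    (hx : x ∈ Icc a b) : |tail b f x| ≤ ∫ y in Ioo a b, |f y| := by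
  rw [tail, ← setIntegral_Ioo_eq hx.2]
  refine (abs_integral_le_integral_abs).trans ?_
  exact setIntegral_mono_set hf.abs (Filter.Eventually.of_forall fun _ => abs_nonneg _)
    (Ioo_subset_Ioo_left hx.1).eventuallyLE

theorem abs_tail_le_of_abs_le {a b : ℝ} {f : ℝ → ℝ} {C : ℝ} (hf : ∀ x ∈ Icc a b, |f x| ≤ C) {x : ℝ}
    (hx : x ∈ Icc a b) : |tail b f x| ≤ C * (b - a) := by
  have hC : 0 ≤ C := (abs_nonneg _).trans (hf x hx)
  have := intervalIntegral.norm_integral_le_of_norm_le_const (a := x) (b := b) (f := f) (C := C)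
    (fun y hy => by
      rw [uIoc_of_le hx.2] at hy
      exact hf y ⟨hx.1.trans hy.1.le, hy.2⟩)
  rw [abs_of_nonneg (sub_nonneg.2 hx.2)] at this
  exact this.trans (mul_le_mul_of_nonneg_left (by linarith [hx.1]) hC)

/-- The solution vanishing at `L` of `f - f' = h`. -/
noncomputable def expTail (L : ℝ) (h : ℝ → ℝ) (x : ℝ) : ℝ :=
  Real.exp x * tail L (fun y => Real.exp (-y) * h y) x

/-- The constant which makes `G0 L h` vanish at `-L`. -/
noncomputable def cst (L : ℝ) (h : ℝ → ℝ) : ℝ :=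
  -(tail L (tail L (expTail L h)) (-L) / tail L (tail L Real.exp) (-L))

/-- The second derivative of `G0 L h`. -/
noncomputable def G2 (L : ℝ) (h : ℝ → ℝ) (x : ℝ) : ℝ := cst L h * Real.exp x + expTail L h x

/-- The first derivative of `G0 L h`. -/
noncomputable def G1 (L : ℝ) (h : ℝ → ℝ) (x : ℝ) : ℝ := -tail L (G2 L h) x

/-- The solution of `F'' - F''' = h`, `F(-L) = F(L) = F'(L) = 0`. -/
noncomputable def G0 (L : ℝ) (h : ℝ → ℝ) (x : ℝ) : ℝ := -tail L (G1 L h) x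

section

variable {L : ℝ} {h k : ℝ → ℝ}

theorem integrableOn_exp_mul (hh : IntegrableOn h (Ioo (-L) L)) :
    IntegrableOn (fun y => Real.exp (-y) * h y) (Ioo (-L) L) := by
  refine Integrable.bdd_mul (c := Real.exp L) hh (by fun_prop) ?_
  filter_upwards [ae_restrict_mem measurableSet_Ioo] with y hy
  rw [Real.norm_of_nonneg (Real.exp_nonneg _)]
  exact Real.exp_le_exp.2 (by linarith [hy.1])

theorem integrableOn_of_continuousOn (hf : ContinuousOn h (Icc (-L) L)) :
    IntegrableOn h (Ioo (-L) L) := hf.integrableOn_Icc.mono_set Ioo_subset_Icc_self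

theorem continuousOn_tail' (hL : 0 < L) (hh : IntegrableOn h (Ioo (-L) L)) :
    ContinuousOn (tail L h) (Icc (-L) L) :=
  continuousOn_tail (by linarith) (intervalIntegrable_of_integrableOn_Ioo (by linarith) hh)

theorem continuousOn_expTail (hL : 0 < L) (hh : IntegrableOn h (Ioo (-L) L)) :
    ContinuousOn (expTail L h) (Icc (-L) L) :=
  Real.continuous_exp.continuousOn.mul (continuousOn_tail' hL (integrableOn_exp_mul hh))

theorem continuousOn_G2 (hL : 0 < L) (hh : IntegrableOn h (Ioo (-L) L)) :
    ContinuousOn (G2 L h) (Icc (-L) L) :=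
  (by fun_prop : Continuous fun x => cst L h * Real.exp x).continuousOn.add
    (continuousOn_expTail hL hh)

theorem continuousOn_G1 (hL : 0 < L) (hh : IntegrableOn h (Ioo (-L) L)) :
    ContinuousOn (G1 L h) (Icc (-L) L) :=
  (continuousOn_tail' hL (integrableOn_of_continuousOn (continuousOn_G2 hL hh))).neg

theorem continuousOn_G0 (hL : 0 < L) (hh : IntegrableOn h (Ioo (-L) L)) :
    ContinuousOn (G0 L h) (Icc (-L) L) :=
  (continuousOn_tail' hL (integrableOn_of_continuousOn (continuousOn_G1 hL hh))).neg

theorem hasDerivAt_G1 (hL : 0 < L) (hh : IntegrableOn h (Ioo (-L) L)) {x : ℝ}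
    (hx : x ∈ Ioo (-L) L) : HasDerivAt (G1 L h) (G2 L h x) x := by
  have := (hasDerivAt_tail (continuousOn_G2 hL hh) hx).neg
  rwa [neg_neg] at this

theorem hasDerivAt_G0 (hL : 0 < L) (hh : IntegrableOn h (Ioo (-L) L)) {x : ℝ}
    (hx : x ∈ Ioo (-L) L) : HasDerivAt (G0 L h) (G1 L h x) x := by
  have := (hasDerivAt_tail (continuousOn_G1 hL hh) hx).neg
  rwa [neg_neg] at this

/-- An element of `L²` has no pointwise values, but primitives ignore null sets, so the derivative
can be taken with a continuous representative `H`. The case of interest is `h = K k`, `H = G0 L k`.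
-/
theorem hasDerivAt_G2 {H : ℝ → ℝ} (hH : ContinuousOn H (Icc (-L) L))
    (hh : ∀ᵐ x ∂(volume.restrict (Ioo (-L) L)), h x = H x) {x : ℝ}
    (hx : x ∈ Ioo (-L) L) : HasDerivAt (G2 L h) (G2 L h x - H x) x := by
  have e : ∀ y ∈ Icc (-L) L, tail L (fun y => Real.exp (-y) * h y) y =
      tail L (fun y => Real.exp (-y) * H y) y := fun y hy =>
    tail_congr (by filter_upwards [hh] with z hz; rw [hz]) hy
  have h1 : HasDerivAt (tail L (fun y => Real.exp (-y) * h y)) (-(Real.exp (-x) * H x)) x := by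
    refine (hasDerivAt_tail (h := fun y => Real.exp (-y) * H y) (a := -L)
      ((by fun_prop : Continuous fun y : ℝ => Real.exp (-y)).continuousOn.mul hH)
      hx).congr_of_eventuallyEq ?_
    filter_upwards [isOpen_Ioo.mem_nhds hx] with y hy using e y (Ioo_subset_Icc_self hy)
  have h2 := ((Real.hasDerivAt_exp x).const_mul (cst L h)).add ((Real.hasDerivAt_exp x).mul h1)
  refine h2.congr_deriv ?_
  simp only [G2, expTail]
  have : Real.exp x * Real.exp (-x) = 1 := by rw [← Real.exp_add]; simp
  linear_combination (-H x) * this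

@[simp] theorem G1_right : G1 L h L = 0 := by simp [G1]

@[simp] theorem G0_right : G0 L h L = 0 := by simp [G0]

/-- This is the slope with which the free constant in the second derivative enters the value at
`-L`; being nonzero, it makes the boundary condition there uniquely solvable. -/
theorem tail_tail_exp_pos (hL : 0 < L) : 0 < tail L (tail L Real.exp) (-L) := by
  have h1 : ∀ x, tail L Real.exp x = Real.exp L - Real.exp x := fun x => by
    rw [tail, integral_exp]
  have h2 : tail L Real.exp = fun x => Real.exp L - Real.exp x := funext h1
  rw [h2, tail]
  apply intervalIntegral.intervalIntegral_pos_of_pos_on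
  · exact Continuous.intervalIntegrable (by fun_prop) _ _
  · intro x hx
    simpa using hx.2
  · linarith

theorem G0_eq (hL : 0 < L) (hh : IntegrableOn h (Ioo (-L) L)) (c : ℝ) {x : ℝ}
    (hx : x ∈ Icc (-L) L) :
    tail L (tail L (fun y => c * Real.exp y + expTail L h y)) x =
      c * tail L (tail L Real.exp) x + tail L (tail L (expTail L h)) x := by
  have i1 : IntegrableOn Real.exp (Ioo (-L) L) :=
    integrableOn_of_continuousOn Real.continuous_exp.continuousOn
  have i2 := integrableOn_of_continuousOn (continuousOn_expTail hL hh)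
  rw [← tail_mul_add (integrableOn_of_continuousOn (continuousOn_tail' hL i1))
    (integrableOn_of_continuousOn (continuousOn_tail' hL i2)) c hx]
  refine tail_congr ?_ hx
  filter_upwards [ae_restrict_mem measurableSet_Ioo] with y hy
  exact tail_mul_add i1 i2 c (Ioo_subset_Icc_self hy)

theorem G0_eq_tail_tail : G0 L h = tail L (tail L (G2 L h)) := by
  funext x
  simp only [G0, G1, tail]
  rw [intervalIntegral.integral_neg, neg_neg]

theorem G0_left (hL : 0 < L) (hh : IntegrableOn h (Ioo (-L) L)) : G0 L h (-L) = 0 := by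
  rw [G0_eq_tail_tail]
  refine (G0_eq hL hh (cst L h) ⟨le_rfl, by linarith⟩).trans ?_
  rw [cst, neg_mul, div_mul_cancel₀ _ (tail_tail_exp_pos hL).ne']
  ring

theorem expTail_mul_add (hh : IntegrableOn h (Ioo (-L) L)) (hk : IntegrableOn k (Ioo (-L) L))
    (α : ℝ) {x : ℝ} (hx : x ∈ Icc (-L) L) :
    expTail L (fun y => α * h y + k y) x = α * expTail L h x + expTail L k x := by
  have : (fun y => Real.exp (-y) * (α * h y + k y)) =
    fun y => α * (Real.exp (-y) * h y) + Real.exp (-y) * k y := by funext y; ring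
  rw [expTail, this, tail_mul_add (integrableOn_exp_mul hh) (integrableOn_exp_mul hk) α hx]
  simp only [expTail]; ring

theorem tail_mul_add_of_eqOn {a b : ℝ} {p f g : ℝ → ℝ} (hf : ContinuousOn f (Icc a b))
    (hg : ContinuousOn g (Icc a b)) (α : ℝ) (hp : ∀ y ∈ Icc a b, p y = α * f y + g y) {x : ℝ}
    (hx : x ∈ Icc a b) : tail b p x = α * tail b f x + tail b g x := by
  rw [← tail_mul_add (hf.integrableOn_Icc.mono_set Ioo_subset_Icc_self)
    (hg.integrableOn_Icc.mono_set Ioo_subset_Icc_self) α hx]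
  refine tail_congr ?_ hx
  filter_upwards [ae_restrict_mem measurableSet_Ioo] with y hy
  exact hp y (Ioo_subset_Icc_self hy)

theorem cst_mul_add (hL : 0 < L) (hh : IntegrableOn h (Ioo (-L) L))
    (hk : IntegrableOn k (Ioo (-L) L)) (α : ℝ) :
    cst L (fun y => α * h y + k y) = α * cst L h + cst L k := by
  have c1 := continuousOn_expTail hL hh
  have c2 := continuousOn_expTail hL hk
  have t1 := continuousOn_tail' hL (integrableOn_of_continuousOn c1)
  have t2 := continuousOn_tail' hL (integrableOn_of_continuousOn c2)
  have := tail_mul_add_of_eqOn t1 t2 α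
    (fun y hy => tail_mul_add_of_eqOn c1 c2 α (fun z hz => expTail_mul_add hh hk α hz) hy)
    (x := -L) ⟨le_rfl, by linarith⟩
  rw [cst, this]
  simp only [cst]; ring

theorem G2_mul_add (hL : 0 < L) (hh : IntegrableOn h (Ioo (-L) L))
    (hk : IntegrableOn k (Ioo (-L) L)) (α : ℝ) {x : ℝ} (hx : x ∈ Icc (-L) L) :
    G2 L (fun y => α * h y + k y) x = α * G2 L h x + G2 L k x := by
  simp only [G2]
  rw [cst_mul_add hL hh hk, expTail_mul_add hh hk α hx]
  ring

theorem G1_mul_add (hL : 0 < L) (hh : IntegrableOn h (Ioo (-L) L))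
    (hk : IntegrableOn k (Ioo (-L) L)) (α : ℝ) {x : ℝ} (hx : x ∈ Icc (-L) L) :
    G1 L (fun y => α * h y + k y) x = α * G1 L h x + G1 L k x := by
  simp only [G1]
  rw [tail_mul_add_of_eqOn (continuousOn_G2 hL hh) (continuousOn_G2 hL hk) α
    (fun y hy => G2_mul_add hL hh hk α hy) hx]
  ring

theorem G0_mul_add (hL : 0 < L) (hh : IntegrableOn h (Ioo (-L) L))
    (hk : IntegrableOn k (Ioo (-L) L)) (α : ℝ) {x : ℝ} (hx : x ∈ Icc (-L) L) :
    G0 L (fun y => α * h y + k y) x = α * G0 L h x + G0 L k x := by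
  simp only [G0]
  rw [tail_mul_add_of_eqOn (continuousOn_G1 hL hh) (continuousOn_G1 hL hk) α
    (fun y hy => G1_mul_add hL hh hk α hy) hx]
  ring

theorem expTail_congr (he : ∀ᵐ x ∂(volume.restrict (Ioo (-L) L)), h x = k x) {x : ℝ}
    (hx : x ∈ Icc (-L) L) : expTail L h x = expTail L k x := by
  rw [expTail, expTail, tail_congr _ hx]
  filter_upwards [he] with y hy
  rw [hy]

theorem tail_congr_of_eqOn {a b : ℝ} {f g : ℝ → ℝ} (h : ∀ x ∈ Icc a b, f x = g x) {x : ℝ}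
    (hx : x ∈ Icc a b) : tail b f x = tail b g x := by
  refine tail_congr ?_ hx
  filter_upwards [ae_restrict_mem measurableSet_Ioo] with y hy
  exact h y (Ioo_subset_Icc_self hy)

theorem G2_congr (hL : 0 < L) (he : ∀ᵐ x ∂(volume.restrict (Ioo (-L) L)), h x = k x) {x : ℝ}
    (hx : x ∈ Icc (-L) L) : G2 L h x = G2 L k x := by
  rw [G2, G2, cst, cst, expTail_congr he hx, tail_congr_of_eqOn (fun y hy =>
    tail_congr_of_eqOn (fun z hz => expTail_congr he hz) hy) (x := -L) ⟨le_rfl, by linarith⟩]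

theorem G1_congr (hL : 0 < L) (he : ∀ᵐ x ∂(volume.restrict (Ioo (-L) L)), h x = k x) {x : ℝ}
    (hx : x ∈ Icc (-L) L) : G1 L h x = G1 L k x := by
  rw [G1, G1, tail_congr_of_eqOn (fun y hy => G2_congr hL he hy) hx]

theorem G0_congr (hL : 0 < L) (he : ∀ᵐ x ∂(volume.restrict (Ioo (-L) L)), h x = k x) {x : ℝ}
    (hx : x ∈ Icc (-L) L) : G0 L h x = G0 L k x := by
  rw [G0, G0, tail_congr_of_eqOn (fun y hy => G1_congr hL he hy) hx]

end

/-! ### Bounds for the solution operator on `L²`. -/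

theorem integrableOn_L2 {L : ℝ} (h : L2 L) : IntegrableOn h (Ioo (-L) L) :=
  (Lp.memLp h).integrable (by norm_num)

theorem integral_abs_le_norm {L : ℝ} (hL : 0 < L) (h : L2 L) :
    ∫ x in Ioo (-L) L, |h x| ≤ Real.sqrt (2 * L) * ‖h‖ := by
  have h1 := eLpNorm_le_eLpNorm_mul_rpow_measure_univ (p := 1) (q := 2) (by norm_num)
    (Lp.memLp h).1
  have h2 : ∫ x in Ioo (-L) L, |h x| = (eLpNorm h 1 (volume.restrict (Ioo (-L) L))).toReal := by
    rw [eLpNorm_one_eq_lintegral_enorm, ← integral_norm_eq_lintegral_enorm (Lp.memLp h).1]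
    rfl
  rw [h2, Lp.norm_def]
  refine (ENNReal.toReal_mono ?_ h1).trans (le_of_eq ?_)
  · refine ENNReal.mul_ne_top (Lp.eLpNorm_ne_top h) ?_
    exact ENNReal.rpow_ne_top_of_nonneg (by norm_num) (by simp)
  · rw [ENNReal.toReal_mul, mul_comm, ← ENNReal.toReal_rpow, Real.sqrt_eq_rpow]
    congr 2
    · simp only [Measure.restrict_apply_univ, Real.volume_Ioo]
      rw [ENNReal.toReal_ofReal (by linarith)]; ring
    · norm_num

theorem abs_expTail_le {L : ℝ} {h : ℝ → ℝ} (hh : IntegrableOn h (Ioo (-L) L)) {x : ℝ}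
    (hx : x ∈ Icc (-L) L) :
    |expTail L h x| ≤ Real.exp (2 * L) * ∫ y in Ioo (-L) L, |h y| := by
  rw [expTail, abs_mul, Real.abs_exp, two_mul, Real.exp_add, mul_assoc]
  refine mul_le_mul (Real.exp_le_exp.2 hx.2) ?_ (abs_nonneg _) (Real.exp_nonneg _)
  refine (abs_tail_le (integrableOn_exp_mul hh) hx).trans ?_
  rw [← integral_const_mul]
  refine setIntegral_mono_on (integrableOn_exp_mul hh).abs (hh.abs.const_mul _)
    measurableSet_Ioo fun y hy => ?_
  rw [abs_mul, Real.abs_exp]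
  exact mul_le_mul_of_nonneg_right (Real.exp_le_exp.2 (by linarith [hy.1])) (abs_nonneg _)

/-- Every primitive costs at most a factor `2L`, and `cst` has a fixed positive denominator. These
sup bounds by the `L²` norm yield continuity of `K`, bounded point evaluations and the growth of the
flow. -/
theorem exists_G_bound {L : ℝ} (hL : 0 < L) : ∃ C : ℝ, 0 < C ∧ ∀ h : L2 L, ∀ x ∈ Icc (-L) L,
    |G0 L h x| ≤ C * ‖h‖ ∧ |G1 L h x| ≤ C * ‖h‖ ∧ |G2 L h x| ≤ C * ‖h‖ := by
  set τ := tail L (tail L Real.exp) (-L) with hτ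
  have hτ0 : 0 < τ := tail_tail_exp_pos hL
  set A := Real.exp (2 * L) * Real.sqrt (2 * L) with hA
  have hA0 : 0 < A := by positivity
  set B := A * (2 * L) * (2 * L) / τ * Real.exp L + A with hB
  have hB0 : 0 < B := by positivity
  have key : ∀ h : L2 L, ∀ x ∈ Icc (-L) L, |G2 L h x| ≤ B * ‖h‖ := by
    intro h x hx
    have e1 : ∀ y ∈ Icc (-L) L, |expTail L h y| ≤ A * ‖h‖ := fun y hy => by
      refine (abs_expTail_le (integrableOn_L2 h) hy).trans ?_
      rw [hA, mul_assoc]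
      exact mul_le_mul_of_nonneg_left (integral_abs_le_norm hL h) (Real.exp_nonneg _)
    have e2 := abs_tail_le_of_abs_le (fun y hy => abs_tail_le_of_abs_le e1 hy)
      (x := -L) ⟨le_rfl, by linarith⟩
    have e3 : |cst L h| ≤ A * (2 * L) * (2 * L) / τ * ‖h‖ := by
      rw [cst, abs_neg, abs_div, abs_of_pos hτ0, div_mul_eq_mul_div]
      refine div_le_div_of_nonneg_right (e2.trans (le_of_eq ?_)) hτ0.le
      ring
    rw [G2]
    refine (abs_add_le _ _).trans ?_
    rw [abs_mul, Real.abs_exp, hB, add_mul, mul_right_comm]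
    refine add_le_add (mul_le_mul e3 (Real.exp_le_exp.2 hx.2) (Real.exp_nonneg _) ?_) (e1 x hx)
    positivity
  have key1 : ∀ h : L2 L, ∀ x ∈ Icc (-L) L, |G1 L h x| ≤ B * (2 * L) * ‖h‖ := by
    intro h x hx
    rw [G1, abs_neg]
    exact (abs_tail_le_of_abs_le (key h) hx).trans (le_of_eq (by ring))
  have key0 : ∀ h : L2 L, ∀ x ∈ Icc (-L) L, |G0 L h x| ≤ B * (2 * L) * (2 * L) * ‖h‖ := by
    intro h x hx
    rw [G0, abs_neg]
    exact (abs_tail_le_of_abs_le (key1 h) hx).trans (le_of_eq (by ring))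
  refine ⟨B + B * (2 * L) + B * (2 * L) * (2 * L), by positivity, fun h x hx => ⟨?_, ?_, ?_⟩⟩
  · refine (key0 h x hx).trans (mul_le_mul_of_nonneg_right ?_ (norm_nonneg _))
    have : 0 < B + B * (2 * L) := by positivity
    linarith
  · refine (key1 h x hx).trans (mul_le_mul_of_nonneg_right ?_ (norm_nonneg _))
    have : 0 < B + B * (2 * L) * (2 * L) := by positivity
    linarith
  · refine (key h x hx).trans (mul_le_mul_of_nonneg_right ?_ (norm_nonneg _))
    have : 0 < B * (2 * L) + B * (2 * L) * (2 * L) := by positivity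
    linarith

theorem coe_smul_add_ae {L : ℝ} (α : ℝ) (h k : L2 L) :
    ∀ᵐ x ∂(volume.restrict (Ioo (-L) L)), (α • h + k : L2 L) x = α * h x + k x := by
  filter_upwards [Lp.coeFn_add (α • h) k, Lp.coeFn_smul α h] with x h1 h2
  rw [h1, Pi.add_apply, h2, Pi.smul_apply, smul_eq_mul]

theorem G2_smul_add {L : ℝ} (hL : 0 < L) (α : ℝ) (h k : L2 L) {x : ℝ} (hx : x ∈ Icc (-L) L) :
    G2 L (α • h + k : L2 L) x = α * G2 L h x + G2 L k x := by
  rw [G2_congr hL (coe_smul_add_ae α h k) hx,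
    G2_mul_add hL (integrableOn_L2 h) (integrableOn_L2 k) α hx]

theorem G1_smul_add {L : ℝ} (hL : 0 < L) (α : ℝ) (h k : L2 L) {x : ℝ} (hx : x ∈ Icc (-L) L) :
    G1 L (α • h + k : L2 L) x = α * G1 L h x + G1 L k x := by
  rw [G1_congr hL (coe_smul_add_ae α h k) hx,
    G1_mul_add hL (integrableOn_L2 h) (integrableOn_L2 k) α hx]

theorem G0_smul_add {L : ℝ} (hL : 0 < L) (α : ℝ) (h k : L2 L) {x : ℝ} (hx : x ∈ Icc (-L) L) :
    G0 L (α • h + k : L2 L) x = α * G0 L h x + G0 L k x := by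
  rw [G0_congr hL (coe_smul_add_ae α h k) hx,
    G0_mul_add hL (integrableOn_L2 h) (integrableOn_L2 k) α hx]

/-- A bounded function which is compatible with the expressions `α • h + k` is a continuous
linear map. -/
theorem exists_clm_of_bound {E F : Type*} [NormedAddCommGroup E] [NormedSpace ℝ E]
    [NormedAddCommGroup F] [NormedSpace ℝ F] (φ : E → F) {C : ℝ}
    (h1 : ∀ (α : ℝ) h k, φ (α • h + k) = α • φ h + φ k) (h2 : ∀ h, ‖φ h‖ ≤ C * ‖h‖) :
    ∃ ℓ : E →L[ℝ] F, ∀ h, ℓ h = φ h := by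
  have h0 : φ 0 = 0 := by simpa using h2 0
  refine ⟨LinearMap.mkContinuous ⟨⟨φ, fun h k => ?_⟩, fun α h => ?_⟩ C h2, fun h => rfl⟩
  · simpa using h1 1 h k
  · simpa [h0] using h1 α h 0

theorem memLp_of_continuousOn {L : ℝ} {f : ℝ → ℝ} (hf : ContinuousOn f (Icc (-L) L)) :
    MemLp f 2 (volume.restrict (Ioo (-L) L)) := by
  obtain ⟨C, hC⟩ := isCompact_Icc.exists_bound_of_continuousOn hf
  refine MemLp.of_bound ((hf.mono Ioo_subset_Icc_self).aestronglyMeasurable measurableSet_Ioo) C ?_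
  filter_upwards [ae_restrict_mem measurableSet_Ioo] with x hx
  exact hC x (Ioo_subset_Icc_self hx)

theorem exists_solutionOp {L : ℝ} (hL : 0 < L) : ∃ K : L2 L →L[ℝ] L2 L, ∀ h : L2 L,
    ∀ᵐ x ∂(volume.restrict (Ioo (-L) L)), K h x = G0 L h x := by
  obtain ⟨C, hC, hb⟩ := exists_G_bound hL
  have hm : ∀ h : L2 L, MemLp (G0 L h) 2 (volume.restrict (Ioo (-L) L)) := fun h =>
    memLp_of_continuousOn (continuousOn_G0 hL (integrableOn_L2 h))
  obtain ⟨K, hK⟩ := exists_clm_of_bound (fun h : L2 L => (hm h).toLp) (C :=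
    (measureUnivNNReal (volume.restrict (Ioo (-L) L)) : ℝ) ^ (2 : ℝ≥0∞).toReal⁻¹ * C) (by
      intro α h k
      apply Lp.ext
      filter_upwards [(hm (α • h + k)).coeFn_toLp, (hm h).coeFn_toLp, (hm k).coeFn_toLp,
        coe_smul_add_ae α (hm h).toLp (hm k).toLp, ae_restrict_mem measurableSet_Ioo]
        with x e1 e2 e3 e4 e5
      rw [e1, e4, e2, e3, G0_smul_add hL α h k (Ioo_subset_Icc_self e5)])
    (fun h => by
      rw [mul_assoc]
      refine Lp.norm_le_of_ae_bound (by positivity) ?_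
      filter_upwards [(hm h).coeFn_toLp, ae_restrict_mem measurableSet_Ioo] with x e1 e2
      rw [e1]
      exact (hb h x (Ioo_subset_Icc_self e2)).1)
  refine ⟨K, fun h => ?_⟩
  filter_upwards [(hm h).coeFn_toLp] with x e1
  rw [hK, e1]

/-- The solution operator `h ↦ F` of `F'' - F''' = h`, `F(-L) = F(L) = F'(L) = 0`. -/
noncomputable def K {L : ℝ} (hL : 0 < L) : L2 L →L[ℝ] L2 L := (exists_solutionOp hL).choose

theorem K_ae_eq {L : ℝ} (hL : 0 < L) (h : L2 L) :
    ∀ᵐ x ∂(volume.restrict (Ioo (-L) L)), K hL h x = G0 L h x :=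
  (exists_solutionOp hL).choose_spec h

/-- A bounded functional carries a time derivative in `L²` to a time derivative of the
representative at every single point `x`. -/
theorem exists_eval_G0 {L : ℝ} (hL : 0 < L) {x : ℝ} (hx : x ∈ Icc (-L) L) :
    ∃ ℓ : L2 L →L[ℝ] ℝ, ∀ h : L2 L, ℓ h = G0 L h x := by
  obtain ⟨C, hC, hb⟩ := exists_G_bound hL
  exact exists_clm_of_bound _ (fun α h k => G0_smul_add hL α h k hx) fun h => (hb h x hx).1

theorem exists_eval_G1 {L : ℝ} (hL : 0 < L) {x : ℝ} (hx : x ∈ Icc (-L) L) :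
    ∃ ℓ : L2 L →L[ℝ] ℝ, ∀ h : L2 L, ℓ h = G1 L h x := by
  obtain ⟨C, hC, hb⟩ := exists_G_bound hL
  exact exists_clm_of_bound _ (fun α h k => G1_smul_add hL α h k hx) fun h => (hb h x hx).2.1

/-- `A f = h` implies `f = K h`. -/
theorem GraphA.eq_K {L : ℝ} (hL : 0 < L) {f h : L2 L} (hg : GraphA L f h) : f = K hL h := by
  obtain ⟨f₁, f₂, f₃, w1, w2, w3, t1, t2, t3, rfl⟩ := hg
  set h : L2 L := f₂ - f₃ with hh
  have hlt : -L < L := by linarith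
  have hle := hlt.le
  -- The integrating factor turns `f₂ - f₃ = h` into `(e^{-x} f₂)' = -e^{-x} h`.
  have hw : IsWeakDeriv (-L) L (fun x => Real.exp (-x) * f₂ x)
      (fun x => -(Real.exp (-x) * h x)) := by
    intro η e1 e2 e3
    have e4 : ContDiff ℝ ∞ (fun x => Real.exp (-x) * η x) := by fun_prop
    have e5 : HasCompactSupport (fun x => Real.exp (-x) * η x) := e2.mul_left
    have e6 : tsupport (fun x => Real.exp (-x) * η x) ⊆ Ioo (-L) L :=
      (tsupport_mul_subset_right).trans e3
    have := w3 _ e4 e5 e6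
    have e7 : ∀ x, deriv (fun x => Real.exp (-x) * η x) x =
        Real.exp (-x) * deriv η x - Real.exp (-x) * η x := fun x => by
      have d1 : HasDerivAt (fun x : ℝ => Real.exp (-x)) (-Real.exp (-x)) x := by
        simpa using (hasDerivAt_neg x).exp
      have d2 : HasDerivAt η (deriv η x) x :=
        ((e1.differentiable (by simp)) x).hasDerivAt
      refine (d1.mul d2).deriv.trans ?_
      ring
    have hdc : Continuous (deriv η) := e1.continuous_deriv (by norm_cast)
    have i1 : IntegrableOn (fun x => Real.exp (-x) * f₂ x * deriv η x) (Ioo (-L) L) :=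
      integrableOn_mul_test (integrableOn_exp_mul (integrableOn_L2 f₂)) hdc e2.deriv
    have i2 : IntegrableOn (fun x => Real.exp (-x) * f₂ x * η x) (Ioo (-L) L) :=
      integrableOn_mul_test (integrableOn_exp_mul (integrableOn_L2 f₂)) e1.continuous e2
    have i3 : IntegrableOn (fun x => Real.exp (-x) * h x * η x) (Ioo (-L) L) :=
      integrableOn_mul_test (integrableOn_exp_mul (integrableOn_L2 h)) e1.continuous e2
    have e8 : ∫ x in Ioo (-L) L, f₂ x * deriv (fun x => Real.exp (-x) * η x) x =
        (∫ x in Ioo (-L) L, Real.exp (-x) * f₂ x * deriv η x) -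
          ∫ x in Ioo (-L) L, Real.exp (-x) * f₂ x * η x := by
      rw [← integral_sub i1 i2]
      congr 1; funext x; rw [e7]; ring
    have e9 : ∫ x in Ioo (-L) L, f₃ x * (Real.exp (-x) * η x) =
        (∫ x in Ioo (-L) L, Real.exp (-x) * f₂ x * η x) -
          ∫ x in Ioo (-L) L, Real.exp (-x) * h x * η x := by
      rw [← integral_sub i2 i3]
      apply integral_congr_ae
      filter_upwards [Lp.coeFn_sub f₂ f₃] with x hx
      rw [hh, hx, Pi.sub_apply]; ring
    rw [e8, e9] at this
    simp only [neg_mul, integral_neg]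
    linarith
  obtain ⟨c, hc⟩ := hw.exists_eq_sub_tail hlt (integrableOn_exp_mul (integrableOn_L2 f₂))
    (integrableOn_exp_mul (integrableOn_L2 h)).neg
  have hF2 : ∀ᵐ x ∂(volume.restrict (Ioo (-L) L)), f₂ x = c * Real.exp x + expTail L h x := by
    filter_upwards [hc] with x hx
    have e1 : tail L (fun x => -(Real.exp (-x) * h x)) x =
        -tail L (fun x => Real.exp (-x) * h x) x := by
      simp [tail, intervalIntegral.integral_neg]
    have e2 : Real.exp x * Real.exp (-x) = 1 := by rw [← Real.exp_add]; simp
    rw [e1] at hx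
    rw [expTail]
    linear_combination (Real.exp x) * hx - f₂ x * e2
  set P : ℝ → ℝ := fun x => c * Real.exp x + expTail L h x with hP
  have cP : ContinuousOn P (Icc (-L) L) :=
    (by fun_prop : Continuous fun x => c * Real.exp x).continuousOn.add
      (continuousOn_expTail hL (integrableOn_L2 h))
  have iP := integrableOn_of_continuousOn cP
  -- Integration from `L`: the zero trace there removes the constant of integration.
  have step : ∀ (p q : L2 L) (Q : ℝ → ℝ), HasWeakDeriv L p q → ContinuousOn Q (Icc (-L) L) →
      (∀ᵐ x ∂(volume.restrict (Ioo (-L) L)), q x = Q x) → HasTrace L p L 0 →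
      ∀ᵐ x ∂(volume.restrict (Ioo (-L) L)), p x = -tail L Q x := by
    intro p q Q hpq hQ hqQ ⟨g, g1, g2, g3⟩
    obtain ⟨c', hc'⟩ := IsWeakDeriv.exists_eq_sub_tail hlt hpq (integrableOn_L2 p) (integrableOn_L2 q)
    have c1 : ContinuousOn (fun x => c' - tail L q x) (Icc (-L) L) :=
      continuousOn_const.sub (continuousOn_tail' hL (integrableOn_L2 q))
    have e : EqOn g (fun x => c' - tail L q x) (Icc (-L) L) := by
      refine Measure.eqOn_Icc_of_ae_eq (μ := volume) hlt.ne ?_ g1 c1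
      rw [← restrict_Ioo_eq_restrict_Icc]
      filter_upwards [hc', g2] with x h1 h2
      rw [← h2, h1]
    have e0 := e ⟨hle, le_rfl⟩
    simp only [tail_self, sub_zero, g3] at e0
    filter_upwards [hc', ae_restrict_mem measurableSet_Ioo] with x h1 h2
    rw [h1, ← e0, tail_congr hqQ (Ioo_subset_Icc_self h2)]
    ring
  have hF1 := step f₁ f₂ P w2 cP hF2 t3
  have c1 : ContinuousOn (fun x => -tail L P x) (Icc (-L) L) := (continuousOn_tail' hL iP).neg
  have hF0 := step f f₁ _ w1 c1 hF1 t2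
  have e0 : ∀ x, -tail L (fun x => -tail L P x) x = tail L (tail L P) x := fun x => by
    simp only [tail]; rw [intervalIntegral.integral_neg, neg_neg]
  simp only [e0] at hF0
  -- The one remaining condition, `f(-L) = 0`, is affine in `c` with nonzero slope.
  have hcst : c = cst L h := by
    obtain ⟨g, g1, g2, g3⟩ := t1
    have e : EqOn g (tail L (tail L P)) (Icc (-L) L) := by
      refine Measure.eqOn_Icc_of_ae_eq (μ := volume) hlt.ne ?_ g1
        (continuousOn_tail' hL (integrableOn_of_continuousOn (continuousOn_tail' hL iP)))
      rw [← restrict_Ioo_eq_restrict_Icc]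
      filter_upwards [hF0, g2] with x h1 h2
      rw [← h2, h1]
    have e1 := e ⟨le_rfl, hle⟩
    rw [g3, hP, G0_eq hL (integrableOn_L2 h) c ⟨le_rfl, hle⟩] at e1
    rw [cst, ← neg_div, eq_div_iff (tail_tail_exp_pos hL).ne']
    linarith
  apply Lp.ext
  filter_upwards [hF0, K_ae_eq hL h] with x h1 h2
  rw [h1, h2, G0_eq_tail_tail, hP, hcst]
  rfl

/-! ### Energy and interpolation estimates -/

theorem sq_integral_mul_le {a b : ℝ} (hab : a ≤ b) {f g : ℝ → ℝ} (hf : ContinuousOn f (Icc a b))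
    (hg : ContinuousOn g (Icc a b)) :
    (∫ x in a..b, f x * g x) ^ 2 ≤ (∫ x in a..b, f x ^ 2) * ∫ x in a..b, g x ^ 2 := by
  have ii : ∀ {p : ℝ → ℝ}, ContinuousOn p (Icc a b) → IntervalIntegrable p volume a b :=
    fun hp => (hp.mono (uIcc_of_le hab).subset).intervalIntegrable
  have key : ∀ l : ℝ, 0 ≤ (∫ x in a..b, g x ^ 2) * (l * l) + (-2 * ∫ x in a..b, f x * g x) * l +
      ∫ x in a..b, f x ^ 2 := by
    intro l
    have h1 : 0 ≤ ∫ x in a..b, (f x - l * g x) ^ 2 :=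
      intervalIntegral.integral_nonneg hab fun x _ => sq_nonneg _
    have h2 : ∫ x in a..b, (f x - l * g x) ^ 2 =
        ∫ x in a..b, ((f x ^ 2 - (2 * l) * (f x * g x)) + l ^ 2 * g x ^ 2) := by
      congr 1; funext x; ring
    rw [h2, intervalIntegral.integral_add (ii (by fun_prop)) (ii (by fun_prop)),
      intervalIntegral.integral_sub (ii (by fun_prop)) (ii (by fun_prop)),
      intervalIntegral.integral_const_mul, intervalIntegral.integral_const_mul] at h1
    linarith
  have := discrim_le_zero key
  rw [discrim] at this
  linarith

section

variable {L : ℝ} (hL : 0 < L)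

theorem inner_eq_integral {f h : L2 L} {F H : ℝ → ℝ} (hL : 0 < L)
    (hf : ∀ᵐ x ∂(volume.restrict (Ioo (-L) L)), f x = F x)
    (hh : ∀ᵐ x ∂(volume.restrict (Ioo (-L) L)), h x = H x) :
    inner ℝ f h = ∫ x in -L..L, F x * H x := by
  rw [L2.inner_def, ← setIntegral_Ioo_eq (by linarith)]
  apply integral_congr_ae
  filter_upwards [hf, hh] with x h1 h2
  rw [h1, h2]
  simp [mul_comm]

/-- If `K h = 0`, two differentiations leave `tail + cst = 0`, and the a.e. derivative of the
primitive recovers `e^{-x} h = 0`. Injectivity lifts identities from `u` to `A u`. -/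
theorem K_injective : Function.Injective (K hL) := by
  rw [injective_iff_map_eq_zero]
  intro h h0
  have hi := integrableOn_L2 h
  have e0 : ∀ x ∈ Icc (-L) L, G0 L h x = 0 := by
    refine Measure.eqOn_Icc_of_ae_eq (μ := volume) (g := fun _ => 0) (by linarith) ?_
      (continuousOn_G0 hL hi) continuousOn_const
    rw [← restrict_Ioo_eq_restrict_Icc]
    have := K_ae_eq hL h
    rw [h0] at this
    filter_upwards [this, Lp.coeFn_zero ℝ 2 (volume.restrict (Ioo (-L) L))] with x h1 h2
    rw [← h1, h2]; rfl
  have hz : ∀ {f : ℝ → ℝ} {f' x : ℝ}, (∀ y ∈ Ioo (-L) L, f y = 0) → x ∈ Ioo (-L) L →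
      HasDerivAt f f' x → f' = 0 := by
    intro f f' x hf hx hd
    refine hd.unique ((hasDerivAt_const x (0 : ℝ)).congr_of_eventuallyEq ?_)
    filter_upwards [isOpen_Ioo.mem_nhds hx] with y hy using hf y hy
  have e1 : ∀ x ∈ Ioo (-L) L, G1 L h x = 0 := fun x hx =>
    hz (fun y hy => e0 y (Ioo_subset_Icc_self hy)) hx (hasDerivAt_G0 hL hi hx)
  have e2 : ∀ x ∈ Ioo (-L) L, G2 L h x = 0 := fun x hx =>
    hz e1 hx (hasDerivAt_G1 hL hi hx)
  have e3 : ∀ x ∈ Ioo (-L) L, tail L (fun y => Real.exp (-y) * h y) x + cst L h = 0 := by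
    intro x hx
    have := e2 x hx
    rw [G2, expTail, mul_comm (cst L h), ← mul_add] at this
    rcases mul_eq_zero.1 this with h' | h'
    · exact absurd h' (Real.exp_ne_zero x)
    · linarith
  apply Lp.ext
  have e4 := ae_restrict_of_ae (s := Ioo (-L) L) (ae_hasDerivAt_tail
    (intervalIntegrable_of_integrableOn_Ioo (by linarith) (integrableOn_exp_mul hi)))
  filter_upwards [e4, Lp.coeFn_zero ℝ 2 (volume.restrict (Ioo (-L) L)),
    ae_restrict_mem measurableSet_Ioo] with x h1 h2 h3
  rw [h2, Pi.zero_apply]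
  have h4 := hz e3 h3 ((h1 (by rw [uIcc_of_le (by linarith)]; exact Ioo_subset_Icc_self h3)).add_const
    (cst L h))
  simpa using h4

theorem hasDerivAt_G2_K (k : L2 L) {x : ℝ} (hx : x ∈ Ioo (-L) L) :
    HasDerivAt (G2 L (K hL k)) (G2 L (K hL k) x - G0 L k x) x :=
  hasDerivAt_G2 (continuousOn_G0 hL (integrableOn_L2 k)) (K_ae_eq hL k) hx

theorem integral_eq_sub {a b : ℝ} (hab : a ≤ b) {f f' : ℝ → ℝ} (hf : ContinuousOn f (Icc a b))
    (hd : ∀ x ∈ Ioo a b, HasDerivAt f (f' x) x) (hf' : ContinuousOn f' (Icc a b)) :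
    ∫ x in a..b, f' x = f b - f a :=
  intervalIntegral.integral_eq_sub_of_hasDerivAt_of_le hab hf hd
    (hf'.mono (uIcc_of_le hab).subset).intervalIntegrable

/-- The dissipation of energy. -/
theorem inner_K_le (k : L2 L) :
    inner ℝ (K hL k) (K hL (K hL k)) ≤ - ∫ x in -L..L, G1 L (K hL k) x ^ 2 := by
  set h := K hL k with hh
  have hk := integrableOn_L2 k
  have hi := integrableOn_L2 h
  have c0 := continuousOn_G0 hL hi
  have c1 := continuousOn_G1 hL hi
  have c2 := continuousOn_G2 hL hi
  have k0 := continuousOn_G0 hL hk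
  have hle : -L ≤ L := by linarith
  rw [inner_eq_integral hL (K_ae_eq hL k) (K_ae_eq hL h)]
  -- With `f = K h`, the primitive `f_x f - f_xx f + f_x²/2` has derivative `(f_xx - f_xxx) f + f_x²
  -- = h f + f_x²`. Only its value `f_x(-L)²/2` at the left end survives, with the favourable sign.
  have := integral_eq_sub hle
    (f := fun x => G1 L h x * G0 L h x - G2 L h x * G0 L h x + 1 / 2 * G1 L h x ^ 2)
    (f' := fun x => G0 L k x * G0 L h x + G1 L h x ^ 2) (by fun_prop)
    (fun x hx => by
      have d0 := hasDerivAt_G0 hL hi hx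
      have d1 := hasDerivAt_G1 hL hi hx
      have d2 := hasDerivAt_G2_K hL k hx
      refine (((d1.mul d0).sub (d2.mul d0)).add ((d1.pow 2).const_mul (1 / 2))).congr_deriv ?_
      rw [← hh]; norm_num; ring) (by fun_prop)
  rw [intervalIntegral.integral_add, G0_right, G0_left hL hi, G1_right] at this
  · have h3 := sq_nonneg (G1 L h (-L))
    linarith
  all_goals
    refine ContinuousOn.intervalIntegrable (ContinuousOn.mono ?_ (uIcc_of_le hle).subset)
    fun_prop

theorem norm_sq_K_eq (k : L2 L) : ‖K hL k‖ ^ 2 = ∫ x in -L..L, G0 L k x * G0 L k x := by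
  rw [← real_inner_self_eq_norm_sq, inner_eq_integral hL (K_ae_eq hL k) (K_ae_eq hL k)]

theorem integral_abs_sq_le (hL : 0 < L) {f : ℝ → ℝ} (hf : ContinuousOn f (Icc (-L) L)) :
    (∫ x in -L..L, |f x|) ^ 2 ≤ 2 * L * ∫ x in -L..L, f x ^ 2 := by
  have := sq_integral_mul_le (a := -L) (b := L) (by linarith) (continuousOn_const (c := (1 : ℝ)))
    hf.abs
  simp only [one_mul, one_pow, sq_abs] at this
  refine this.trans (le_of_eq ?_)
  rw [intervalIntegral.integral_const, smul_eq_mul]; ring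

/-- Write `h = K k`, `f = K h`: the claim is `‖h‖¹⁰ ≤ C ‖h_x‖⁸ ‖f_x‖²`. As `f_x(L) = 0` and `|f_xx|
≤ B‖h‖`, the maximum of `|f_x|` is at most a multiple `m` of `(‖h‖ ‖f_x‖)^{1/2}`. By parts, `‖f_x‖²`
and `‖f_xx‖²` are `O(‖h‖ m)`, and `‖h‖² ≤ ‖h_x‖ ‖f_xx - f_x‖` closes the loop. -/
theorem exists_interpolation : ∃ C : ℝ, 0 < C ∧ ∀ k : L2 L,
    ‖K hL k‖ ^ 10 ≤ C * (∫ x in -L..L, G1 L k x ^ 2) ^ 4 * ∫ x in -L..L, G1 L (K hL k) x ^ 2 := by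
  obtain ⟨B, hB, hb⟩ := exists_G_bound hL
  have hle : -L ≤ L := by linarith
  set r := Real.sqrt (2 * L) with hr
  have hr0 : 0 < r := by positivity
  -- constants
  set C₁ := 2 * L * B + r with hC₁
  have hC₁0 : 0 < C₁ := by positivity
  set C₂ := 2 * (B + C₁ + 2 * L * B) with hC₂
  have hC₂0 : 0 < C₂ := by positivity
  refine ⟨C₂ ^ 4 * (2 * B * r) ^ 2, by positivity, fun k => ?_⟩
  set h := K hL k with hh
  have hk := integrableOn_L2 k
  have hi := integrableOn_L2 h
  have c0 := continuousOn_G0 hL hi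
  have c1 := continuousOn_G1 hL hi
  have c2 := continuousOn_G2 hL hi
  have k0 := continuousOn_G0 hL hk
  have k1 := continuousOn_G1 hL hk
  have ii : ∀ {p : ℝ → ℝ}, ContinuousOn p (Icc (-L) L) → IntervalIntegrable p volume (-L) L :=
    fun hp => (hp.mono (uIcc_of_le hle).subset).intervalIntegrable
  set N := ‖h‖ with hN
  have hN0 : 0 ≤ N := norm_nonneg _
  set P := ∫ x in -L..L, G1 L k x ^ 2 with hP
  set a2 := ∫ x in -L..L, G1 L h x ^ 2 with ha2
  set b2 := ∫ x in -L..L, G2 L h x ^ 2 with hb2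
  have ha0 : 0 ≤ a2 := intervalIntegral.integral_nonneg hle fun x _ => sq_nonneg _
  have hP0 : 0 ≤ P := intervalIntegral.integral_nonneg hle fun x _ => sq_nonneg _
  have hN2 : N ^ 2 = ∫ x in -L..L, G0 L k x * G0 L k x := norm_sq_K_eq hL k
  -- integrals of absolute values
  have iG1 : ∫ x in -L..L, |G1 L h x| ≤ r * Real.sqrt a2 := by
    rw [hr, ← Real.sqrt_mul (by linarith)]
    exact Real.le_sqrt_of_sq_le (integral_abs_sq_le hL c1)
  have iG0 : ∫ x in -L..L, |G0 L k x| ≤ r * N := by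
    rw [← Real.sqrt_sq hN0, hr, ← Real.sqrt_mul (by linarith), hN2]
    refine Real.le_sqrt_of_sq_le ((integral_abs_sq_le hL k0).trans (le_of_eq ?_))
    simp only [sq]
  -- the maximum of the first derivative
  set m := Real.sqrt (2 * B * r * N * Real.sqrt a2) with hm
  have hm0 : 0 ≤ m := Real.sqrt_nonneg _
  have hm2 : m ^ 2 = 2 * B * r * N * Real.sqrt a2 := Real.sq_sqrt (by positivity)
  have hmb : ∀ x ∈ Icc (-L) L, |G1 L h x| ≤ m := by
    intro x hx
    refine Real.le_sqrt_of_sq_le ?_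
    rw [sq_abs]
    have hs : Icc x L ⊆ Icc (-L) L := Icc_subset_Icc_left hx.1
    have e := integral_eq_sub hx.2 (f := fun y => G1 L h y ^ 2)
      (f' := fun y => 2 * G1 L h y * G2 L h y) ((c1.mono hs).pow 2) (fun y hy => by
        refine ((hasDerivAt_G1 hL hi ⟨hx.1.trans_lt hy.1, hy.2⟩).pow 2).congr_deriv ?_
        norm_num) ((continuousOn_const.mul (c1.mono hs)).mul (c2.mono hs))
    rw [G1_right] at e
    have e1 : G1 L h x ^ 2 = -∫ y in x..L, 2 * G1 L h y * G2 L h y := by rw [e]; ring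
    rw [e1]
    refine (neg_le_abs _).trans ?_
    have e2 : |∫ y in x..L, 2 * G1 L h y * G2 L h y| ≤ ∫ y in x..L, 2 * (B * N) * |G1 L h y| := by
      refine (intervalIntegral.abs_integral_le_integral_abs hx.2).trans ?_
      refine intervalIntegral.integral_mono_on hx.2 ?_ ?_ fun y hy => ?_
      · refine ContinuousOn.intervalIntegrable (ContinuousOn.mono ?_ ((uIcc_of_le hx.2).subset.trans hs))
        fun_prop
      · refine ContinuousOn.intervalIntegrable (ContinuousOn.mono ?_ ((uIcc_of_le hx.2).subset.trans hs))
        fun_prop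
      · rw [abs_mul, abs_mul, abs_two]
        nlinarith [(hb h y (hs hy)).2.2, abs_nonneg (G1 L h y)]
    refine e2.trans ?_
    rw [intervalIntegral.integral_const_mul]
    have e3 : ∫ y in x..L, |G1 L h y| ≤ ∫ y in -L..L, |G1 L h y| := by
      refine intervalIntegral.integral_mono_interval hx.1 hx.2 le_rfl ?_ (ii c1.abs)
      exact Filter.Eventually.of_forall fun y => abs_nonneg _
    have : 2 * (B * N) * (∫ y in x..L, |G1 L h y|) ≤ 2 * (B * N) * (r * Real.sqrt a2) :=
      mul_le_mul_of_nonneg_left (e3.trans iG1) (by positivity)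
    refine this.trans (le_of_eq (by ring))
  -- the two lower norms
  have ha : a2 ≤ 2 * L * B * N * m := by
    have : a2 ≤ ∫ x in -L..L, m * (B * N) := by
      refine intervalIntegral.integral_mono_on hle (ii (c1.pow 2)) (by simp) fun x hx => ?_
      rw [← sq_abs, sq]
      exact mul_le_mul (hmb x hx) (hb h x hx).2.1 (abs_nonneg _) hm0
    refine this.trans (le_of_eq ?_)
    simp; ring
  have hbb : b2 ≤ (B + C₁) * N * m := by
    -- Here `f_xxx = f_xx - h` is used; the boundary value at `-L` is estimated by the sup bounds.
    have e := integral_eq_sub hle (f := fun x => G1 L h x * G2 L h x)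
      (f' := fun x => G2 L h x ^ 2 + G1 L h x * (G2 L h x - G0 L k x)) (c1.mul c2)
      (fun x hx => by
        refine ((hasDerivAt_G1 hL hi hx).mul (hasDerivAt_G2_K hL k hx)).congr_deriv ?_
        rw [← hh]; ring) (by fun_prop)
    rw [intervalIntegral.integral_add (ii (by fun_prop)) (ii (by fun_prop)), G1_right] at e
    have e1 : |G1 L h (-L) * G2 L h (-L)| ≤ m * (B * N) := by
      rw [abs_mul]
      exact mul_le_mul (hmb _ ⟨le_rfl, hle⟩) (hb h _ ⟨le_rfl, hle⟩).2.2 (abs_nonneg _) hm0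
    have e2 : |∫ x in -L..L, G1 L h x * (G2 L h x - G0 L k x)| ≤
        ∫ x in -L..L, m * (B * N + |G0 L k x|) := by
      refine (intervalIntegral.abs_integral_le_integral_abs hle).trans ?_
      refine intervalIntegral.integral_mono_on hle (ii (by fun_prop)) (ii (by fun_prop)) fun x hx => ?_
      rw [abs_mul]
      refine mul_le_mul (hmb x hx) ((abs_sub _ _).trans ?_) (abs_nonneg _) hm0
      linarith [(hb h x hx).2.2]
    rw [intervalIntegral.integral_const_mul, intervalIntegral.integral_add (by simp)
      (ii k0.abs), intervalIntegral.integral_const] at e2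
    have e3 : m * ((L - -L) • (B * N) + ∫ x in -L..L, |G0 L k x|) ≤ m * (C₁ * N) := by
      refine mul_le_mul_of_nonneg_left ?_ hm0
      rw [hC₁, smul_eq_mul]; linarith
    have e4 := neg_le_abs (G1 L h (-L) * G2 L h (-L))
    have e5 := neg_le_abs (∫ x in -L..L, G1 L h x * (G2 L h x - G0 L k x))
    have : b2 ≤ m * (B * N) + m * (C₁ * N) := by linarith
    linarith
  -- the highest norm
  have e := integral_eq_sub hle (f := fun x => G0 L k x * (G1 L h x - G2 L h x))
    (f' := fun x => G0 L k x * G0 L k x - G1 L k x * (G2 L h x - G1 L h x))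
    (by fun_prop) (fun x hx => by
        refine ((hasDerivAt_G0 hL hk hx).mul
          ((hasDerivAt_G1 hL hi hx).sub (hasDerivAt_G2_K hL k hx))).congr_deriv ?_
        rw [← hh, Pi.sub_apply]; ring) (by fun_prop)
  rw [intervalIntegral.integral_sub (ii (by fun_prop)) (ii (by fun_prop)), G0_right,
    G0_left hL hk, ← hN2] at e
  -- Since `h` vanishes at both ends, `∫ h (f_xx - f_xxx) = ∫ h_x (f_xx - f_x)`.
  have e1 : N ^ 2 = ∫ x in -L..L, G1 L k x * (G2 L h x - G1 L h x) := by linarith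
  have e2 : N ^ 4 ≤ P * ∫ x in -L..L, (G2 L h x - G1 L h x) ^ 2 := by
    have := sq_integral_mul_le hle k1 (c2.sub c1)
    simp only [Pi.sub_apply] at this
    rw [← e1] at this
    calc N ^ 4 = (N ^ 2) ^ 2 := by ring
      _ ≤ _ := this
  have e3 : ∫ x in -L..L, (G2 L h x - G1 L h x) ^ 2 ≤ 2 * (b2 + a2) := by
    rw [hb2, ha2, ← intervalIntegral.integral_add (ii (by fun_prop)) (ii (by fun_prop)),
      ← intervalIntegral.integral_const_mul]
    refine intervalIntegral.integral_mono_on hle (ii (by fun_prop)) (ii (by fun_prop)) fun x hx => ?_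
    nlinarith [sq_nonneg (G2 L h x + G1 L h x)]
  have e4 : N ^ 4 ≤ P * (C₂ * N * m) := by
    refine e2.trans (mul_le_mul_of_nonneg_left (e3.trans ?_) hP0)
    rw [hC₂]; nlinarith
  rcases hN0.eq_or_lt with h0 | h0
  · rw [← h0]; simp only [ne_eq, OfNat.ofNat_ne_zero, not_false_eq_true, zero_pow]; positivity
  have e5 : N ^ 3 ≤ P * C₂ * m := by
    refine le_of_mul_le_mul_left ?_ h0
    calc N * N ^ 3 = N ^ 4 := by ring
      _ ≤ _ := e4
      _ = _ := by ring
  -- In the fourth power, `m⁴` is a constant times `N² a2`, free of square roots.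
  have e6 : (N ^ 3) ^ 4 ≤ (P * C₂ * m) ^ 4 := pow_le_pow_left₀ (by positivity) e5 4
  refine le_of_mul_le_mul_left ?_ (pow_pos h0 2)
  calc N ^ 2 * N ^ 10 = (N ^ 3) ^ 4 := by ring
    _ ≤ _ := e6
    _ = P ^ 4 * C₂ ^ 4 * (m ^ 2) ^ 2 := by ring
    _ = P ^ 4 * C₂ ^ 4 * (2 * B * r * N) ^ 2 * Real.sqrt a2 ^ 2 := by rw [hm2]; ring
    _ = N ^ 2 * (C₂ ^ 4 * (2 * B * r) ^ 2 * P ^ 4 * a2) := by rw [Real.sq_sqrt ha0]; ring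

end

/-! ### Smoothing -/

/-- The function `y^{-1/8}` has derivative at least `κ/8`. Dropping its positive initial value makes
the bound independent of `y a`, which is what smoothing requires. -/
theorem mul_sub_le_rpow_of_deriv_le {y y' : ℝ → ℝ} {a t κ : ℝ} (hat : a < t)
    (hy : ContinuousOn y (Icc a t)) (hpos : ∀ τ ∈ Icc a t, 0 < y τ)
    (hd : ∀ τ ∈ Ioo a t, HasDerivAt y (y' τ) τ)
    (hle : ∀ τ ∈ Ioo a t, y' τ ≤ -(κ * y τ ^ (9 / 8 : ℝ))) :
    κ / 8 * (t - a) ≤ y t ^ (-(1 / 8) : ℝ) := by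
  have h1 : ∀ τ ∈ Ioo a t, HasDerivAt (fun τ => y τ ^ (-(1 / 8) : ℝ))
      (y' τ * (-(1 / 8)) * y τ ^ (-(1 / 8) - 1 : ℝ)) τ := fun τ hτ =>
    (hd τ hτ).rpow_const (Or.inl (hpos τ (Ioo_subset_Icc_self hτ)).ne')
  have h2 : κ / 8 * (t - a) ≤ y t ^ (-(1 / 8) : ℝ) - y a ^ (-(1 / 8) : ℝ) := by
    refine (convex_Icc a t).mul_sub_le_image_sub_of_le_deriv
      (f := fun τ => y τ ^ (-(1 / 8) : ℝ)) ?_ ?_ ?_ a (left_mem_Icc.2 hat.le) t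
      (right_mem_Icc.2 hat.le) hat.le
    · exact hy.rpow_const fun τ hτ => Or.inl (hpos τ hτ).ne'
    · rw [interior_Icc]
      exact fun τ hτ => (h1 τ hτ).differentiableAt.differentiableWithinAt
    · rw [interior_Icc]
      intro τ hτ
      rw [(h1 τ hτ).deriv]
      have p := hpos τ (Ioo_subset_Icc_self hτ)
      have e : y τ ^ (9 / 8 : ℝ) * y τ ^ (-(1 / 8) - 1 : ℝ) = 1 := by
        rw [← Real.rpow_add p]; norm_num
      have q : 0 < y τ ^ (-(1 / 8) - 1 : ℝ) := Real.rpow_pos_of_pos p _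
      have := mul_le_mul_of_nonneg_right (hle τ hτ) q.le
      have : -(κ * y τ ^ (9 / 8 : ℝ)) * y τ ^ (-(1 / 8) - 1 : ℝ) = -κ := by
        linear_combination (-κ) * e
      linarith
  have h3 : 0 < y a ^ (-(1 / 8) : ℝ) := Real.rpow_pos_of_pos (hpos a (left_mem_Icc.2 hat.le)) _
  linarith

/-- The smoothing estimate for regular solutions. -/
theorem exists_smoothing_bound {L : ℝ} (hL : 0 < L) : ∃ C : ℝ, 0 < C ∧
    ∀ (a b M : ℝ) (u u₁ u₂ u₃ : ℝ → L2 L), 0 < M →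
      (∀ t ∈ Icc a b, u t = K hL (u₁ t)) → (∀ t ∈ Icc a b, u₁ t = K hL (u₂ t)) →
      (∀ t ∈ Icc a b, u₂ t = K hL (u₃ t)) → ContinuousOn u₁ (Icc a b) →
      (∀ t ∈ Ioo a b, HasDerivAt u₁ (u₂ t) t) → (∀ t ∈ Icc a b, ‖u t‖ ≤ M) →
      ∀ t ∈ Icc a b, a < t → ‖u₁ t‖ ≤ C * M / (t - a) ^ 4 := by
  obtain ⟨C, hC, hint⟩ := exists_interpolation hL
  refine ⟨4 ^ 4 * C, by positivity, ?_⟩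
  intro a b M u u₁ u₂ u₃ hM h0 h1 h2 hc hd hM' t ht hat
  have hta : 0 < t - a := sub_pos.2 hat
  rcases (norm_nonneg (u₁ t)).eq_or_lt with hz | hz
  · rw [← hz]; positivity
  have hsub : Icc a t ⊆ Icc a b := Icc_subset_Icc_right ht.2
  have hsub' : Ioo a t ⊆ Ioo a b := Ioo_subset_Ioo_right ht.2
  set y : ℝ → ℝ := fun τ => ‖u₁ τ‖ ^ 2 with hy
  set P : ℝ → ℝ := fun τ => ∫ x in -L..L, G1 L (u₂ τ) x ^ 2 with hP
  have hP0 : ∀ τ, 0 ≤ P τ := fun τ =>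
    intervalIntegral.integral_nonneg (by linarith) fun x _ => sq_nonneg _
  have hyc : ContinuousOn y (Icc a t) := (hc.mono hsub).norm.pow 2
  have hyd : ∀ τ ∈ Ioo a t, HasDerivAt y (2 * inner ℝ (u₁ τ) (u₂ τ)) τ := fun τ hτ =>
    (hd τ (hsub' hτ)).norm_sq
  have hyle : ∀ τ ∈ Ioo a t, 2 * inner ℝ (u₁ τ) (u₂ τ) ≤ -(2 * P τ) := fun τ hτ => by
    have m := hsub (Ioo_subset_Icc_self hτ)
    have := inner_K_le hL (u₃ τ)
    rw [← h2 τ m, ← h1 τ m, real_inner_comm] at this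
    linarith
  have hanti : AntitoneOn y (Icc a t) := by
    refine antitoneOn_of_deriv_nonpos (convex_Icc _ _) hyc ?_ ?_
    · rw [interior_Icc]
      exact fun τ hτ => (hyd τ hτ).differentiableAt.differentiableWithinAt
    · rw [interior_Icc]
      intro τ hτ
      rw [(hyd τ hτ).deriv]
      linarith [hyle τ hτ, hP0 τ]
  -- The energy decreases and is positive at time `t`, so it is positive on all of `[a, t]` and its
  -- negative powers are differentiable.
  have hpos : ∀ τ ∈ Icc a t, 0 < y τ := fun τ hτ =>
    (pow_pos hz 2).trans_le (hanti hτ (right_mem_Icc.2 hat.le) hτ.2)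
  -- Dissipation one level down gives `‖u_x‖² ≤ -⟨u₁, u⟩ ≤ ‖u₁‖ M`; inserted into the interpolation
  -- inequality it cancels one factor `‖u₁‖`.
  have hkey : ∀ τ ∈ Icc a t, y τ ^ 9 ≤ (C * M) ^ 2 * P τ ^ 8 := fun τ hτ => by
    have m := hsub hτ
    have i1 := hint (u₂ τ)
    rw [← h1 τ m] at i1
    have i2 := inner_K_le hL (u₂ τ)
    rw [← h1 τ m, ← h0 τ m] at i2
    have i3 : ∫ x in -L..L, G1 L (u₁ τ) x ^ 2 ≤ ‖u₁ τ‖ * M := by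
      have := neg_le_abs (inner ℝ (u₁ τ) (u τ))
      have := (abs_real_inner_le_norm (u₁ τ) (u τ)).trans
        (mul_le_mul_of_nonneg_left (hM' τ m) (norm_nonneg _))
      linarith
    have n0 : 0 < ‖u₁ τ‖ := by
      have := hpos τ hτ
      rcases (norm_nonneg (u₁ τ)).eq_or_lt with h | h
      · simp [hy, ← h] at this
      · exact h
    have i4 : ‖u₁ τ‖ ^ 9 ≤ C * P τ ^ 4 * M := by
      refine le_of_mul_le_mul_left ?_ n0
      calc ‖u₁ τ‖ * ‖u₁ τ‖ ^ 9 = ‖u₁ τ‖ ^ 10 := by ring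
        _ ≤ C * P τ ^ 4 * ∫ x in -L..L, G1 L (u₁ τ) x ^ 2 := i1
        _ ≤ C * P τ ^ 4 * (‖u₁ τ‖ * M) :=
          mul_le_mul_of_nonneg_left i3 (by have := hP0 τ; positivity)
        _ = _ := by ring
    calc y τ ^ 9 = (‖u₁ τ‖ ^ 9) ^ 2 := by simp only [hy]; ring
      _ ≤ (C * P τ ^ 4 * M) ^ 2 := pow_le_pow_left₀ (by positivity) i4 2
      _ = _ := by ring
  -- The eighth root of the previous estimate reads `κ y^{9/8} ≤ P`, while `y' ≤ -2P`.
  set κ : ℝ := ((C * M) ^ 2) ^ (-(1 / 8) : ℝ) with hκ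
  have hCM : 0 < (C * M) ^ 2 := by positivity
  have hκ0 : 0 < κ := Real.rpow_pos_of_pos hCM _
  have r8 : ∀ {r : ℝ}, 0 < r → (r ^ (-(1 / 8) : ℝ)) ^ 8 = r⁻¹ := fun {r} hr => by
    rw [← Real.rpow_natCast, ← Real.rpow_mul hr.le, ← Real.rpow_neg_one]; norm_num
  have hPk : ∀ τ ∈ Icc a t, κ * y τ ^ (9 / 8 : ℝ) ≤ P τ := fun τ hτ => by
    refine le_of_pow_le_pow_left₀ (n := 8) (by norm_num) (hP0 τ) ?_
    have e1 : (y τ ^ (9 / 8 : ℝ)) ^ 8 = y τ ^ 9 := by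
      rw [← Real.rpow_natCast, ← Real.rpow_mul (hpos τ hτ).le, ← Real.rpow_natCast]; norm_num
    rw [mul_pow, r8 hCM, e1, inv_mul_le_iff₀ hCM]
    exact hkey τ hτ
  have hfin := mul_sub_le_rpow_of_deriv_le (κ := 2 * κ) hat hyc hpos hyd
    fun τ hτ => by linarith [hyle τ hτ, hPk τ (Ioo_subset_Icc_self hτ)]
  have yt := hpos t (right_mem_Icc.2 hat.le)
  have h8 := pow_le_pow_left₀ (by positivity) hfin 8
  rw [r8 yt, mul_pow, div_pow, mul_pow, r8 hCM] at h8
  have h9 : y t ≤ (4 ^ 4 * C * M / (t - a) ^ 4) ^ 2 := by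
    have e : (2 ^ 8 * ((C * M) ^ 2)⁻¹ / 8 ^ 8 * (t - a) ^ 8) =
        ((4 ^ 4 * C * M / (t - a) ^ 4) ^ 2)⁻¹ := by
      field_simp
      norm_num
    rw [e] at h8
    exact (inv_le_inv₀ (by positivity) yt).1 h8
  exact le_of_sq_le_sq (by simpa [hy] using h9) (by positivity)

/-- A mild solution of `u' = A u` on `[a, b]`, expressed by the inverse of `A`. -/
def IsMild {L : ℝ} (hL : 0 < L) (u : ℝ → L2 L) (a b : ℝ) : Prop :=
  ContinuousOn u (Icc a b) ∧
    ∀ s ∈ Icc a b, ∀ t ∈ Icc a b, ∫ τ in s..t, u τ = K hL (u t - u s)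

/-- The difference quotient. -/
noncomputable def diffQuot {E : Type*} [NormedAddCommGroup E] [NormedSpace ℝ E] (ε : ℝ)
    (u : ℝ → E) (t : ℝ) : E := ε⁻¹ • (u (t + ε) - u t)

/-- The Steklov average. -/
noncomputable def steklov {E : Type*} [NormedAddCommGroup E] [NormedSpace ℝ E] (ε : ℝ)
    (u : ℝ → E) (t : ℝ) : E := ε⁻¹ • ∫ τ in t..(t + ε), u τ

/-! ### Steklov averages of mild solutions. -/

section

variable {L : ℝ} {hL : 0 < L} {u v : ℝ → L2 L} {a b ε : ℝ}

theorem add_mem_Icc_of_mem {t : ℝ} (hε : 0 ≤ ε) (ht : t ∈ Icc a (b - ε)) :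
    t + ε ∈ Icc a b := ⟨by linarith [ht.1], by linarith [ht.2]⟩

theorem Icc_sub_subset (hε : 0 ≤ ε) : Icc a (b - ε) ⊆ Icc a b :=
  Icc_subset_Icc_right (by linarith)

theorem continuousOn_diffQuot {E : Type*} [NormedAddCommGroup E] [NormedSpace ℝ E] {u : ℝ → E}
    (hε : 0 ≤ ε) (h : ContinuousOn u (Icc a b)) :
    ContinuousOn (diffQuot ε u) (Icc a (b - ε)) := by
  have h1 : ContinuousOn (fun t => u (t + ε)) (Icc a (b - ε)) :=
    h.comp (by fun_prop) fun t ht => add_mem_Icc_of_mem hε ht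
  exact (h1.sub (h.mono (Icc_sub_subset hε))).const_smul _

theorem diffQuot_K (w : ℝ → L2 L) (t : ℝ) :
    diffQuot ε (fun t => K hL (w t)) t = K hL (diffQuot ε w t) := by
  simp [diffQuot]

theorem diffQuot_congr {E : Type*} [NormedAddCommGroup E] [NormedSpace ℝ E] {u v : ℝ → E}
    (hε : 0 ≤ ε) (h : ∀ t ∈ Icc a b, u t = v t) {t : ℝ} (ht : t ∈ Icc a (b - ε)) :
    diffQuot ε u t = diffQuot ε v t := by
  rw [diffQuot, diffQuot, h t (Icc_sub_subset hε ht), h _ (add_mem_Icc_of_mem hε ht)]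

/-- After a shift of variables, `∫_{s+ε}^{t+ε} u - ∫_s^t u = ∫_t^{t+ε} u - ∫_s^{s+ε} u`. So the
difference quotient is the time derivative of the Steklov average. -/
theorem integral_diffQuot {E : Type*} [NormedAddCommGroup E] [NormedSpace ℝ E]
    {u : ℝ → E} (hε : 0 ≤ ε) (h : ContinuousOn u (Icc a b)) {s t : ℝ}
    (hs : s ∈ Icc a (b - ε)) (ht : t ∈ Icc a (b - ε)) :
    ∫ τ in s..t, diffQuot ε u τ = steklov ε u t - steklov ε u s := by
  have ii : ∀ {p q : ℝ}, p ∈ Icc a b → q ∈ Icc a b → IntervalIntegrable u volume p q :=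
    fun hp hq => (h.mono (ordConnected_Icc.uIcc_subset hp hq)).intervalIntegrable
  have hs1 := Icc_sub_subset hε hs
  have ht1 := Icc_sub_subset hε ht
  have hs2 := add_mem_Icc_of_mem hε hs
  have ht2 := add_mem_Icc_of_mem hε ht
  have i1 : IntervalIntegrable (fun τ => u (τ + ε)) volume s t := by
    refine ContinuousOn.intervalIntegrable (h.comp (by fun_prop) fun τ hτ => ?_)
    exact add_mem_Icc_of_mem hε (ordConnected_Icc.uIcc_subset hs ht hτ)
  simp only [diffQuot, steklov]
  rw [intervalIntegral.integral_smul, intervalIntegral.integral_sub i1 (ii hs1 ht1),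
    intervalIntegral.integral_comp_add_right, ← smul_sub]
  congr 1
  have e1 := intervalIntegral.integral_add_adjacent_intervals (ii hs1 hs2) (ii hs2 ht2)
  have e2 := intervalIntegral.integral_add_adjacent_intervals (ii hs1 ht1) (ii ht1 ht2)
  rw [sub_eq_sub_iff_add_eq_add, add_comm, e1, ← e2, add_comm]

/-- The source of regularity: averaging in time lands in the domain of `A`, and `A` of the average
is the difference quotient. -/
theorem IsMild.steklov_eq (h : IsMild hL u a b) (hε : 0 ≤ ε) {t : ℝ} (ht : t ∈ Icc a (b - ε)) :
    steklov ε u t = K hL (diffQuot ε u t) := by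
  rw [steklov, diffQuot, map_smul, ← h.2 t (Icc_sub_subset hε ht) _ (add_mem_Icc_of_mem hε ht)]

theorem IsMild.continuousOn_steklov (h : IsMild hL u a b) (hε : 0 ≤ ε) :
    ContinuousOn (steklov ε u) (Icc a (b - ε)) :=
  ((K hL).continuous.comp_continuousOn (continuousOn_diffQuot hε h.1)).congr
    fun _ ht => h.steklov_eq hε ht

theorem IsMild.integral_steklov (h : IsMild hL u a b) (hε : 0 ≤ ε) {s t : ℝ}
    (hs : s ∈ Icc a (b - ε)) (ht : t ∈ Icc a (b - ε)) :
    ∫ τ in s..t, steklov ε u τ = K hL (steklov ε u t - steklov ε u s) := by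
  have hsub := ordConnected_Icc.uIcc_subset hs ht
  rw [← integral_diffQuot hε h.1 hs ht, ← ContinuousLinearMap.intervalIntegral_comp_comm]
  · exact intervalIntegral.integral_congr fun τ hτ => h.steklov_eq hε (hsub hτ)
  · exact ((continuousOn_diffQuot hε h.1).mono hsub).intervalIntegrable

theorem IsMild.steklov (h : IsMild hL u a b) (hε : 0 ≤ ε) : IsMild hL (steklov ε u) a (b - ε) :=
  ⟨h.continuousOn_steklov hε, fun _ hs _ ht => h.integral_steklov hε hs ht⟩

theorem hasDerivAt_of_integral_eq {E : Type*} [NormedAddCommGroup E] [NormedSpace ℝ E]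
    [CompleteSpace E] {u w : ℝ → E} (hw : ContinuousOn w (Ioo a b))
    (h : ∀ s ∈ Ioo a b, ∀ t ∈ Ioo a b, ∫ τ in s..t, w τ = u t - u s) {t : ℝ} (ht : t ∈ Ioo a b) :
    HasDerivAt u (w t) t := by
  have h1 : HasDerivAt (fun t' => ∫ τ in t..t', w τ) (w t) t :=
    intervalIntegral.integral_hasDerivAt_right (by simp)
      (hw.stronglyMeasurableAtFilter isOpen_Ioo _ ht) (hw.continuousAt (isOpen_Ioo.mem_nhds ht))
  refine (h1.add_const (u t)).congr_of_eventuallyEq ?_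
  filter_upwards [isOpen_Ioo.mem_nhds ht] with τ hτ
  rw [h t ht τ hτ, sub_add_cancel]

theorem hasDerivAt_steklov {E : Type*} [NormedAddCommGroup E] [NormedSpace ℝ E]
    [CompleteSpace E] {u : ℝ → E} (hε : 0 ≤ ε) (h : ContinuousOn u (Icc a b)) {t : ℝ}
    (ht : t ∈ Ioo a (b - ε)) : HasDerivAt (steklov ε u) (diffQuot ε u t) t :=
  hasDerivAt_of_integral_eq ((continuousOn_diffQuot hε h).mono Ioo_subset_Icc_self)
    (fun _ hs _ ht => integral_diffQuot hε h (Ioo_subset_Icc_self hs) (Ioo_subset_Icc_self ht)) ht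

theorem hasDerivAt_diffQuot {E : Type*} [NormedAddCommGroup E] [NormedSpace ℝ E]
    {u u' : ℝ → E} (hε : 0 ≤ ε) (h : ∀ t ∈ Ioo a b, HasDerivAt u (u' t) t) {t : ℝ}
    (ht : t ∈ Ioo a (b - ε)) : HasDerivAt (diffQuot ε u) (diffQuot ε u' t) t := by
  have h1 := (h (t + ε) ⟨by linarith [ht.1], by linarith [ht.2]⟩).comp_add_const t ε
  exact (h1.sub (h t ⟨ht.1, by linarith [ht.2]⟩)).const_smul _

/-- The centre `c` is free: `c = u t` will give convergence of the averages, `c = 0` their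
boundedness. -/
theorem norm_steklov_sub_le {E : Type*} [NormedAddCommGroup E] [NormedSpace ℝ E]
    [CompleteSpace E] {u : ℝ → E} (hε : 0 < ε) {t η : ℝ} {c : E}
    (hu : ContinuousOn u (Icc t (t + ε))) (h : ∀ τ ∈ Icc t (t + ε), ‖u τ - c‖ ≤ η) :
    ‖steklov ε u t - c‖ ≤ η := by
  have hle : t ≤ t + ε := by linarith
  have hi : IntervalIntegrable u volume t (t + ε) :=
    (hu.mono (uIcc_of_le hle).subset).intervalIntegrable
  have e : steklov ε u t - c = ε⁻¹ • ∫ τ in t..(t + ε), (u τ - c) := by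
    rw [intervalIntegral.integral_sub hi (by simp), intervalIntegral.integral_const, smul_sub,
      add_sub_cancel_left, inv_smul_smul₀ hε.ne', steklov]
  rw [e, norm_smul, norm_inv, Real.norm_of_nonneg hε.le, inv_mul_le_iff₀ hε]
  have := intervalIntegral.norm_integral_le_of_norm_le_const (a := t) (b := t + ε)
    (f := fun τ => u τ - c) (C := η) fun τ hτ => h τ (by
      rw [uIoc_of_le hle] at hτ; exact Ioc_subset_Icc_self hτ)
  rw [add_sub_cancel_left, abs_of_pos hε] at this
  linarith

theorem IsMild.norm_steklov3_sub_le (h : IsMild hL u a b) (hε : 0 < ε) {t η : ℝ} {c : L2 L}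
    (ht : t ∈ Icc a (b - ε - ε - ε)) (hη : ∀ τ ∈ Icc t (t + 3 * ε), ‖u τ - c‖ ≤ η) :
    ‖KdVB.steklov ε (KdVB.steklov ε (KdVB.steklov ε u)) t - c‖ ≤ η := by
  have h1 := h.steklov hε.le
  have h2 := h1.steklov hε.le
  refine norm_steklov_sub_le hε (h2.1.mono (Icc_subset_Icc ht.1 (by linarith [ht.2])))
    fun τ hτ => ?_
  refine norm_steklov_sub_le hε (h1.1.mono (Icc_subset_Icc (by linarith [ht.1, hτ.1])
    (by linarith [ht.2, hτ.2]))) fun σ hσ => ?_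
  refine norm_steklov_sub_le hε (h.1.mono (Icc_subset_Icc (by linarith [ht.1, hτ.1, hσ.1])
    (by linarith [ht.2, hτ.2, hσ.2]))) fun r hr => hη r ⟨?_, ?_⟩
  · linarith [ht.1, hτ.1, hσ.1, hr.1]
  · linarith [ht.2, hτ.2, hσ.2, hr.2]

/-- The triple Steklov average of a mild solution is a regular solution. -/
theorem IsMild.exists_regular (h : IsMild hL u a b) (hε : 0 < ε) :
    ∃ v₀ v₁ v₂ v₃ : ℝ → L2 L,
      (∀ t ∈ Icc a (b - 3 * ε), v₀ t = K hL (v₁ t)) ∧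
      (∀ t ∈ Icc a (b - 3 * ε), v₁ t = K hL (v₂ t)) ∧
      (∀ t ∈ Icc a (b - 3 * ε), v₂ t = K hL (v₃ t)) ∧
      ContinuousOn v₁ (Icc a (b - 3 * ε)) ∧
      (∀ t ∈ Ioo a (b - 3 * ε), HasDerivAt v₁ (v₂ t) t) ∧
      ∀ t ∈ Icc a (b - 3 * ε), ∀ (c : L2 L) (η : ℝ),
        (∀ τ ∈ Icc t (t + 3 * ε), ‖u τ - c‖ ≤ η) → ‖v₀ t - c‖ ≤ η := by
  have h1 := h.steklov hε.le
  have h2 := h1.steklov hε.le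
  have he : b - 3 * ε = b - ε - ε - ε := by ring
  rw [he]
  -- Each application of `A` trades one average for a difference quotient, so three averages allow
  -- three applications; each average shortens the interval by `ε`.
  refine ⟨KdVB.steklov ε (KdVB.steklov ε (KdVB.steklov ε u)),
    diffQuot ε (KdVB.steklov ε (KdVB.steklov ε u)),
    diffQuot ε (diffQuot ε (KdVB.steklov ε u)),
    diffQuot ε (diffQuot ε (diffQuot ε u)), ?_, ?_, ?_, ?_, ?_, ?_⟩
  · exact fun t ht => h2.steklov_eq hε.le ht
  · intro t ht
    rw [← diffQuot_K]
    exact diffQuot_congr hε.le (fun τ hτ => h1.steklov_eq hε.le hτ) ht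
  · intro t ht
    rw [← diffQuot_K]
    refine diffQuot_congr hε.le (fun τ hτ => ?_) ht
    rw [← diffQuot_K]
    exact diffQuot_congr hε.le (fun σ hσ => h.steklov_eq hε.le hσ) hτ
  · exact continuousOn_diffQuot hε.le h2.1
  · intro t ht
    exact hasDerivAt_diffQuot hε.le (fun τ hτ => hasDerivAt_steklov hε.le h1.1 hτ) ht
  · intro t ht c η hη
    exact h.norm_steklov3_sub_le hε ht hη

end

open Filter Topology in
/-- Mild solutions take values in the domain of `A`. -/
theorem exists_mild_smoothing {L : ℝ} (hL : 0 < L) : ∃ C : ℝ, 0 < C ∧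
    ∀ (a b M : ℝ) (u : ℝ → L2 L), a < b → 0 < M → IsMild hL u a b → (∀ t ∈ Icc a b, ‖u t‖ ≤ M) →
      ∃ w : ℝ → L2 L, ContinuousOn w (Ioo a b) ∧
        ∀ t ∈ Ioo a b, u t = K hL (w t) ∧ ‖w t‖ ≤ C * M / (t - a) ^ 4 := by
  obtain ⟨C, hC, hs⟩ := exists_smoothing_bound hL
  refine ⟨C, hC, fun a b M u hab hM hu hb => ?_⟩
  -- Then `3 ε n = (b - a)/(n + 1)`, so the intervals of validity stay in `[a, b]` and increase with
  -- `n`.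
  set ε : ℕ → ℝ := fun n => (b - a) / 3 / ((n : ℝ) + 1) with hε
  have hba : 0 < b - a := sub_pos.2 hab
  have ε0 : ∀ n, 0 < ε n := fun n => by simp only [hε]; positivity
  have εanti : ∀ {n m}, n ≤ m → ε m ≤ ε n := fun {n m} h => by
    simp only [hε]; gcongr
  have εlim : Tendsto (fun n => 3 * ε n) atTop (𝓝 0) := by
    have h1 : Tendsto (fun n : ℕ => (b - a) / ((n : ℝ) + 1)) atTop (𝓝 0) := by
      simpa [div_eq_mul_inv] using (tendsto_one_div_add_atTop_nhds_zero_nat (𝕜 := ℝ)).const_mul (b - a)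
    refine h1.congr fun n => ?_
    simp only [hε]; field_simp
  choose v₀ v₁ v₂ v₃ e0 e1 e2 hc hd happ using fun n => hu.exists_regular (ε0 n)
  have hsub : ∀ {n m}, n ≤ m → Icc a (b - 3 * ε n) ⊆ Icc a (b - 3 * ε m) := fun h =>
    Icc_subset_Icc_right (by linarith [εanti h])
  have hsub' : ∀ {n m}, n ≤ m → Ioo a (b - 3 * ε n) ⊆ Ioo a (b - 3 * ε m) := fun h =>
    Ioo_subset_Ioo_right (by linarith [εanti h])
  have hin : ∀ {n t τ}, t ∈ Icc a (b - 3 * ε n) → τ ∈ Icc t (t + 3 * ε n) → τ ∈ Icc a b :=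
    fun ht hτ => ⟨ht.1.trans hτ.1, by linarith [ht.2, hτ.2]⟩
  -- the averages converge
  have huc : ∀ η > 0, ∃ N, ∀ n ≥ N, ∀ t ∈ Icc a (b - 3 * ε n), ‖v₀ n t - u t‖ ≤ η := by
    intro η hη
    have := Metric.uniformContinuousOn_iff.1
      (isCompact_Icc.uniformContinuousOn_of_continuous hu.1) η hη
    obtain ⟨δ, hδ, h⟩ := this
    obtain ⟨N, hN⟩ := eventually_atTop.1 (εlim.eventually (gt_mem_nhds hδ))
    refine ⟨N, fun n hn t ht => happ n t ht _ _ fun τ hτ => ?_⟩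
    rw [← dist_eq_norm]
    refine (h τ (hin ht hτ) t ⟨ht.1, by linarith [ht.2, ε0 n]⟩ ?_).le
    rw [Real.dist_eq, abs_of_nonneg (by linarith [hτ.1])]
    linarith [hτ.2, hN n hn]
  -- The difference of two averages is again a regular solution on the common interval, so the
  -- smoothing bound turns uniform closeness of `v₀` into closeness of `v₁`.
  have hcau : ∀ η > 0, ∃ N₀, ∀ N ≥ N₀, ∀ n ≥ N, ∀ m ≥ N, ∀ t ∈ Icc a (b - 3 * ε N), a < t →
      ‖v₁ n t - v₁ m t‖ ≤ C * η / (t - a) ^ 4 := by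
    intro η hη
    obtain ⟨N, hN⟩ := huc (η / 2) (by positivity)
    refine ⟨N, fun N hN' n hn m hm => ?_⟩
    refine hs a (b - 3 * ε N) η (fun t => v₀ n t - v₀ m t) (fun t => v₁ n t - v₁ m t)
      (fun t => v₂ n t - v₂ m t) (fun t => v₃ n t - v₃ m t) hη ?_ ?_ ?_ ?_ ?_ ?_
    · intro t ht
      rw [map_sub, ← e0 n t (hsub hn ht), ← e0 m t (hsub hm ht)]
    · intro t ht
      rw [map_sub, ← e1 n t (hsub hn ht), ← e1 m t (hsub hm ht)]
    · intro t ht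
      rw [map_sub, ← e2 n t (hsub hn ht), ← e2 m t (hsub hm ht)]
    · exact ((hc n).mono (hsub hn)).sub ((hc m).mono (hsub hm))
    · exact fun t ht => (hd n t (hsub' hn ht)).sub (hd m t (hsub' hm ht))
    · intro t ht
      have h1 := hN n (hN'.le.trans hn) t (hsub hn ht)
      have h2 := hN m (hN'.le.trans hm) t (hsub hm ht)
      have : v₀ n t - v₀ m t = (v₀ n t - u t) - (v₀ m t - u t) := by abel
      rw [this]
      linarith [norm_sub_le (v₀ n t - u t) (v₀ m t - u t)]
  have hucs : ∀ a' b', a < a' → b' < b → UniformCauchySeqOn v₁ atTop (Icc a' b') := by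
    intro a' b' ha hb'
    rw [Metric.uniformCauchySeqOn_iff]
    intro r hr
    have p : 0 < a' - a := sub_pos.2 ha
    obtain ⟨N, hN⟩ := hcau (r / 2 * (a' - a) ^ 4 / C) (by positivity)
    obtain ⟨N', hN'⟩ := eventually_atTop.1 (εlim.eventually (gt_mem_nhds (sub_pos.2 hb')))
    have hb'' : b' ≤ b - 3 * ε (max N N') := by linarith [hN' _ (le_max_right N N')]
    refine ⟨max N N', fun m hm n hn t ht => ?_⟩
    rw [dist_eq_norm]
    have hat : a' - a ≤ t - a := by linarith [ht.1]
    refine (hN _ (le_max_left _ _) m hm n hn t ⟨ha.le.trans ht.1, ht.2.trans hb''⟩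
      (ha.trans_le ht.1)).trans_lt ?_
    rw [mul_div_cancel₀ _ hC.ne', div_lt_iff₀ (pow_pos (p.trans_le hat) 4)]
    have q := pow_le_pow_left₀ p.le hat 4
    have p4 := pow_pos p 4
    nlinarith
  have hpt : ∀ t ∈ Ioo a b, CauchySeq fun n => v₁ n t := fun t ht =>
    (hucs t t ht.1 ht.2).cauchySeq (left_mem_Icc.2 le_rfl)
  have hlim : ∀ t, ∃ w, t ∈ Ioo a b → Tendsto (fun n => v₁ n t) atTop (𝓝 w) := fun t => by
    by_cases ht : t ∈ Ioo a b
    · obtain ⟨w, hw⟩ := cauchySeq_tendsto_of_complete (hpt t ht)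
      exact ⟨w, fun _ => hw⟩
    · exact ⟨0, fun h => absurd h ht⟩
  choose w hw using hlim
  have hev : ∀ b', b' < b → ∀ᶠ n in atTop, b' < b - 3 * ε n := fun b' hb' => by
    filter_upwards [εlim.eventually (gt_mem_nhds (sub_pos.2 hb'))] with n hn
    linarith
  refine ⟨w, fun t₀ ht₀ => ?_, fun t ht => ⟨?_, ?_⟩⟩
  · have ha' : a < (a + t₀) / 2 := by linarith [ht₀.1]
    have hb' : (t₀ + b) / 2 < b := by linarith [ht₀.2]
    have hun := (hucs _ _ ha' hb').tendstoUniformlyOn_of_tendsto (F := v₁) (f := w) fun t ht =>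
      hw t ⟨ha'.trans_le ht.1, ht.2.trans_lt hb'⟩
    have hcont : ContinuousOn w (Icc ((a + t₀) / 2) ((t₀ + b) / 2)) := by
      refine hun.continuousOn (Eventually.frequently ?_)
      filter_upwards [hev _ hb'] with n hn
      exact (hc n).mono (Icc_subset_Icc ha'.le hn.le)
    exact (hcont.continuousAt (Icc_mem_nhds (by linarith [ht₀.1]) (by linarith [ht₀.2]))).continuousWithinAt
  · have l1 : Tendsto (fun n => v₀ n t) atTop (𝓝 (u t)) := by
      rw [tendsto_iff_norm_sub_tendsto_zero, Metric.tendsto_atTop]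
      intro η hη
      obtain ⟨N, hN⟩ := huc (η / 2) (by positivity)
      obtain ⟨N', hN'⟩ := eventually_atTop.1 (hev t ht.2)
      refine ⟨max N N', fun n hn => ?_⟩
      rw [Real.dist_eq, sub_zero, abs_of_nonneg (norm_nonneg _)]
      have := hN n ((le_max_left _ _).trans hn) t ⟨ht.1.le, (hN' n ((le_max_right _ _).trans hn)).le⟩
      linarith
    have l2 := ((K hL).continuous.tendsto (w t)).comp (hw t ht)
    refine tendsto_nhds_unique (l1.congr' ?_) l2
    filter_upwards [hev t ht.2] with n hn
    exact e0 n t ⟨ht.1.le, hn.le⟩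
  · refine le_of_tendsto (hw t ht).norm ?_
    filter_upwards [hev t ht.2] with n hn
    refine hs a (b - 3 * ε n) M (v₀ n) (v₁ n) (v₂ n) (v₃ n) hM (e0 n) (e1 n) (e2 n) (hc n) (hd n)
      (fun τ hτ => ?_) t ⟨ht.1.le, hn.le⟩ ht.1
    simpa using happ n τ hτ 0 M fun σ hσ => by simpa using hb σ (hin hτ hσ)

/-! ### Bootstrapping the regularity. -/

section

variable {L : ℝ} {hL : 0 < L} {u w : ℝ → L2 L} {a b c d : ℝ}

/-- After applying `K` this is the mild formula for `u`, and `K` is injective. -/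
theorem IsMild.integral_eq_sub_of_eq_K (h : IsMild hL u a b)
    (hw : ContinuousOn w (Ioo a b)) (hK : ∀ t ∈ Ioo a b, u t = K hL (w t)) {s t : ℝ}
    (hs : s ∈ Ioo a b) (ht : t ∈ Ioo a b) : ∫ τ in s..t, w τ = u t - u s := by
  have hsub := ordConnected_Ioo.uIcc_subset hs ht
  apply K_injective hL
  rw [← h.2 s (Ioo_subset_Icc_self hs) t (Ioo_subset_Icc_self ht),
    ← ContinuousLinearMap.intervalIntegral_comp_comm _ (hw.mono hsub).intervalIntegrable]
  exact intervalIntegral.integral_congr fun τ hτ => (hK τ (hsub hτ)).symm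

theorem IsMild.of_eq_K (h : IsMild hL u a b) (hw : ContinuousOn w (Ioo a b))
    (hK : ∀ t ∈ Ioo a b, u t = K hL (w t)) (hs : Icc c d ⊆ Ioo a b) : IsMild hL w c d := by
  refine ⟨hw.mono hs, fun s hs' t ht => ?_⟩
  rw [h.integral_eq_sub_of_eq_K hw hK (hs hs') (hs ht), map_sub, ← hK _ (hs hs'), ← hK _ (hs ht)]

end

/-- Interior regularity of the solutions. -/
theorem IsSolution.exists_regular {L T : ℝ} (hL : 0 < L) (hT : 0 < T) {u₀ : L2 L} {u : ℝ → L2 L}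
    (h : IsSolution L T u₀ u) : ∃ (w z : ℝ → L2 L) (B : ℝ), 0 < B ∧
      ContinuousOn w (Ioo 0 T) ∧ ContinuousOn z (Ioo 0 T) ∧
      (∀ t ∈ Ioo 0 T, u t = K hL (w t)) ∧ (∀ t ∈ Ioo 0 T, w t = K hL (z t)) ∧
      (∀ t ∈ Ioo 0 T, HasDerivAt w (z t) t) ∧ ∀ t ∈ Ioo 0 T, ‖w t‖ ≤ B / t ^ 4 := by
  have hm : IsMild hL u 0 T := by
    have h0 : ∀ t ∈ Icc 0 T, ∫ τ in 0..t, u τ = K hL (u t - u₀) := fun t ht =>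
      (h.mild t ht).eq_K hL
    refine ⟨h.continuousOn, fun s hs t ht => ?_⟩
    have ii : ∀ {t}, t ∈ Icc 0 T → IntervalIntegrable u volume 0 t := fun ht =>
      (h.continuousOn.mono (ordConnected_Icc.uIcc_subset ⟨le_rfl, hT.le⟩ ht)).intervalIntegrable
    rw [← intervalIntegral.integral_interval_sub_left (ii ht) (ii hs), h0 t ht, h0 s hs, ← map_sub]
    congr 1; abel
  obtain ⟨C, hC, hreg⟩ := exists_mild_smoothing hL
  obtain ⟨M, hM⟩ := isCompact_Icc.exists_bound_of_continuousOn h.continuousOn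
  -- Smoothing is used on the whole of `[0, T]`, so that the growth of `w` at `t = 0` is quantified;
  -- `|M| + 1` is a positive bound.
  obtain ⟨w, hwc, hw⟩ := hreg 0 T (|M| + 1) u hT (by positivity) hm
    fun t ht => (hM t ht).trans (by linarith [le_abs_self M])
  -- Continuity of `w` is known only on the open interval, so the second application is local; the
  -- local functions `z` agree by injectivity of `K`.
  have hloc : ∀ c d, 0 < c → c < d → d < T → ∃ z : ℝ → L2 L, ContinuousOn z (Ioo c d) ∧
      ∀ t ∈ Ioo c d, w t = K hL (z t) := by
    intro c d hc hcd hd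
    have hsub : Icc c d ⊆ Ioo 0 T := fun x hx => ⟨hc.trans_le hx.1, hx.2.trans_lt hd⟩
    have hmw : IsMild hL w c d := hm.of_eq_K hwc (fun t ht => (hw t ht).1) hsub
    obtain ⟨M', hM'⟩ := isCompact_Icc.exists_bound_of_continuousOn hmw.1
    obtain ⟨z, hzc, hz⟩ := hreg c d (|M'| + 1) w hcd (by positivity) hmw
      fun t ht => (hM' t ht).trans (by linarith [le_abs_self M'])
    exact ⟨z, hzc, fun t ht => (hz t ht).1⟩
  have hmem : ∀ {t}, t ∈ Ioo 0 T → t ∈ Ioo (t / 2) ((t + T) / 2) := fun ht =>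
    ⟨by linarith [ht.1], by linarith [ht.2]⟩
  have hloc' : ∀ t ∈ Ioo 0 T, ∃ z : ℝ → L2 L, ContinuousOn z (Ioo (t / 2) ((t + T) / 2)) ∧
      ∀ τ ∈ Ioo (t / 2) ((t + T) / 2), w τ = K hL (z τ) := fun t ht =>
    hloc _ _ (by linarith [ht.1]) (by linarith [ht.1, ht.2]) (by linarith [ht.2])
  have hex : ∀ t, ∃ z, t ∈ Ioo 0 T → w t = K hL z := fun t => by
    by_cases ht : t ∈ Ioo 0 T
    · obtain ⟨z, -, hz⟩ := hloc' t ht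
      exact ⟨z t, fun _ => hz t (hmem ht)⟩
    · exact ⟨0, fun h => absurd h ht⟩
  choose z hz using hex
  have hzc : ContinuousOn z (Ioo 0 T) := by
    intro t ht
    obtain ⟨z', hz'c, hz'⟩ := hloc' t ht
    have hn := isOpen_Ioo.mem_nhds (hmem ht)
    refine ((hz'c.continuousAt hn).congr ?_).continuousWithinAt
    filter_upwards [hn, isOpen_Ioo.mem_nhds ht] with τ h1 h2
    exact K_injective hL ((hz' τ h1).symm.trans (hz τ h2))
  refine ⟨w, z, C * (|M| + 1), by positivity, hwc, hzc, fun t ht => (hw t ht).1, hz,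
    fun t ht => ?_, fun t ht => by simpa using (hw t ht).2⟩
  have hsub : Icc (t / 2) ((t + T) / 2) ⊆ Ioo 0 T := fun x hx =>
    ⟨by linarith [ht.1, hx.1], by linarith [ht.2, hx.2]⟩
  have hmw : IsMild hL w (t / 2) ((t + T) / 2) := hm.of_eq_K hwc (fun t ht => (hw t ht).1) hsub
  refine hasDerivAt_of_integral_eq (hzc.mono (Ioo_subset_Icc_self.trans hsub)) (fun s hs r hr => ?_)
    (hmem ht)
  exact hmw.integral_eq_sub_of_eq_K (hzc.mono (Ioo_subset_Icc_self.trans hsub))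
    (fun τ hτ => hz τ (hsub (Ioo_subset_Icc_self hτ))) hs hr

/-! ### Pointwise estimates for the Carleman inequality -/

/-- The quantity `∂ₓQ + ∂ₜg`, for the flux `carlemanFlux` and the density `carlemanDensity`. -/
noncomputable def carlemanDiv (a b c a' V₀ V₁ V₂ V₃ Vt : ℝ) : ℝ :=
  (Vt + V₃ + 3 * a ^ 2 * V₁) * (3 * a * V₂ + a ^ 3 * V₀ + 3 * b * V₁)
    - (3 / 2 * a' * V₁ ^ 2 - 3 / 2 * a ^ 2 * a' * V₀ ^ 2 - 9 / 2 * b * V₂ ^ 2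
      - 15 / 2 * a ^ 4 * b * V₀ ^ 2 + 3 * (2 * a * b ^ 2 + a ^ 2 * c) * (V₀ * V₁)
      - 3 * c * (V₁ * V₂))

theorem abs_mul_le_of_abs_le {x y p q : ℝ} (hx : |x| ≤ p) (hy : |y| ≤ q) : |x * y| ≤ p * q := by
  rw [abs_mul]
  exact mul_le_mul hx hy (abs_nonneg _) ((abs_nonneg _).trans hx)

theorem add_add_sq_le (x y z : ℝ) : (x + y + z) ^ 2 ≤ 3 * (x ^ 2 + y ^ 2 + z ^ 2) := by
  nlinarith [sq_nonneg (x - y), sq_nonneg (x - z), sq_nonneg (y - z)]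

theorem mul_le_half_add_sq (x y : ℝ) : x * y ≤ 1 / 2 * (x + y) ^ 2 := by
  nlinarith [sq_nonneg x, sq_nonneg y]

theorem abs_mul_le_half (x y : ℝ) : |x * y| ≤ 1 / 2 * (x ^ 2 + y ^ 2) := by
  rw [abs_le]
  constructor <;> nlinarith [sq_nonneg (x + y), sq_nonneg (x - y)]

/-- The equation makes the two factors of the product in `carlemanDiv` add up to `α V₀ + 2a V₁ +
V₂`, and a product is at most half the square of the sum. Apart from the two terms with `b V₂²` and
`a⁴ b V₀²`, everything is one power of `ρ` below `carlemanNorm`. -/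
theorem carlemanDiv_le {B : ℝ} (hB : 1 ≤ B) : ∃ C : ℝ, 0 < C ∧
    ∀ p₀ p₁ p₂ p₃ ρ r V₀ V₁ V₂ V₃ Vt : ℝ, |p₀| ≤ B → |p₁| ≤ B → |p₂| ≤ B → |p₃| ≤ B → 1 ≤ ρ →
      |r| ≤ ρ ^ 2 →
      Vt + r * p₀ * V₀ + V₃ + 3 * (ρ * p₁) * V₂ + 3 * ((ρ * p₁) ^ 2 + ρ * p₂) * V₁
        + ((ρ * p₁) ^ 3 + 3 * (ρ * p₁) * (ρ * p₂) + ρ * p₃) * V₀ - V₂ - 2 * (ρ * p₁) * V₁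
        - ((ρ * p₁) ^ 2 + ρ * p₂) * V₀ = 0 →
      carlemanDiv (ρ * p₁) (ρ * p₂) (ρ * p₃) (r * p₁) V₀ V₁ V₂ V₃ Vt ≤
        9 / 2 * (ρ * p₂) * V₂ ^ 2 + 15 / 2 * (ρ * p₁) ^ 4 * (ρ * p₂) * V₀ ^ 2
          + C * (ρ ^ 4 * V₀ ^ 2 + ρ ^ 2 * V₁ ^ 2 + V₂ ^ 2) := by
  refine ⟨3 / 2 * (7 * B ^ 2) ^ 2 + 3 / 2 * (2 * B) ^ 2 + 3 / 2 + 3 / 2 * B + 3 / 2 * B ^ 3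
    + 9 * B ^ 3 + 3 * B, by positivity, ?_⟩
  intro p₀ p₁ p₂ p₃ ρ r V₀ V₁ V₂ V₃ Vt h0 h1 h2 h3 hρ hr hpde
  have ρ0 : 0 < ρ := by linarith
  have B0 : 0 < B := by linarith
  have ρle : ρ ≤ ρ ^ 2 := by nlinarith
  have Ble : B ≤ B ^ 2 := by nlinarith
  have hρa : |ρ| ≤ ρ := (abs_of_pos ρ0).le
  set a := ρ * p₁ with ha
  set b := ρ * p₂ with hb
  set c := ρ * p₃ with hc
  set a' := r * p₁ with ha'
  have ea : |a| ≤ ρ * B := abs_mul_le_of_abs_le hρa h1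
  have eb : |b| ≤ ρ * B := abs_mul_le_of_abs_le hρa h2
  have ec : |c| ≤ ρ * B := abs_mul_le_of_abs_le hρa h3
  have ea' : |a'| ≤ ρ ^ 2 * B := abs_mul_le_of_abs_le hr h1
  have er : |r * p₀| ≤ ρ ^ 2 * B := abs_mul_le_of_abs_le hr h0
  have ea2 : a ^ 2 ≤ ρ ^ 2 * B ^ 2 := by
    have := abs_mul_le_of_abs_le ea ea
    calc a ^ 2 = a * a := sq a
      _ ≤ |a * a| := le_abs_self _
      _ ≤ _ := this
      _ = _ := by ring
  have eb2 : b ^ 2 ≤ ρ ^ 2 * B ^ 2 := by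
    have := abs_mul_le_of_abs_le eb eb
    calc b ^ 2 = b * b := sq b
      _ ≤ |b * b| := le_abs_self _
      _ ≤ _ := this
      _ = _ := by ring
  have hρB : ρ * B ≤ ρ ^ 2 * B ^ 2 := mul_le_mul ρle Ble B0.le (by positivity)
  have hρB' : ρ ^ 2 * B ≤ ρ ^ 2 * B ^ 2 := mul_le_mul_of_nonneg_left Ble (by positivity)
  -- In the scaled variables `X`, `Y`, `V₂` every error term is a quadratic form with coefficients
  -- bounded in terms of `B`.
  set X := ρ ^ 2 * V₀ with hX
  set Y := ρ * V₁ with hY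
  -- The zeroth-order remainder; its terms contribute `1 + 3 + 1 + 1 + 1 = 7` multiples of `ρ² B²`.
  set α := -(r * p₀) - 3 * (a * b) - c + a ^ 2 + b with hα
  have eα : |α| ≤ ρ ^ 2 * (7 * B ^ 2) := by
    have eab := abs_mul_le_of_abs_le ea eb
    rw [abs_le] at er eab ec eb ⊢
    have := sq_nonneg a
    have e : ρ * B * (ρ * B) = ρ ^ 2 * B ^ 2 := by ring
    rw [e] at eab
    constructor <;> simp only [hα] <;> linarith [er.1, er.2, eab.1, eab.2, ec.1, ec.2, eb.1, eb.2]
  have hsum : (Vt + V₃ + 3 * a ^ 2 * V₁) + (3 * a * V₂ + a ^ 3 * V₀ + 3 * b * V₁) =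
      α * V₀ + 2 * a * V₁ + V₂ := by simp only [hα]; linarith
  have t1 : (α * V₀) ^ 2 ≤ (7 * B ^ 2) ^ 2 * X ^ 2 := by
    have := abs_mul_le_of_abs_le eα (le_refl |V₀|)
    calc (α * V₀) ^ 2 = |α * V₀| ^ 2 := (sq_abs _).symm
      _ ≤ (ρ ^ 2 * (7 * B ^ 2) * |V₀|) ^ 2 := pow_le_pow_left₀ (abs_nonneg _) this 2
      _ = (7 * B ^ 2) ^ 2 * (ρ ^ 4 * |V₀| ^ 2) := by ring
      _ = _ := by rw [sq_abs]; ring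
  have t2 : (2 * a * V₁) ^ 2 ≤ (2 * B) ^ 2 * Y ^ 2 := by
    calc (2 * a * V₁) ^ 2 = 4 * V₁ ^ 2 * a ^ 2 := by ring
      _ ≤ 4 * V₁ ^ 2 * (ρ ^ 2 * B ^ 2) := mul_le_mul_of_nonneg_left ea2 (by positivity)
      _ = _ := by ring
  have t3 : (Vt + V₃ + 3 * a ^ 2 * V₁) * (3 * a * V₂ + a ^ 3 * V₀ + 3 * b * V₁) ≤
      3 / 2 * ((7 * B ^ 2) ^ 2 * X ^ 2 + (2 * B) ^ 2 * Y ^ 2 + V₂ ^ 2) := by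
    have s1 := mul_le_half_add_sq (Vt + V₃ + 3 * a ^ 2 * V₁) (3 * a * V₂ + a ^ 3 * V₀ + 3 * b * V₁)
    rw [hsum] at s1
    have s2 := add_add_sq_le (α * V₀) (2 * a * V₁) V₂
    linarith
  have t4 : |a' * V₁ ^ 2| ≤ B * Y ^ 2 := by
    refine (abs_mul_le_of_abs_le ea' (abs_of_nonneg (sq_nonneg V₁)).le).trans (le_of_eq ?_)
    ring
  have t5 : |a ^ 2 * a' * V₀ ^ 2| ≤ B ^ 3 * X ^ 2 := by
    refine (abs_mul_le_of_abs_le (abs_mul_le_of_abs_le ((abs_of_nonneg (sq_nonneg a)).le.trans ea2)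
      ea') (abs_of_nonneg (sq_nonneg V₀)).le).trans (le_of_eq ?_)
    ring
  have t6 : |(2 * a * b ^ 2 + a ^ 2 * c) * (V₀ * V₁)| ≤ 3 / 2 * B ^ 3 * (X ^ 2 + Y ^ 2) := by
    have u1 : |2 * a * b ^ 2 + a ^ 2 * c| ≤ 3 * (ρ ^ 3 * B ^ 3) := by
      have v1 := abs_mul_le_of_abs_le ea ((abs_of_nonneg (sq_nonneg b)).le.trans eb2)
      have v2 := abs_mul_le_of_abs_le ((abs_of_nonneg (sq_nonneg a)).le.trans ea2) ec
      rw [abs_le] at v1 v2 ⊢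
      constructor <;> linarith [v1.1, v1.2, v2.1, v2.2]
    have u2 := abs_mul_le_of_abs_le u1 (le_refl |V₀ * V₁|)
    have u3 : 3 * (ρ ^ 3 * B ^ 3) * |V₀ * V₁| = 3 * B ^ 3 * |X * Y| := by
      have : X * Y = ρ ^ 3 * (V₀ * V₁) := by simp only [hX, hY]; ring
      rw [this, abs_mul (ρ ^ 3), abs_of_pos (pow_pos ρ0 3)]; ring
    have u4 := abs_mul_le_half X Y
    have u5 := mul_le_mul_of_nonneg_left u4 (show (0 : ℝ) ≤ 3 * B ^ 3 by positivity)
    linarith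
  have t7 : |c * (V₁ * V₂)| ≤ B * (Y ^ 2 + V₂ ^ 2) := by
    have u2 := abs_mul_le_of_abs_le ec (le_refl |V₁ * V₂|)
    have u3 : ρ * B * |V₁ * V₂| = B * |Y * V₂| := by
      have : Y * V₂ = ρ * (V₁ * V₂) := by simp only [hY]; ring
      rw [this, abs_mul ρ, abs_of_pos ρ0]; ring
    have u4 : |Y * V₂| ≤ Y ^ 2 + V₂ ^ 2 := by
      linarith [abs_mul_le_half Y V₂, sq_nonneg Y, sq_nonneg V₂]
    have u5 := mul_le_mul_of_nonneg_left u4 B0.le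
    linarith
  have eX : ρ ^ 4 * V₀ ^ 2 = X ^ 2 := by simp only [hX]; ring
  have eY : ρ ^ 2 * V₁ ^ 2 = Y ^ 2 := by simp only [hY]; ring
  rw [eX, eY, carlemanDiv]
  have t4' := (abs_le.1 t4).1
  have t5' := (abs_le.1 t5).2
  have t6' := (abs_le.1 t6).1
  have t7' := (abs_le.1 t7).2
  have X2 := sq_nonneg X
  have Y2 := sq_nonneg Y
  have Z2 := sq_nonneg V₂
  have n1 : 0 ≤ (3 / 2 * (2 * B) ^ 2 + 3 / 2 + 3 / 2 * B + 9 / 2 * B ^ 3 + 3 * B) * X ^ 2 := by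
    positivity
  have n2 : 0 ≤ (3 / 2 * (7 * B ^ 2) ^ 2 + 3 / 2 + 3 / 2 * B ^ 3 + 9 / 2 * B ^ 3) * Y ^ 2 := by
    positivity
  have n3 : 0 ≤ (3 / 2 * (7 * B ^ 2) ^ 2 + 3 / 2 * (2 * B) ^ 2 + 3 / 2 * B + 3 / 2 * B ^ 3
    + 9 * B ^ 3) * V₂ ^ 2 := by positivity
  linarith

/-- The quantity which is estimated by the Carleman inequality. -/
noncomputable def carlemanNorm (ρ V₀ V₁ V₂ : ℝ) : ℝ := ρ ^ 5 * V₀ ^ 2 + ρ ^ 3 * V₁ ^ 2 + ρ * V₂ ^ 2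

/-- No term `ρ³ V₁²` arises from the product. It is supplied by `ρ³ ∂ₓ(V₀ V₁) = ρ³ (V₁² + V₀ V₂)`,
whose cross term is absorbed by half of the other two squares. The first bound holds everywhere and
serves on `ω`; the second uses the signs off `ω`. -/
theorem carlemanDiv_sub_le {B κ₀ : ℝ} (hB : 1 ≤ B) (hκ₀ : 0 < κ₀) : ∃ ρ₀ κ C : ℝ, 1 ≤ ρ₀ ∧ 0 < κ ∧
    0 < C ∧ ∀ p₀ p₁ p₂ p₃ ρ r V₀ V₁ V₂ V₃ Vt : ℝ,
      |p₀| ≤ B → |p₁| ≤ B → |p₂| ≤ B → |p₃| ≤ B → ρ₀ ≤ ρ → |r| ≤ ρ ^ 2 →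
      Vt + r * p₀ * V₀ + V₃ + 3 * (ρ * p₁) * V₂ + 3 * ((ρ * p₁) ^ 2 + ρ * p₂) * V₁
        + ((ρ * p₁) ^ 3 + 3 * (ρ * p₁) * (ρ * p₂) + ρ * p₃) * V₀ - V₂ - 2 * (ρ * p₁) * V₁
        - ((ρ * p₁) ^ 2 + ρ * p₂) * V₀ = 0 →
      (carlemanDiv (ρ * p₁) (ρ * p₂) (ρ * p₃) (r * p₁) V₀ V₁ V₂ V₃ Vt
          - 4 * κ * (ρ ^ 3 * V₁ ^ 2 + ρ ^ 3 * V₀ * V₂) ≤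
        C * carlemanNorm ρ V₀ V₁ V₂ - κ * carlemanNorm ρ V₀ V₁ V₂) ∧
      (κ₀ ≤ |p₁| → p₂ ≤ -κ₀ →
        carlemanDiv (ρ * p₁) (ρ * p₂) (ρ * p₃) (r * p₁) V₀ V₁ V₂ V₃ Vt
          - 4 * κ * (ρ ^ 3 * V₁ ^ 2 + ρ ^ 3 * V₀ * V₂) ≤
        -κ * carlemanNorm ρ V₀ V₁ V₂) := by
  obtain ⟨C₁, hC₁, h⟩ := carlemanDiv_le hB
  -- `4κ` is at most `9/2 κ₀` and `15/2 κ₀⁵`, the coefficients of `ρ V₂²` and `ρ⁵ V₀²` off `ω`. Of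
  -- these `4κ`, the cross term takes `2κ` and the lower-order terms `κ`.
  set κ : ℝ := min (9 / 8 * κ₀) (15 / 8 * κ₀ ^ 5) with hκ
  have κ0 : 0 < κ := by simp only [hκ, lt_min_iff]; constructor <;> positivity
  -- Beyond this threshold `C₁ ≤ κ ρ`, so the lower-order terms cost at most `κ` times
  -- `carlemanNorm`.
  set ρ₀ : ℝ := 1 + C₁ / κ with hρ₀
  have hd : 0 < C₁ / κ := by positivity
  refine ⟨ρ₀, κ, 9 / 2 * B + 15 / 2 * B ^ 5 + 4 * κ, by linarith, κ0, by positivity, ?_⟩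
  intro p₀ p₁ p₂ p₃ ρ r V₀ V₁ V₂ V₃ Vt h0 h1 h2 h3 hρ hr hpde
  have ρ1 : 1 ≤ ρ := by linarith
  have ρ0 : 0 < ρ := by linarith
  have B0 : 0 < B := by linarith
  have hmain := h p₀ p₁ p₂ p₃ ρ r V₀ V₁ V₂ V₃ Vt h0 h1 h2 h3 ρ1 hr hpde
  have hCρ : C₁ ≤ κ * ρ := by
    have : C₁ / κ ≤ ρ := by linarith
    rw [div_le_iff₀ κ0] at this
    linarith
  have hlow : C₁ * (ρ ^ 4 * V₀ ^ 2 + ρ ^ 2 * V₁ ^ 2 + V₂ ^ 2) ≤ κ * carlemanNorm ρ V₀ V₁ V₂ := by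
    refine (mul_le_mul_of_nonneg_right hCρ (by positivity)).trans (le_of_eq ?_)
    rw [carlemanNorm]; ring
  have hcross : -(4 * κ * (ρ ^ 3 * V₀ * V₂)) ≤ 2 * κ * (ρ ^ 5 * V₀ ^ 2 + ρ * V₂ ^ 2) := by
    have : 0 ≤ 2 * κ * ρ * (ρ ^ 2 * V₀ + V₂) ^ 2 := by positivity
    linarith
  have w5 : 0 ≤ ρ ^ 5 * V₀ ^ 2 := by positivity
  have w3 : 0 ≤ ρ ^ 3 * V₁ ^ 2 := by positivity
  have w1 : 0 ≤ ρ * V₂ ^ 2 := by positivity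
  constructor
  · have e1 : 9 / 2 * (ρ * p₂) * V₂ ^ 2 ≤ 9 / 2 * B * (ρ * V₂ ^ 2) := by
      have := mul_le_mul_of_nonneg_right ((le_abs_self _).trans h2) w1
      linarith
    have e2 : 15 / 2 * (ρ * p₁) ^ 4 * (ρ * p₂) * V₀ ^ 2 ≤ 15 / 2 * B ^ 5 * (ρ ^ 5 * V₀ ^ 2) := by
      have q1 : p₁ ^ 4 * p₂ ≤ B ^ 4 * B := by
        have : p₁ ^ 4 ≤ B ^ 4 := by
          rw [← Even.pow_abs (by decide : Even 4)]
          exact pow_le_pow_left₀ (abs_nonneg _) h1 4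
        exact mul_le_mul this ((le_abs_self _).trans h2) |> fun f => by
          rcases le_or_gt 0 p₂ with hp | hp
          · exact f hp (by positivity)
          · exact (mul_nonpos_of_nonneg_of_nonpos (by positivity) hp.le).trans (by positivity)
      have := mul_le_mul_of_nonneg_right q1 w5
      have e : 15 / 2 * (ρ * p₁) ^ 4 * (ρ * p₂) * V₀ ^ 2 =
        15 / 2 * (p₁ ^ 4 * p₂ * (ρ ^ 5 * V₀ ^ 2)) := by ring
      rw [e]
      linarith
    have q2 : 0 ≤ (9 / 2 * B) * (ρ ^ 5 * V₀ ^ 2) := by positivity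
    have q3 : 0 ≤ (15 / 2 * B ^ 5) * (ρ * V₂ ^ 2) := by positivity
    have q4 : 0 ≤ (9 / 2 * B + 15 / 2 * B ^ 5) * (ρ ^ 3 * V₁ ^ 2) := by positivity
    have q5 : 0 ≤ κ * (ρ ^ 3 * V₁ ^ 2) := by positivity
    have q6 : 0 ≤ κ * (ρ ^ 5 * V₀ ^ 2) := by positivity
    have q7 : 0 ≤ κ * (ρ * V₂ ^ 2) := by positivity
    rw [carlemanNorm] at hlow ⊢
    linarith
  · intro k1 k2
    have m1 : κ ≤ 9 / 8 * κ₀ := min_le_left _ _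
    have m2 : κ ≤ 15 / 8 * κ₀ ^ 5 := min_le_right _ _
    have e1 : 9 / 2 * (ρ * p₂) * V₂ ^ 2 ≤ -(4 * κ) * (ρ * V₂ ^ 2) := by
      have := mul_le_mul_of_nonneg_right (show 9 / 2 * p₂ ≤ -(4 * κ) by linarith) w1
      linarith
    have e2 : 15 / 2 * (ρ * p₁) ^ 4 * (ρ * p₂) * V₀ ^ 2 ≤ -(4 * κ) * (ρ ^ 5 * V₀ ^ 2) := by
      have q1 : κ₀ ^ 4 ≤ p₁ ^ 4 := by
        rw [← Even.pow_abs (by decide : Even 4) p₁]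
        exact pow_le_pow_left₀ hκ₀.le k1 4
      have q2 : κ₀ ^ 4 * κ₀ ≤ p₁ ^ 4 * (-p₂) := mul_le_mul q1 (by linarith) hκ₀.le (by positivity)
      have := mul_le_mul_of_nonneg_right (show 4 * κ ≤ 15 / 2 * (p₁ ^ 4 * (-p₂)) by linarith) w5
      have e : 15 / 2 * (ρ * p₁) ^ 4 * (ρ * p₂) * V₀ ^ 2 =
        -(15 / 2 * (p₁ ^ 4 * (-p₂)) * (ρ ^ 5 * V₀ ^ 2)) := by ring
      rw [e]
      linarith
    have q5 : 0 ≤ κ * (ρ ^ 3 * V₁ ^ 2) := by positivity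
    rw [carlemanNorm] at hlow ⊢
    linarith

/-- The Carleman norms of `v = e^{-θ} u` and of `u` are comparable. -/
theorem carlemanNorm_le {B : ℝ} (hB : 1 ≤ B) : ∃ C : ℝ, 0 < C ∧ ∀ p₁ p₂ ρ U₀ U₁ U₂ V₁ V₂ : ℝ,
    |p₁| ≤ B → |p₂| ≤ B → 1 ≤ ρ →
      V₁ = U₁ + ρ * p₁ * U₀ → |V₂ - U₂ - 2 * (ρ * p₁) * U₁| ≤ 2 * B ^ 2 * ρ ^ 2 * |U₀| →
      carlemanNorm ρ U₀ V₁ V₂ ≤ C * carlemanNorm ρ U₀ U₁ U₂ := by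
  refine ⟨1 + 2 * (1 + B ^ 2) + 3 * (1 + 4 * B ^ 2 + 4 * B ^ 4), by positivity, ?_⟩
  intro p₁ p₂ ρ U₀ U₁ U₂ V₁ V₂ h1 h2 hρ e1 e2
  have ρ0 : 0 < ρ := by linarith
  have hp : p₁ ^ 2 ≤ B ^ 2 := by
    rw [← sq_abs]; exact pow_le_pow_left₀ (abs_nonneg _) h1 2
  have f1 : ρ ^ 3 * V₁ ^ 2 ≤ 2 * (ρ ^ 3 * U₁ ^ 2) + 2 * B ^ 2 * (ρ ^ 5 * U₀ ^ 2) := by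
    have : V₁ ^ 2 ≤ 2 * (U₁ ^ 2 + (ρ * p₁ * U₀) ^ 2) := by
      rw [e1]; nlinarith [sq_nonneg (U₁ - ρ * p₁ * U₀)]
    have g1 := mul_le_mul_of_nonneg_left this (pow_pos ρ0 3).le
    have g2 := mul_le_mul_of_nonneg_left hp (show 0 ≤ ρ ^ 5 * U₀ ^ 2 by positivity)
    linarith
  have f2 : ρ * V₂ ^ 2 ≤ 3 * (ρ * U₂ ^ 2) + 3 * (4 * B ^ 2) * (ρ ^ 3 * U₁ ^ 2)
      + 3 * (4 * B ^ 4) * (ρ ^ 5 * U₀ ^ 2) := by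
    set q := V₂ - U₂ - 2 * (ρ * p₁) * U₁ with hq
    have hq2 : q ^ 2 ≤ 4 * B ^ 4 * (ρ ^ 4 * U₀ ^ 2) := by
      calc q ^ 2 = |q| ^ 2 := (sq_abs _).symm
        _ ≤ (2 * B ^ 2 * ρ ^ 2 * |U₀|) ^ 2 := pow_le_pow_left₀ (abs_nonneg _) e2 2
        _ = 4 * B ^ 4 * (ρ ^ 4 * |U₀| ^ 2) := by ring
        _ = _ := by rw [sq_abs]
    have : V₂ ^ 2 ≤ 3 * (U₂ ^ 2 + (2 * (ρ * p₁) * U₁) ^ 2 + q ^ 2) := by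
      have : V₂ = U₂ + 2 * (ρ * p₁) * U₁ + q := by simp only [hq]; ring
      rw [this]
      exact add_add_sq_le _ _ _
    have g1 := mul_le_mul_of_nonneg_left this ρ0.le
    have g2 := mul_le_mul_of_nonneg_left hp (show 0 ≤ ρ ^ 3 * U₁ ^ 2 by positivity)
    have g3 := mul_le_mul_of_nonneg_left hq2 ρ0.le
    linarith
  have w5 : 0 ≤ ρ ^ 5 * U₀ ^ 2 := by positivity
  have w3 : 0 ≤ ρ ^ 3 * U₁ ^ 2 := by positivity
  have w1 : 0 ≤ ρ * U₂ ^ 2 := by positivity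
  have n5 : 0 ≤ (2 + 3 * (1 + 4 * B ^ 2)) * (ρ ^ 5 * U₀ ^ 2) := by positivity
  have n3 : 0 ≤ (1 + 2 * B ^ 2 + 3 * (1 + 4 * B ^ 4)) * (ρ ^ 3 * U₁ ^ 2) := by positivity
  have n1 : 0 ≤ (1 + 2 * (1 + B ^ 2) + 3 * (4 * B ^ 2 + 4 * B ^ 4)) * (ρ * U₂ ^ 2) := by positivity
  rw [carlemanNorm, carlemanNorm]
  linarith

/-! ### The divergence identity -/

/-- The flux in the divergence identity. -/
noncomputable def carlemanFlux (a b V₀ V₁ V₂ Vt : ℝ) : ℝ :=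
  3 * a * Vt * V₁ + 3 / 2 * a * V₂ ^ 2 + a ^ 3 * V₀ * V₂ + 4 * a ^ 3 * V₁ ^ 2
    - 3 * a ^ 2 * b * V₀ * V₁ + 3 * b * V₁ * V₂ + 3 / 2 * a ^ 5 * V₀ ^ 2

/-- The density in the divergence identity. -/
noncomputable def carlemanDensity (a V₀ V₁ : ℝ) : ℝ := 1 / 2 * a ^ 3 * V₀ ^ 2 - 3 / 2 * a * V₁ ^ 2

/-- The time derivative of the density. -/
noncomputable def carlemanDensityDeriv (a a' V₀ V₁ Vt Vtx : ℝ) : ℝ :=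
  3 / 2 * a ^ 2 * a' * V₀ ^ 2 + a ^ 3 * V₀ * Vt - 3 / 2 * a' * V₁ ^ 2 - 3 * a * V₁ * Vtx

/-- The flux collects the boundary terms of the integrations by parts in `P₁P₂`. The mixed
derivative `Vtx` produced by `3a Vt V₁` cancels against the one in the time derivative of the
density, so `carlemanDiv` does not contain it. -/
theorem hasDerivAt_carlemanFlux {a b V₀ V₁ V₂ Vt : ℝ → ℝ} {a' c V₃ Vtx x : ℝ}
    (ha : HasDerivAt a (b x) x) (hb : HasDerivAt b c x) (h0 : HasDerivAt V₀ (V₁ x) x)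
    (h1 : HasDerivAt V₁ (V₂ x) x) (h2 : HasDerivAt V₂ V₃ x) (ht : HasDerivAt Vt Vtx x) :
    HasDerivAt (fun x => carlemanFlux (a x) (b x) (V₀ x) (V₁ x) (V₂ x) (Vt x))
      (carlemanDiv (a x) (b x) c a' (V₀ x) (V₁ x) (V₂ x) V₃ (Vt x)
        - carlemanDensityDeriv (a x) a' (V₀ x) (V₁ x) (Vt x) Vtx) x := by
  have d := (((((((ha.const_mul 3).mul ht).mul h1).add ((ha.const_mul (3 / 2)).mul (h2.pow 2))).add
    (((ha.pow 3).mul h0).mul h2)).add (((ha.pow 3).const_mul 4).mul (h1.pow 2))).sub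
    (((((ha.pow 2).const_mul 3).mul hb).mul h0).mul h1)).add
    (((hb.const_mul 3).mul h1).mul h2) |>.add (((ha.pow 5).const_mul (3 / 2)).mul (h0.pow 2))
  refine d.congr_deriv ?_
  simp only [carlemanDiv, carlemanDensityDeriv, Pi.mul_apply, Pi.pow_apply]
  push_cast
  ring

theorem hasDerivAt_carlemanDensity {a V₀ V₁ : ℝ → ℝ} {a' Vt Vtx t : ℝ}
    (ha : HasDerivAt a a' t) (h0 : HasDerivAt V₀ Vt t) (h1 : HasDerivAt V₁ Vtx t) :
    HasDerivAt (fun t => carlemanDensity (a t) (V₀ t) (V₁ t))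
      (carlemanDensityDeriv (a t) a' (V₀ t) (V₁ t) Vt Vtx) t := by
  have d := (((ha.pow 3).const_mul (1 / 2)).mul (h0.pow 2)).sub
    ((ha.const_mul (3 / 2)).mul (h1.pow 2))
  refine d.congr_deriv ?_
  simp only [carlemanDensityDeriv, Pi.pow_apply]
  push_cast
  ring

/-- `∂ₓ(e^{-θ} U)` up to the factor `e^{-θ}`, with `a = ∂ₓθ`. -/
def conj₁ (a U₀ U₁ : ℝ) : ℝ := U₁ - a * U₀

/-- `∂ₓ²(e^{-θ} U)` up to the factor `e^{-θ}`. -/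
def conj₂ (a b U₀ U₁ U₂ : ℝ) : ℝ := U₂ - 2 * a * U₁ + (a ^ 2 - b) * U₀

/-- `∂ₓ³(e^{-θ} U)` up to the factor `e^{-θ}`. -/
def conj₃ (a b c U₀ U₁ U₂ U₃ : ℝ) : ℝ :=
  U₃ - 3 * a * U₂ + (3 * a ^ 2 - 3 * b) * U₁ + (3 * a * b - a ^ 3 - c) * U₀

/-- `∂ₜ∂ₓ(e^{-θ} U)` up to the factor `e^{-θ}`, with `q = ∂ₜθ` and `a' = ∂ₜ∂ₓθ`. -/
def conjₜ₁ (a a' q U₀ U₁ W₀ W₁ : ℝ) : ℝ := W₁ - q * U₁ - a' * U₀ - a * (W₀ - q * U₀)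

theorem hasDerivAt_conj₀ {e U₀ : ℝ → ℝ} {a U₁ x : ℝ} (he : HasDerivAt e (-a * e x) x)
    (h0 : HasDerivAt U₀ U₁ x) :
    HasDerivAt (fun x => e x * U₀ x) (e x * conj₁ a (U₀ x) U₁) x :=
  (he.mul h0).congr_deriv (by simp only [conj₁]; ring)

theorem hasDerivAt_conj₁ {e a U₀ U₁ : ℝ → ℝ} {b U₂ x : ℝ} (he : HasDerivAt e (-a x * e x) x)
    (ha : HasDerivAt a b x) (h0 : HasDerivAt U₀ (U₁ x) x) (h1 : HasDerivAt U₁ U₂ x) :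
    HasDerivAt (fun x => e x * conj₁ (a x) (U₀ x) (U₁ x))
      (e x * conj₂ (a x) b (U₀ x) (U₁ x) U₂) x :=
  (he.mul (h1.sub (ha.mul h0))).congr_deriv (by simp only [conj₂, Pi.sub_apply, Pi.mul_apply]; ring)

theorem hasDerivAt_conj₂ {e a b U₀ U₁ U₂ : ℝ → ℝ} {c U₃ x : ℝ} (he : HasDerivAt e (-a x * e x) x)
    (ha : HasDerivAt a (b x) x) (hb : HasDerivAt b c x) (h0 : HasDerivAt U₀ (U₁ x) x)
    (h1 : HasDerivAt U₁ (U₂ x) x) (h2 : HasDerivAt U₂ U₃ x) :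
    HasDerivAt (fun x => e x * conj₂ (a x) (b x) (U₀ x) (U₁ x) (U₂ x))
      (e x * conj₃ (a x) (b x) c (U₀ x) (U₁ x) (U₂ x) U₃) x :=
  (he.mul ((h2.sub ((ha.const_mul 2).mul h1)).add (((ha.pow 2).sub hb).mul h0))).congr_deriv (by
    simp only [conj₃, Pi.sub_apply, Pi.mul_apply, Pi.add_apply, Pi.pow_apply]
    push_cast
    ring)

theorem hasDerivAt_conjₜ {e q U₀ W₀ : ℝ → ℝ} {a a' U₁ W₁ x : ℝ} (he : HasDerivAt e (-a * e x) x)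
    (hq : HasDerivAt q a' x) (h0 : HasDerivAt U₀ U₁ x) (hw : HasDerivAt W₀ W₁ x) :
    HasDerivAt (fun x => e x * (W₀ x - q x * U₀ x))
      (e x * conjₜ₁ a a' (q x) (U₀ x) U₁ (W₀ x) W₁) x :=
  (he.mul (hw.sub (hq.mul h0))).congr_deriv (by
    simp only [conjₜ₁, Pi.sub_apply, Pi.mul_apply]; ring)

theorem hasDerivAt_time_conj₁ {e a U₀ U₁ : ℝ → ℝ} {q a' W₀ W₁ t : ℝ}
    (he : HasDerivAt e (-q * e t) t) (ha : HasDerivAt a a' t) (h0 : HasDerivAt U₀ W₀ t)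
    (h1 : HasDerivAt U₁ W₁ t) :
    HasDerivAt (fun t => e t * conj₁ (a t) (U₀ t) (U₁ t))
      (e t * conjₜ₁ (a t) a' q (U₀ t) (U₁ t) W₀ W₁) t :=
  (he.mul (h1.sub (ha.mul h0))).congr_deriv (by
    simp only [conjₜ₁, Pi.sub_apply, Pi.mul_apply]; ring)

/-- The conjugated equation. -/
theorem conj_equation (e a b c q U₀ U₁ U₂ W₀ : ℝ) :
    e * (W₀ - q * U₀) + q * (e * U₀) + e * conj₃ a b c U₀ U₁ U₂ (U₂ - W₀)
      + 3 * a * (e * conj₂ a b U₀ U₁ U₂) + 3 * (a ^ 2 + b) * (e * conj₁ a U₀ U₁)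
      + (a ^ 3 + 3 * a * b + c) * (e * U₀) - e * conj₂ a b U₀ U₁ U₂ - 2 * a * (e * conj₁ a U₀ U₁)
      - (a ^ 2 + b) * (e * U₀) = 0 := by
  simp only [conj₁, conj₂, conj₃]; ring

theorem carlemanNorm_mul (ρ e V₀ V₁ V₂ : ℝ) :
    carlemanNorm ρ (e * V₀) (e * V₁) (e * V₂) = e ^ 2 * carlemanNorm ρ V₀ V₁ V₂ := by
  simp only [carlemanNorm]; ring

/-- Conjugation by `e^{-θ}` and its inverse differ only by the sign of `θ`, so both comparisons are
cases of `carlemanNorm_le`, with `-p₁` and `p₁`. -/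
theorem exists_carlemanNorm_conj_le {B : ℝ} (hB : 1 ≤ B) : ∃ C : ℝ, 0 < C ∧
    ∀ p₁ p₂ ρ U₀ U₁ U₂ : ℝ, |p₁| ≤ B → |p₂| ≤ B → 1 ≤ ρ →
      carlemanNorm ρ U₀ (conj₁ (ρ * p₁) U₀ U₁) (conj₂ (ρ * p₁) (ρ * p₂) U₀ U₁ U₂) ≤
        C * carlemanNorm ρ U₀ U₁ U₂ ∧
      carlemanNorm ρ U₀ U₁ U₂ ≤
        C * carlemanNorm ρ U₀ (conj₁ (ρ * p₁) U₀ U₁) (conj₂ (ρ * p₁) (ρ * p₂) U₀ U₁ U₂) := by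
  obtain ⟨C, hC, h⟩ := carlemanNorm_le hB
  refine ⟨C, hC, fun p₁ p₂ ρ U₀ U₁ U₂ h1 h2 hρ => ?_⟩
  have key : ∀ σ : ℝ, |σ| ≤ 1 → |(ρ * p₁) ^ 2 + σ * (ρ * p₂)| ≤ 2 * B ^ 2 * ρ ^ 2 := by
    intro σ hσ
    have k1 : |p₁ ^ 2| ≤ B ^ 2 := by
      rw [abs_pow]; exact pow_le_pow_left₀ (abs_nonneg _) h1 2
    have k2 : |σ * (ρ * p₂)| ≤ 1 * (ρ ^ 2 * B ^ 2) := by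
      refine abs_mul_le_of_abs_le hσ (abs_mul_le_of_abs_le ?_ ?_)
      · rw [abs_of_pos (by linarith)]; nlinarith
      · nlinarith
    have k3 : |(ρ * p₁) ^ 2| ≤ ρ ^ 2 * B ^ 2 := by
      rw [mul_pow]; exact abs_mul_le_of_abs_le (abs_of_nonneg (by positivity)).le k1
    linarith [abs_add_le ((ρ * p₁) ^ 2) (σ * (ρ * p₂))]
  constructor
  · refine h (-p₁) p₂ ρ _ _ _ _ _ (by rwa [abs_neg]) h2 hρ (by simp only [conj₁]; ring) ?_
    have e : conj₂ (ρ * p₁) (ρ * p₂) U₀ U₁ U₂ - U₂ - 2 * (ρ * -p₁) * U₁ =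
      ((ρ * p₁) ^ 2 + (-1) * (ρ * p₂)) * U₀ := by simp only [conj₂]; ring
    rw [e, abs_mul]
    exact mul_le_mul_of_nonneg_right (key (-1) (by norm_num)) (abs_nonneg _)
  · refine h p₁ p₂ ρ _ _ _ _ _ h1 h2 hρ (by simp only [conj₁]; ring) ?_
    have e : U₂ - conj₂ (ρ * p₁) (ρ * p₂) U₀ U₁ U₂ - 2 * (ρ * p₁) * conj₁ (ρ * p₁) U₀ U₁ =
      ((ρ * p₁) ^ 2 + 1 * (ρ * p₂)) * U₀ := by simp only [conj₁, conj₂]; ring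
    rw [e, abs_mul]
    exact mul_le_mul_of_nonneg_right (key 1 (by norm_num)) (abs_nonneg _)

/-- With `V₀ = Vt = 0` the flux reduces to `3/2 a V₂² + 4a³ V₁²`, negative because `p₁ < 0`, and a
cross term `3b V₁ V₂` that large `ρ` absorbs. -/
theorem carlemanFlux_left_le {B κ₀ : ℝ} (hκ₀ : 0 < κ₀) (hB : 1 ≤ B) :
    ∃ ρ₀ κ : ℝ, 0 < κ ∧ ∀ p₁ p₂ ρ U₁ U₂ : ℝ, |p₁| ≤ B → |p₂| ≤ B → p₁ ≤ -κ₀ → 1 ≤ ρ → ρ₀ ≤ ρ →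
      carlemanFlux (ρ * p₁) (ρ * p₂) 0 U₁ (conj₂ (ρ * p₁) (ρ * p₂) 0 U₁ U₂) 0 ≤
        -κ * (ρ ^ 3 * U₁ ^ 2 + ρ * U₂ ^ 2) := by
  obtain ⟨C, hC, h⟩ := exists_carlemanNorm_conj_le hB
  -- Half of the coefficients `3/2 κ₀` and `4 κ₀³`; the other halves absorb the cross term.
  set κ : ℝ := min (3 / 4 * κ₀) (2 * κ₀ ^ 3) with hκ
  have κ0 : 0 < κ := by simp only [hκ, lt_min_iff]; constructor <;> positivity
  refine ⟨2 * B ^ 2 / κ₀ ^ 4, κ / C, by positivity, ?_⟩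
  intro p₁ p₂ ρ U₁ U₂ h1 h2 hp hρ hρ'
  have ρ0 : 0 < ρ := by linarith
  have h' := (h p₁ p₂ ρ 0 U₁ U₂ h1 h2 hρ).2
  set V₂ := conj₂ (ρ * p₁) (ρ * p₂) 0 U₁ U₂ with hV₂
  have e1 : conj₁ (ρ * p₁) 0 U₁ = U₁ := by simp [conj₁]
  rw [e1, carlemanNorm, carlemanNorm] at h'
  have e2 : carlemanFlux (ρ * p₁) (ρ * p₂) 0 U₁ V₂ 0 =
      -(3 / 2 * (-p₁) * (ρ * V₂ ^ 2)) - 4 * (-p₁) ^ 3 * (ρ ^ 3 * U₁ ^ 2) + 3 * (ρ * p₂) * (U₁ * V₂) := by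
    simp only [carlemanFlux]; ring
  have w3 : 0 ≤ ρ ^ 3 * U₁ ^ 2 := by positivity
  have w1 : 0 ≤ ρ * V₂ ^ 2 := by positivity
  have f1 := mul_le_mul_of_nonneg_right (show κ₀ ≤ -p₁ by linarith) w1
  have f2 := mul_le_mul_of_nonneg_right (pow_le_pow_left₀ hκ₀.le (show κ₀ ≤ -p₁ by linarith) 3) w3
  have f3 : 3 * (ρ * p₂) * (U₁ * V₂) ≤ 3 / 4 * κ₀ * (ρ * V₂ ^ 2) + 3 * B ^ 2 / κ₀ * (ρ * U₁ ^ 2) := by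
    have q1 : p₂ * (U₁ * V₂) ≤ B * |U₁ * V₂| :=
      (le_abs_self _).trans (abs_mul_le_of_abs_le h2 le_rfl)
    have q2 : B * |U₁ * V₂| ≤ κ₀ / 4 * V₂ ^ 2 + B ^ 2 / κ₀ * U₁ ^ 2 := by
      rw [abs_mul, ← sq_abs V₂, ← sq_abs U₁]
      have e : κ₀ / 4 * |V₂| ^ 2 + B ^ 2 / κ₀ * |U₁| ^ 2 - B * (|U₁| * |V₂|) =
        (κ₀ * |V₂| / 2 - B * |U₁|) ^ 2 / κ₀ := by field_simp; ring
      have : 0 ≤ (κ₀ * |V₂| / 2 - B * |U₁|) ^ 2 / κ₀ := by positivity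
      linarith
    calc 3 * (ρ * p₂) * (U₁ * V₂) = 3 * ρ * (p₂ * (U₁ * V₂)) := by ring
      _ ≤ 3 * ρ * (κ₀ / 4 * V₂ ^ 2 + B ^ 2 / κ₀ * U₁ ^ 2) :=
        mul_le_mul_of_nonneg_left (q1.trans q2) (by positivity)
      _ = _ := by ring
  have f4 : 3 * B ^ 2 / κ₀ * (ρ * U₁ ^ 2) ≤ 2 * κ₀ ^ 3 * (ρ ^ 3 * U₁ ^ 2) := by
    rw [div_le_iff₀ (by positivity)] at hρ'
    have q : 3 * B ^ 2 / κ₀ ≤ 2 * κ₀ ^ 3 * ρ ^ 2 := by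
      rw [div_le_iff₀ hκ₀]
      have : ρ * κ₀ ^ 4 ≤ ρ ^ 2 * κ₀ ^ 4 := mul_le_mul_of_nonneg_right (by nlinarith) (by positivity)
      nlinarith [sq_nonneg B]
    have := mul_le_mul_of_nonneg_right q (show 0 ≤ ρ * U₁ ^ 2 by positivity)
    linarith
  have m1 := mul_le_mul_of_nonneg_right (show κ ≤ 3 / 4 * κ₀ from min_le_left _ _) w1
  have m2 := mul_le_mul_of_nonneg_right (show κ ≤ 2 * κ₀ ^ 3 from min_le_right _ _) w3
  have m3 : κ / C * (ρ ^ 3 * U₁ ^ 2 + ρ * U₂ ^ 2) ≤ κ * (ρ ^ 3 * U₁ ^ 2 + ρ * V₂ ^ 2) := by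
    rw [div_mul_eq_mul_div, div_le_iff₀ hC]
    have := mul_le_mul_of_nonneg_left h' κ0.le
    linarith
  rw [e2]
  linarith

/-! ### The Carleman inequality at a fixed time -/

/-- A weight with its derivatives and bounds for them. -/
structure WeightData (L l₁ l₂ B κ₀ m : ℝ) (ψ p₁ p₂ p₃ : ℝ → ℝ) : Prop where
  one_le : 1 ≤ B
  κ_pos : 0 < κ₀
  m_pos : 0 < m
  cont₀ : ContinuousOn ψ (Icc (-L) L)
  cont₁ : ContinuousOn p₁ (Icc (-L) L)
  cont₂ : ContinuousOn p₂ (Icc (-L) L)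
  cont₃ : ContinuousOn p₃ (Icc (-L) L)
  deriv₀ : ∀ x ∈ Ioo (-L) L, HasDerivAt ψ (p₁ x) x
  deriv₁ : ∀ x ∈ Ioo (-L) L, HasDerivAt p₁ (p₂ x) x
  deriv₂ : ∀ x ∈ Ioo (-L) L, HasDerivAt p₂ (p₃ x) x
  le₀ : ∀ x ∈ Icc (-L) L, |ψ x| ≤ B
  le₁ : ∀ x ∈ Icc (-L) L, |p₁ x| ≤ B
  le₂ : ∀ x ∈ Icc (-L) L, |p₂ x| ≤ B
  le₃ : ∀ x ∈ Icc (-L) L, |p₃ x| ≤ B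
  m_le : ∀ x ∈ Icc (-L) L, m ≤ ψ x
  off : ∀ x ∈ Icc (-L) L \ Ioo l₁ l₂, κ₀ ≤ |p₁ x| ∧ p₂ x ≤ -κ₀
  left : p₁ (-L) ≤ -κ₀
  right : 0 ≤ p₁ L

/-- A function on `[-L, L]` with its derivatives and its time derivative, satisfying the equation
and the boundary conditions. -/
structure IsSlice (L : ℝ) (u₀ u₁ u₂ w₀ w₁ : ℝ → ℝ) : Prop where
  cont₀ : ContinuousOn u₀ (Icc (-L) L)
  cont₁ : ContinuousOn u₁ (Icc (-L) L)
  cont₂ : ContinuousOn u₂ (Icc (-L) L)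
  contw₀ : ContinuousOn w₀ (Icc (-L) L)
  contw₁ : ContinuousOn w₁ (Icc (-L) L)
  deriv₀ : ∀ x ∈ Ioo (-L) L, HasDerivAt u₀ (u₁ x) x
  deriv₁ : ∀ x ∈ Ioo (-L) L, HasDerivAt u₁ (u₂ x) x
  deriv₂ : ∀ x ∈ Ioo (-L) L, HasDerivAt u₂ (u₂ x - w₀ x) x
  derivw : ∀ x ∈ Ioo (-L) L, HasDerivAt w₀ (w₁ x) x
  left : u₀ (-L) = 0
  right : u₀ L = 0
  right₁ : u₁ L = 0
  leftw : w₀ (-L) = 0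
  rightw : w₀ L = 0

/-- The time derivative of the density for the conjugated function. -/
noncomputable def densityDeriv (p₀ p₁ ρ r U₀ U₁ W₀ W₁ : ℝ) : ℝ :=
  carlemanDensityDeriv (ρ * p₁) (r * p₁) (Real.exp (-(ρ * p₀)) * U₀)
    (Real.exp (-(ρ * p₀)) * conj₁ (ρ * p₁) U₀ U₁) (Real.exp (-(ρ * p₀)) * (W₀ - r * p₀ * U₀))
    (Real.exp (-(ρ * p₀)) * conjₜ₁ (ρ * p₁) (r * p₁) (r * p₀) U₀ U₁ W₀ W₁)

/-- The weighted norm of the conjugated function, in terms of the function. -/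
noncomputable def weightedNorm (p₀ ρ U₀ U₁ U₂ : ℝ) : ℝ :=
  Real.exp (-(ρ * p₀)) ^ 2 * carlemanNorm ρ U₀ U₁ U₂

/-- The pointwise bound is integrated over `[-L, L]`: the flux at `L` is nonnegative, and the flux
at `-L` provides the boundary term. The left-hand side is the integral of the time derivative of the
density. -/
theorem carleman_slice {L l₁ l₂ B κ₀ m : ℝ} {ψ p₁ p₂ p₃ : ℝ → ℝ} (hL : 0 < L)
    (hω : Ioo l₁ l₂ ⊆ Ioo (-L) L) (hψ : WeightData L l₁ l₂ B κ₀ m ψ p₁ p₂ p₃) :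
    ∃ ρ₀ c C : ℝ, 1 ≤ ρ₀ ∧ 0 < c ∧ 0 < C ∧ ∀ ρ r : ℝ, ρ₀ ≤ ρ → |r| ≤ ρ ^ 2 →
      ∀ u₀ u₁ u₂ w₀ w₁ : ℝ → ℝ, IsSlice L u₀ u₁ u₂ w₀ w₁ →
        ∫ x in Ioo (-L) L, densityDeriv (ψ x) (p₁ x) ρ r (u₀ x) (u₁ x) (w₀ x) (w₁ x) ≤
          C * (∫ x in Ioo l₁ l₂, weightedNorm (ψ x) ρ (u₀ x) (u₁ x) (u₂ x))
            - c * (∫ x in Ioo (-L) L, weightedNorm (ψ x) ρ (u₀ x) (u₁ x) (u₂ x))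
            - c * weightedNorm (ψ (-L)) ρ 0 (u₁ (-L)) (u₂ (-L)) := by
  obtain ⟨ρ₁, κ, C, hρ₁, hκ, hC, hdiv⟩ := carlemanDiv_sub_le hψ.one_le hψ.κ_pos
  obtain ⟨ρ₂, κb, hκb, hbd⟩ := carlemanFlux_left_le hψ.κ_pos hψ.one_le
  obtain ⟨D, hD, hcomp⟩ := exists_carlemanNorm_conj_le hψ.one_le
  have hle : -L ≤ L := by linarith
  refine ⟨max ρ₁ ρ₂, min (κ / D) κb, C * D, hρ₁.trans (le_max_left _ _), by positivity,
    by positivity, ?_⟩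
  intro ρ r hρ hr u₀ u₁ u₂ w₀ w₁ hu
  have hρ1 : ρ₁ ≤ ρ := (le_max_left _ _).trans hρ
  have hρ2 : ρ₂ ≤ ρ := (le_max_right _ _).trans hρ
  have hρ' : 1 ≤ ρ := hρ₁.trans hρ1
  obtain ⟨-, -, -, cψ, cp₁, cp₂, cp₃, dψ, dp₁, dp₂, b₀, b₁, b₂, b₃, -, hoff, hleft, hright⟩ := hψ
  obtain ⟨cu₀, cu₁, cu₂, cw₀, cw₁, du₀, du₁, du₂, dw₀, ul, ur, ur₁, wl, wr⟩ := hu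
  set e : ℝ → ℝ := fun x => Real.exp (-(ρ * ψ x)) with he
  have ce : ContinuousOn e (Icc (-L) L) := by fun_prop
  have de : ∀ x ∈ Ioo (-L) L, HasDerivAt e (-(ρ * p₁ x) * e x) x := fun x hx =>
    (((dψ x hx).const_mul ρ).fun_neg.exp).congr_deriv (by simp only [he]; ring)
  set V₀ : ℝ → ℝ := fun x => e x * u₀ x with hV₀
  set V₁ : ℝ → ℝ := fun x => e x * conj₁ (ρ * p₁ x) (u₀ x) (u₁ x) with hV₁
  set V₂ : ℝ → ℝ := fun x => e x * conj₂ (ρ * p₁ x) (ρ * p₂ x) (u₀ x) (u₁ x) (u₂ x) with hV₂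
  set V₃ : ℝ → ℝ := fun x => e x * conj₃ (ρ * p₁ x) (ρ * p₂ x) (ρ * p₃ x) (u₀ x) (u₁ x) (u₂ x)
    (u₂ x - w₀ x) with hV₃
  set Vt : ℝ → ℝ := fun x => e x * (w₀ x - r * ψ x * u₀ x) with hVt
  set Vtx : ℝ → ℝ := fun x => e x * conjₜ₁ (ρ * p₁ x) (r * p₁ x) (r * ψ x) (u₀ x) (u₁ x) (w₀ x)
    (w₁ x) with hVtx
  have cV₀ : ContinuousOn V₀ (Icc (-L) L) := by fun_prop
  have cV₁ : ContinuousOn V₁ (Icc (-L) L) := by simp only [hV₁, conj₁]; fun_prop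
  have cV₂ : ContinuousOn V₂ (Icc (-L) L) := by simp only [hV₂, conj₂]; fun_prop
  have cV₃ : ContinuousOn V₃ (Icc (-L) L) := by simp only [hV₃, conj₃]; fun_prop
  have cVt : ContinuousOn Vt (Icc (-L) L) := by fun_prop
  have cVtx : ContinuousOn Vtx (Icc (-L) L) := by simp only [hVtx, conjₜ₁]; fun_prop
  -- the main quantities
  set G : ℝ → ℝ := fun x => carlemanDensityDeriv (ρ * p₁ x) (r * p₁ x) (V₀ x) (V₁ x) (Vt x) (Vtx x)
    with hG
  set N : ℝ → ℝ := fun x => carlemanDiv (ρ * p₁ x) (ρ * p₂ x) (ρ * p₃ x) (r * p₁ x) (V₀ x) (V₁ x)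
    (V₂ x) (V₃ x) (Vt x) - 4 * κ * (ρ ^ 3 * V₁ x ^ 2 + ρ ^ 3 * V₀ x * V₂ x) with hN
  set F : ℝ → ℝ := fun x => weightedNorm (ψ x) ρ (u₀ x) (u₁ x) (u₂ x) with hF
  -- The correction supplies the missing `V₁²`; it contributes nothing at `±L`, where `V₀ = 0`.
  set Q : ℝ → ℝ := fun x => carlemanFlux (ρ * p₁ x) (ρ * p₂ x) (V₀ x) (V₁ x) (V₂ x) (Vt x)
    - 4 * κ * ρ ^ 3 * (V₀ x * V₁ x) with hQ
  have cG : ContinuousOn G (Icc (-L) L) := by simp only [hG, carlemanDensityDeriv]; fun_prop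
  have cN : ContinuousOn N (Icc (-L) L) := by simp only [hN, carlemanDiv]; fun_prop
  have cF : ContinuousOn F (Icc (-L) L) := by
    simp only [hF, weightedNorm, carlemanNorm]; fun_prop
  have cQ : ContinuousOn Q (Icc (-L) L) := by simp only [hQ, carlemanFlux]; fun_prop
  have dQ : ∀ x ∈ Ioo (-L) L, HasDerivAt Q (N x - G x) x := by
    intro x hx
    have da := (dp₁ x hx).const_mul ρ
    have h0 : HasDerivAt V₀ (V₁ x) x :=
      hasDerivAt_conj₀ (e := e) (a := ρ * p₁ x) (de x hx) (du₀ x hx)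
    have h1 : HasDerivAt V₁ (V₂ x) x :=
      hasDerivAt_conj₁ (a := fun x => ρ * p₁ x) (de x hx) ((dp₁ x hx).const_mul ρ) (du₀ x hx)
        (du₁ x hx)
    have h2 : HasDerivAt V₂ (V₃ x) x :=
      hasDerivAt_conj₂ (a := fun x => ρ * p₁ x) (b := fun x => ρ * p₂ x) (de x hx)
        ((dp₁ x hx).const_mul ρ) ((dp₂ x hx).const_mul ρ) (du₀ x hx) (du₁ x hx) (du₂ x hx)
    have h3 : HasDerivAt Vt (Vtx x) x :=
      hasDerivAt_conjₜ (q := fun x => r * ψ x) (a := ρ * p₁ x) (de x hx) ((dψ x hx).const_mul r)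
        (du₀ x hx) (dw₀ x hx)
    refine ((hasDerivAt_carlemanFlux (a := fun x => ρ * p₁ x) (b := fun x => ρ * p₂ x)
      (a' := r * p₁ x) ((dp₁ x hx).const_mul ρ) ((dp₂ x hx).const_mul ρ) h0 h1 h2 h3).sub
      ((h0.mul h1).const_mul (4 * κ * ρ ^ 3))).congr_deriv ?_
    simp only [hN, hG]
    ring
  have hFTC := integral_eq_sub hle cQ dQ (cN.sub cG)
  -- the boundary terms
  have hQL : 0 ≤ Q L := by
    have e0 : V₀ L = 0 := by simp [hV₀, ur]
    have e1 : V₁ L = 0 := by simp [hV₁, conj₁, ur, ur₁]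
    have et : Vt L = 0 := by simp [hVt, ur, wr]
    have : Q L = 3 / 2 * (ρ * p₁ L) * V₂ L ^ 2 := by
      simp only [hQ, carlemanFlux, e0, e1, et]; ring
    rw [this]
    have : 0 < ρ := by linarith
    positivity
  have hQl : Q (-L) ≤ -κb * weightedNorm (ψ (-L)) ρ 0 (u₁ (-L)) (u₂ (-L)) := by
    have hm : -L ∈ Icc (-L) L := ⟨le_rfl, hle⟩
    have := mul_le_mul_of_nonneg_left (hbd (p₁ (-L)) (p₂ (-L)) ρ (u₁ (-L)) (u₂ (-L)) (b₁ _ hm)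
      (b₂ _ hm) hleft hρ' hρ2) (sq_nonneg (e (-L)))
    have e0 : V₀ (-L) = 0 := by simp [hV₀, ul]
    have et : Vt (-L) = 0 := by simp [hVt, ul, wl]
    have e1 : V₁ (-L) = e (-L) * u₁ (-L) := by simp [hV₁, conj₁, ul]
    have e2 : V₂ (-L) = e (-L) * conj₂ (ρ * p₁ (-L)) (ρ * p₂ (-L)) 0 (u₁ (-L)) (u₂ (-L)) := by
      simp [hV₂, ul]
    have e3 : Q (-L) = e (-L) ^ 2 * carlemanFlux (ρ * p₁ (-L)) (ρ * p₂ (-L)) 0 (u₁ (-L))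
        (conj₂ (ρ * p₁ (-L)) (ρ * p₂ (-L)) 0 (u₁ (-L)) (u₂ (-L))) 0 := by
      simp only [hQ, e0, et, e1, e2, carlemanFlux]; ring
    rw [e3]
    refine this.trans (le_of_eq ?_)
    simp only [weightedNorm, carlemanNorm, he]; ring
  -- the interior terms
  have hF0 : ∀ x, 0 ≤ F x := fun x => by
    have : 0 < ρ := by linarith
    simp only [hF, weightedNorm, carlemanNorm]; positivity
  have hNle : ∀ x ∈ Ioo (-L) L, N x ≤ (Ioo l₁ l₂).indicator (fun x => C * D * F x) x
      - κ / D * F x := by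
    intro x hx
    have hx' := Ioo_subset_Icc_self hx
    obtain ⟨q1, q2⟩ := hdiv (ψ x) (p₁ x) (p₂ x) (p₃ x) ρ r (V₀ x) (V₁ x) (V₂ x) (V₃ x) (Vt x)
      (b₀ x hx') (b₁ x hx') (b₂ x hx') (b₃ x hx') hρ1 hr
      (conj_equation (e x) (ρ * p₁ x) (ρ * p₂ x) (ρ * p₃ x) (r * ψ x) (u₀ x) (u₁ x) (u₂ x) (w₀ x))
    obtain ⟨c1, c2⟩ := hcomp (p₁ x) (p₂ x) ρ (u₀ x) (u₁ x) (u₂ x) (b₁ x hx') (b₂ x hx') hρ'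
    have e1 : carlemanNorm ρ (V₀ x) (V₁ x) (V₂ x) ≤ D * F x := by
      simp only [hV₀, hV₁, hV₂, hF, weightedNorm]
      rw [carlemanNorm_mul]
      refine (mul_le_mul_of_nonneg_left c1 (sq_nonneg _)).trans (le_of_eq ?_)
      simp only [he]; ring
    have e2 : F x ≤ D * carlemanNorm ρ (V₀ x) (V₁ x) (V₂ x) := by
      simp only [hV₀, hV₁, hV₂, hF, weightedNorm]
      rw [carlemanNorm_mul]
      refine (mul_le_mul_of_nonneg_left c2 (sq_nonneg _)).trans (le_of_eq ?_)
      simp only [he]; ring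
    have e3 : κ / D * F x ≤ κ * carlemanNorm ρ (V₀ x) (V₁ x) (V₂ x) := by
      rw [div_mul_eq_mul_div, div_le_iff₀ hD]
      have := mul_le_mul_of_nonneg_left e2 hκ.le
      linarith
    by_cases hxω : x ∈ Ioo l₁ l₂
    · rw [indicator_of_mem hxω]
      have := mul_le_mul_of_nonneg_left e1 hC.le
      simp only [hN]
      linarith
    · rw [indicator_of_notMem hxω]
      have := q2 (hoff x ⟨hx', hxω⟩).1 (hoff x ⟨hx', hxω⟩).2
      simp only [hN]
      linarith
  have iN := integrableOn_of_continuousOn cN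
  have iG := integrableOn_of_continuousOn cG
  have iF := integrableOn_of_continuousOn cF
  have hint : ∫ x in Ioo (-L) L, N x ≤ C * D * (∫ x in Ioo l₁ l₂, F x)
      - κ / D * ∫ x in Ioo (-L) L, F x := by
    refine (setIntegral_mono_on iN (((iF.const_mul (C * D)).indicator measurableSet_Ioo).sub
      (iF.const_mul (κ / D))) measurableSet_Ioo hNle).trans (le_of_eq ?_)
    simp only [Pi.sub_apply]
    rw [integral_sub ((iF.const_mul (C * D)).indicator measurableSet_Ioo) (iF.const_mul _),
      setIntegral_indicator measurableSet_Ioo, inter_eq_self_of_subset_right hω,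
      integral_const_mul, integral_const_mul]
  rw [← setIntegral_Ioo_eq hle, integral_sub iN iG] at hFTC
  have hw0 : 0 ≤ weightedNorm (ψ (-L)) ρ 0 (u₁ (-L)) (u₂ (-L)) := by
    have : 0 < ρ := by linarith
    simp only [weightedNorm, carlemanNorm]; positivity
  have k1 := mul_le_mul_of_nonneg_right (min_le_right (κ / D) κb) hw0
  have hI0 : 0 ≤ ∫ x in Ioo (-L) L, F x := setIntegral_nonneg measurableSet_Ioo fun x _ => hF0 x
  have k2 := mul_le_mul_of_nonneg_right (min_le_left (κ / D) κb) hI0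
  change (∫ x in Ioo (-L) L, G x) ≤ C * D * (∫ x in Ioo l₁ l₂, F x)
    - min (κ / D) κb * (∫ x in Ioo (-L) L, F x)
    - min (κ / D) κb * weightedNorm (ψ (-L)) ρ 0 (u₁ (-L)) (u₂ (-L))
  linarith

/-! ### Integration in time -/

/-- The flow is controlled only inside `(0, T)`; integrability of `J` up to the ends permits `δ →
0`. -/
theorem integral_le_zero_of_interval_le {T M : ℝ} {J : ℝ → ℝ} (hT : 0 < T)
    (hJ : IntegrableOn J (Ioo 0 T))
    (h : ∀ δ ∈ Ioo 0 (T / 2), ∫ t in δ..(T - δ), J t ≤ M * δ) : ∫ t in Ioo 0 T, J t ≤ 0 := by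
  have hI : IntervalIntegrable J volume 0 T := by
    rw [intervalIntegrable_iff_integrableOn_Ioo_of_le hT.le]; exact hJ
  have hc : ContinuousOn (fun x => ∫ t in (0 : ℝ)..x, J t) (Icc 0 T) := by
    have := intervalIntegral.continuousOn_primitive_interval (μ := volume) (f := J) (a := 0) (b := T)
      (by rw [uIcc_of_le hT.le, integrableOn_Icc_iff_integrableOn_Ioo]; exact hJ)
    rwa [uIcc_of_le hT.le] at this
  have hc' : ContinuousOn (fun δ => (∫ t in (0 : ℝ)..(T - δ), J t) - ∫ t in (0 : ℝ)..δ, J t)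
      (Icc 0 T) := by
    refine ContinuousOn.sub (hc.comp (by fun_prop) fun δ hδ => ?_) hc
    exact ⟨by linarith [hδ.2], by linarith [hδ.1]⟩
  have hlim := (hc' 0 ⟨le_rfl, hT.le⟩).mono (show Ioo 0 (T / 2) ⊆ Icc 0 T from fun δ hδ =>
    ⟨hδ.1.le, by linarith [hδ.1, hδ.2]⟩)
  have hM : ContinuousWithinAt (fun δ : ℝ => M * δ) (Ioo 0 (T / 2)) 0 := by fun_prop
  have hne : (nhdsWithin (0 : ℝ) (Ioo 0 (T / 2))).NeBot := by
    rw [← mem_closure_iff_nhdsWithin_neBot, closure_Ioo (by linarith)]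
    exact ⟨le_rfl, by linarith⟩
  have := le_of_tendsto_of_tendsto hlim.tendsto hM.tendsto
    (by
      filter_upwards [self_mem_nhdsWithin] with δ hδ
      have m : ∀ x ∈ Icc 0 T, IntervalIntegrable J volume 0 x := fun x hx =>
        hI.mono_set (by rw [uIcc_of_le hT.le, uIcc_of_le hx.1]; exact Icc_subset_Icc le_rfl hx.2)
      rw [intervalIntegral.integral_interval_sub_left (m _ ⟨by linarith [hδ.2], by linarith [hδ.1]⟩)
        (m _ ⟨hδ.1.le, by linarith [hδ.2]⟩)]
      exact h δ hδ)
  rw [setIntegral_Ioo_eq hT.le]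
  simpa using this

/-- Fubini on a compact rectangle, then the fundamental theorem at each fixed `x`; this avoids
differentiating under the integral. -/
theorem integral_integral_deriv {L T a b : ℝ} {g h : ℝ → ℝ → ℝ} (ha : 0 < a) (hab : a ≤ b)
    (hb : b < T) (hh : ContinuousOn (fun p : ℝ × ℝ => h p.1 p.2) (Ioo 0 T ×ˢ Icc (-L) L))
    (hg : ∀ t ∈ Ioo 0 T, ∀ x ∈ Icc (-L) L, HasDerivAt (fun t => g t x) (h t x) t) :
    ∫ t in a..b, ∫ x in Ioo (-L) L, h t x = ∫ x in Ioo (-L) L, (g b x - g a x) := by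
  have hsub : Icc a b ⊆ Ioo 0 T := fun t ht => ⟨ha.trans_le ht.1, ht.2.trans_lt hb⟩
  have hi : IntegrableOn (fun p : ℝ × ℝ => h p.1 p.2) (Ioo a b ×ˢ Ioo (-L) L) := by
    refine IntegrableOn.mono_set ?_ (prod_mono Ioo_subset_Icc_self Ioo_subset_Icc_self)
    exact (hh.mono (prod_mono hsub subset_rfl)).integrableOn_compact
      (isCompact_Icc.prod isCompact_Icc)
  rw [← setIntegral_Ioo_eq hab, integral_integral_swap (by
    rw [Measure.prod_restrict]; exact hi)]
  refine setIntegral_congr_fun measurableSet_Ioo fun x hx => ?_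
  have hx' := Ioo_subset_Icc_self hx
  change ∫ t in Ioo a b, h t x = g b x - g a x
  rw [setIntegral_Ioo_eq hab]
  refine intervalIntegral.integral_eq_sub_of_hasDerivAt (f := fun t => g t x) (fun t ht => ?_) ?_
  · rw [uIcc_of_le hab] at ht
    exact hg t (hsub ht) x hx'
  · refine ContinuousOn.intervalIntegrable ?_
    rw [uIcc_of_le hab]
    exact hh.comp (f := fun t => (t, x)) (by fun_prop) fun t ht => ⟨hsub ht, hx'⟩

/-- The time-dependent factor of the weight. -/
noncomputable def rate (s T t : ℝ) : ℝ := s / (t * (T - t))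

/-- The derivative of the time-dependent factor of the weight. -/
noncomputable def rateDeriv (s T t : ℝ) : ℝ := -(s * (T - 2 * t)) / (t * (T - t)) ^ 2

section rate

variable {s T t : ℝ}

theorem mul_sub_pos (ht : t ∈ Ioo 0 T) : 0 < t * (T - t) := mul_pos ht.1 (by linarith [ht.2])

theorem hasDerivAt_rate (ht : t ∈ Ioo 0 T) : HasDerivAt (rate s T) (rateDeriv s T t) t := by
  have h1 : HasDerivAt (fun t => t * (T - t)) (T - 2 * t) t :=
    ((hasDerivAt_id t).mul ((hasDerivAt_id t).const_sub T)).congr_deriv (by simp; ring)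
  have := (hasDerivAt_const t s).div h1 (mul_sub_pos ht).ne'
  exact this.congr_deriv (by simp [rateDeriv])

theorem continuousOn_rate : ContinuousOn (rate s T) (Ioo 0 T) := fun _ ht =>
  (hasDerivAt_rate ht).continuousAt.continuousWithinAt

theorem continuousOn_rateDeriv : ContinuousOn (rateDeriv s T) (Ioo 0 T) := by
  unfold rateDeriv
  exact ContinuousOn.div (by fun_prop) (by fun_prop) fun t ht => (pow_pos (mul_sub_pos ht) 2).ne'

theorem le_rate {ρ₀ : ℝ} (hρ₀ : 0 ≤ ρ₀) (hs : ρ₀ * T ^ 2 ≤ s) (ht : t ∈ Ioo 0 T) :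
    ρ₀ ≤ rate s T t := by
  rw [rate, le_div_iff₀ (mul_sub_pos ht)]
  refine le_trans (mul_le_mul_of_nonneg_left ?_ hρ₀) hs
  nlinarith [ht.1, ht.2, sq_nonneg (T - t)]

theorem abs_rateDeriv_le (hs : T ≤ s) (ht : t ∈ Ioo 0 T) : |rateDeriv s T t| ≤ rate s T t ^ 2 := by
  have hT : 0 < T := ht.1.trans ht.2
  have := mul_sub_pos ht
  rw [rateDeriv, rate, div_pow, abs_div, abs_of_pos (pow_pos this 2)]
  gcongr
  rw [abs_neg, abs_mul, abs_of_pos (by linarith), sq]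
  refine mul_le_mul_of_nonneg_left ?_ (by linarith)
  rw [abs_le]
  constructor <;> linarith [ht.1, ht.2]

/-- Converts the growth of the solution in `1/t` into powers of the rate, which the exponential
weight absorbs. -/
theorem inv_le_rate (hs : 1 ≤ s) (ht : t ∈ Ioo 0 T) : 1 / t ≤ T * rate s T t := by
  have := mul_sub_pos ht
  have hT : 0 < T := ht.1.trans ht.2
  have h2 : 0 < T - t := by linarith [ht.2]
  have : T * rate s T t = (T * s / (T - t)) * (1 / t) := by rw [rate]; field_simp
  rw [this]
  refine le_mul_of_one_le_left (one_div_pos.2 ht.1).le ?_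
  rw [one_le_div h2]
  nlinarith [ht.1]

theorem inv_rate_le (hs : 1 ≤ s) (ht : t ∈ Ioo 0 T) : 1 / rate s T t ≤ T * min t (T - t) := by
  have := mul_sub_pos ht
  have h2 : 0 < T - t := by linarith [ht.2]
  have e : 1 / rate s T t = t * (T - t) / s := by rw [rate, one_div_div]
  rw [e]
  refine (div_le_self this.le hs).trans ?_
  rcases le_total t (T - t) with h | h
  · rw [min_eq_left h]; nlinarith [ht.1]
  · rw [min_eq_right h]; nlinarith [ht.1]

end rate

theorem abs_carlemanDensity_le {B : ℝ} (hB : 1 ≤ B) : ∃ C : ℝ, 0 < C ∧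
    ∀ p₀ p₁ ρ U₀ U₁ U₂ : ℝ, |p₁| ≤ B → 1 ≤ ρ →
      |carlemanDensity (ρ * p₁) (Real.exp (-(ρ * p₀)) * U₀)
        (Real.exp (-(ρ * p₀)) * conj₁ (ρ * p₁) U₀ U₁)| ≤ C * weightedNorm p₀ ρ U₀ U₁ U₂ := by
  obtain ⟨D, hD, h⟩ := exists_carlemanNorm_conj_le hB
  refine ⟨2 * B ^ 3 * D, by positivity, fun p₀ p₁ ρ U₀ U₁ U₂ h1 hρ => ?_⟩
  have hρ0 : 0 < ρ := by linarith
  -- The density does not involve `V₂`, so `p₂` may be taken to be `0`.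
  have hn := (h p₁ 0 ρ U₀ U₁ U₂ h1 (by simpa using by linarith) hρ).1
  set e := Real.exp (-(ρ * p₀))
  set V₁ := conj₁ (ρ * p₁) U₀ U₁
  set V₂ := conj₂ (ρ * p₁) (ρ * 0) U₀ U₁ U₂
  have q1 : |ρ * p₁| ≤ ρ * B := abs_mul_le_of_abs_le (abs_of_pos hρ0).le h1
  have q3 : |(ρ * p₁) ^ 3| ≤ (ρ * B) ^ 3 := by
    rw [abs_pow]; exact pow_le_pow_left₀ (abs_nonneg _) q1 3
  have r1 := abs_mul_le_of_abs_le q3 (abs_of_nonneg (sq_nonneg (e * U₀))).le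
  have r2 := abs_mul_le_of_abs_le q1 (abs_of_nonneg (sq_nonneg (e * V₁))).le
  have hB3 : B ≤ B ^ 3 := by nlinarith [sq_nonneg B]
  have hρ3 : ρ ^ 3 ≤ ρ ^ 5 := pow_le_pow_right₀ hρ (by norm_num)
  have hρ1 : ρ ≤ ρ ^ 3 := by simpa using pow_le_pow_right₀ hρ (show 1 ≤ 3 by norm_num)
  have w0 : (ρ * B) ^ 3 * (e * U₀) ^ 2 ≤ B ^ 3 * (ρ ^ 5 * (e * U₀) ^ 2) := by
    have := mul_le_mul_of_nonneg_right hρ3 (show 0 ≤ B ^ 3 * (e * U₀) ^ 2 by positivity)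
    linarith
  have w1 : ρ * B * (e * V₁) ^ 2 ≤ B ^ 3 * (ρ ^ 3 * (e * V₁) ^ 2) := by
    have := mul_le_mul hρ1 hB3 (by linarith) (by positivity)
    have := mul_le_mul_of_nonneg_right this (sq_nonneg (e * V₁))
    linarith
  have w2 : 0 ≤ B ^ 3 * (ρ * (e * V₂) ^ 2) := by positivity
  have n0 : 0 ≤ B ^ 3 * (ρ ^ 5 * (e * U₀) ^ 2) := by positivity
  have n1 : 0 ≤ B ^ 3 * (ρ ^ 3 * (e * V₁) ^ 2) := by positivity
  have main : |carlemanDensity (ρ * p₁) (e * U₀) (e * V₁)| ≤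
      2 * B ^ 3 * (e ^ 2 * carlemanNorm ρ U₀ V₁ V₂) := by
    rw [← carlemanNorm_mul, carlemanDensity, carlemanNorm]
    rw [abs_le] at r1 r2 ⊢
    constructor <;> linarith [r1.1, r1.2, r2.1, r2.2]
  refine main.trans (le_trans (mul_le_mul_of_nonneg_left
    (mul_le_mul_of_nonneg_left hn (sq_nonneg e)) (by positivity)) (le_of_eq ?_))
  rw [weightedNorm]
  ring

/-- The squared growth gives `ρ⁸` and the coefficients at most `ρ⁵`. Bounding `e^{-2mρ} ρ¹⁴` instead
of `ρ¹³` leaves a spare factor `1/ρ`, which vanishes at both ends of the time interval. -/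
theorem weightedNorm_le {A m p₀ ρ T t U₀ U₁ U₂ : ℝ} (hm : 0 < m) (hp : m ≤ p₀) (hρ : 1 ≤ ρ)
    (hT : 0 < T) (ht : 0 < t) (hρt : 1 / t ≤ T * ρ) (h0 : |U₀| ≤ A / t ^ 4) (h1 : |U₁| ≤ A / t ^ 4)
    (h2 : |U₂| ≤ A / t ^ 4) :
    weightedNorm p₀ ρ U₀ U₁ U₂ ≤
      3 * A ^ 2 * T ^ 8 * ((Nat.factorial 14 : ℝ) / (2 * m) ^ 14) * (1 / ρ) := by
  have hρ0 : 0 < ρ := by linarith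
  have sq_le : ∀ U : ℝ, |U| ≤ A / t ^ 4 → U ^ 2 ≤ A ^ 2 * T ^ 8 * ρ ^ 8 := by
    intro U hU
    calc U ^ 2 = |U| ^ 2 := (sq_abs _).symm
      _ ≤ (A / t ^ 4) ^ 2 := pow_le_pow_left₀ (abs_nonneg _) hU 2
      _ = A ^ 2 * (1 / t) ^ 8 := by field_simp
      _ ≤ A ^ 2 * (T * ρ) ^ 8 := by gcongr
      _ = _ := by ring
  have hN : carlemanNorm ρ U₀ U₁ U₂ ≤ 3 * A ^ 2 * T ^ 8 * ρ ^ 13 := by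
    have a0 := mul_le_mul_of_nonneg_left (sq_le _ h0) (pow_pos hρ0 5).le
    have a1 := mul_le_mul (pow_le_pow_right₀ hρ (show 3 ≤ 5 by norm_num)) (sq_le _ h1)
      (sq_nonneg _) (by positivity)
    have a2 := mul_le_mul (show ρ ≤ ρ ^ 5 by
      simpa using pow_le_pow_right₀ hρ (show 1 ≤ 5 by norm_num)) (sq_le _ h2)
      (sq_nonneg _) (by positivity)
    rw [carlemanNorm]
    linarith
  have he : Real.exp (-(ρ * p₀)) ^ 2 * ρ ^ 13 ≤ (Nat.factorial 14 : ℝ) / (2 * m) ^ 14 * (1 / ρ) := by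
    have k := Real.pow_div_factorial_le_exp (2 * m * ρ) (by positivity) 14
    have e1 : Real.exp (-(ρ * p₀)) ^ 2 ≤ Real.exp (-(2 * m * ρ)) := by
      rw [← Real.exp_nat_mul, Real.exp_le_exp]
      push_cast
      nlinarith
    have e2 : Real.exp (-(2 * m * ρ)) * ρ ^ 14 ≤ (Nat.factorial 14 : ℝ) / (2 * m) ^ 14 := by
      rw [Real.exp_neg, inv_mul_le_iff₀ (Real.exp_pos _), mul_div_assoc', le_div_iff₀ (by positivity)]
      rw [div_le_iff₀ (by positivity)] at k
      rw [← mul_pow, mul_comm ρ]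
      exact k
    rw [mul_one_div, le_div_iff₀ hρ0]
    calc _ = Real.exp (-(ρ * p₀)) ^ 2 * ρ ^ 14 := by ring
      _ ≤ _ := (mul_le_mul_of_nonneg_right e1 (by positivity)).trans e2
  calc weightedNorm p₀ ρ U₀ U₁ U₂ ≤ Real.exp (-(ρ * p₀)) ^ 2 * (3 * A ^ 2 * T ^ 8 * ρ ^ 13) :=
        mul_le_mul_of_nonneg_left hN (sq_nonneg _)
    _ = 3 * A ^ 2 * T ^ 8 * (Real.exp (-(ρ * p₀)) ^ 2 * ρ ^ 13) := by ring
    _ ≤ 3 * A ^ 2 * T ^ 8 * ((Nat.factorial 14 : ℝ) / (2 * m) ^ 14 * (1 / ρ)) :=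
        mul_le_mul_of_nonneg_left he (by positivity)
    _ = _ := by ring

/-! ### The Carleman inequality for regular flows -/

/-- A function of `(t, x) ∈ (0, T) × [-L, L]` with its derivatives and its time derivatives,
satisfying the equation and the boundary conditions. -/
structure IsFlow (L T A : ℝ) (U₀ U₁ U₂ W₀ W₁ : ℝ → ℝ → ℝ) : Prop where
  cont₀ : ContinuousOn (fun p : ℝ × ℝ => U₀ p.1 p.2) (Ioo 0 T ×ˢ Icc (-L) L)
  cont₁ : ContinuousOn (fun p : ℝ × ℝ => U₁ p.1 p.2) (Ioo 0 T ×ˢ Icc (-L) L)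
  cont₂ : ContinuousOn (fun p : ℝ × ℝ => U₂ p.1 p.2) (Ioo 0 T ×ˢ Icc (-L) L)
  contw₀ : ContinuousOn (fun p : ℝ × ℝ => W₀ p.1 p.2) (Ioo 0 T ×ˢ Icc (-L) L)
  contw₁ : ContinuousOn (fun p : ℝ × ℝ => W₁ p.1 p.2) (Ioo 0 T ×ˢ Icc (-L) L)
  slice : ∀ t ∈ Ioo 0 T, IsSlice L (U₀ t) (U₁ t) (U₂ t) (W₀ t) (W₁ t)
  time₀ : ∀ t ∈ Ioo 0 T, ∀ x ∈ Icc (-L) L, HasDerivAt (fun t => U₀ t x) (W₀ t x) t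
  time₁ : ∀ t ∈ Ioo 0 T, ∀ x ∈ Icc (-L) L, HasDerivAt (fun t => U₁ t x) (W₁ t x) t
  growth₀ : ∀ t ∈ Ioo 0 T, ∀ x ∈ Icc (-L) L, |U₀ t x| ≤ A / t ^ 4
  growth₁ : ∀ t ∈ Ioo 0 T, ∀ x ∈ Icc (-L) L, |U₁ t x| ≤ A / t ^ 4
  growth₂ : ∀ t ∈ Ioo 0 T, ∀ x ∈ Icc (-L) L, |U₂ t x| ≤ A / t ^ 4

/-! ### Continuity and integrability of the weighted quantities. -/

theorem weightedNorm_nonneg {p₀ ρ U₀ U₁ U₂ : ℝ} (hρ : 0 ≤ ρ) : 0 ≤ weightedNorm p₀ ρ U₀ U₁ U₂ := by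
  simp only [weightedNorm, carlemanNorm]; positivity

theorem continuousOn_weightedNorm {X : Type*} [TopologicalSpace X] {E : Set X}
    {q r u₀ u₁ u₂ : X → ℝ} (hq : ContinuousOn q E) (hr : ContinuousOn r E)
    (h0 : ContinuousOn u₀ E) (h1 : ContinuousOn u₁ E) (h2 : ContinuousOn u₂ E) :
    ContinuousOn (fun p => weightedNorm (q p) (r p) (u₀ p) (u₁ p) (u₂ p)) E := by
  simp only [weightedNorm, carlemanNorm]; fun_prop

theorem continuousOn_densityDeriv {X : Type*} [TopologicalSpace X] {E : Set X}
    {q q₁ r r' u₀ u₁ w₀ w₁ : X → ℝ} (hq : ContinuousOn q E) (hq₁ : ContinuousOn q₁ E)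
    (hr : ContinuousOn r E) (hr' : ContinuousOn r' E) (h0 : ContinuousOn u₀ E)
    (h1 : ContinuousOn u₁ E) (hw₀ : ContinuousOn w₀ E) (hw₁ : ContinuousOn w₁ E) :
    ContinuousOn (fun p => densityDeriv (q p) (q₁ p) (r p) (r' p) (u₀ p) (u₁ p) (w₀ p) (w₁ p))
      E := by
  simp only [densityDeriv, carlemanDensityDeriv, conj₁, conjₜ₁]; fun_prop

theorem hasDerivAt_density {s T t p₀ p₁ : ℝ} {U₀ U₁ : ℝ → ℝ} {W₀ W₁ : ℝ} (ht : t ∈ Ioo 0 T)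
    (h0 : HasDerivAt U₀ W₀ t) (h1 : HasDerivAt U₁ W₁ t) :
    HasDerivAt (fun t => carlemanDensity (rate s T t * p₁)
        (Real.exp (-(rate s T t * p₀)) * U₀ t)
        (Real.exp (-(rate s T t * p₀)) * conj₁ (rate s T t * p₁) (U₀ t) (U₁ t)))
      (densityDeriv p₀ p₁ (rate s T t) (rateDeriv s T t) (U₀ t) (U₁ t) W₀ W₁) t := by
  have hr := hasDerivAt_rate (s := s) ht
  have he : HasDerivAt (fun t => Real.exp (-(rate s T t * p₀)))
      (-(rateDeriv s T t * p₀) * Real.exp (-(rate s T t * p₀))) t :=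
    ((hr.mul_const p₀).fun_neg.exp).congr_deriv (by ring)
  exact hasDerivAt_carlemanDensity (hr.mul_const p₁)
    ((he.mul h0).congr_deriv (by ring))
    (hasDerivAt_time_conj₁ he (hr.mul_const p₁) h0 h1)

theorem integrableOn_of_bounded {L T M : ℝ} {F : ℝ → ℝ → ℝ}
    (hF : ContinuousOn (fun p : ℝ × ℝ => F p.1 p.2) (Ioo 0 T ×ˢ Icc (-L) L))
    (hM : ∀ t ∈ Ioo 0 T, ∀ x ∈ Icc (-L) L, |F t x| ≤ M) :
    IntegrableOn (fun p : ℝ × ℝ => F p.1 p.2) (Ioo 0 T ×ˢ Ioo (-L) L) := by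
  have hm : MeasurableSet (Ioo 0 T ×ˢ Ioo (-L) L) := measurableSet_Ioo.prod measurableSet_Ioo
  refine IntegrableOn.of_bound (C := M) ?_ ?_ ?_
  · rw [Measure.volume_eq_prod, Measure.prod_prod]
    exact ENNReal.mul_lt_top measure_Ioo_lt_top measure_Ioo_lt_top
  · exact (hF.mono (prod_mono subset_rfl Ioo_subset_Icc_self)).aestronglyMeasurable hm
  · filter_upwards [ae_restrict_mem hm] with p hp
    exact hM p.1 hp.1 p.2 (Ioo_subset_Icc_self hp.2)

/-- Lets the estimate be proved for signed real integrals and then read in `[0, ∞]`, with finiteness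
as a by-product. -/
theorem lintegral_ofReal_eq {L T : ℝ} {F : ℝ → ℝ → ℝ} {Y : Set ℝ} (hY : Y ⊆ Ioo (-L) L)
    (hYm : MeasurableSet Y)
    (hF : IntegrableOn (fun p : ℝ × ℝ => F p.1 p.2) (Ioo 0 T ×ˢ Ioo (-L) L))
    (hc : ∀ t ∈ Ioo 0 T, ContinuousOn (F t) (Icc (-L) L))
    (h0 : ∀ t ∈ Ioo 0 T, ∀ x, 0 ≤ F t x) :
    IntegrableOn (fun t => ∫ x in Y, F t x) (Ioo 0 T) ∧
    ∫⁻ t in Ioo 0 T, ∫⁻ x in Y, ENNReal.ofReal (F t x) =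
      ENNReal.ofReal (∫ t in Ioo 0 T, ∫ x in Y, F t x) := by
  have hi : Integrable (fun p : ℝ × ℝ => F p.1 p.2)
      ((volume.restrict (Ioo 0 T)).prod (volume.restrict Y)) := by
    rw [Measure.prod_restrict]
    exact hF.mono_set (prod_mono subset_rfl hY)
  have hi' := hi.integral_prod_left
  refine ⟨hi', ?_⟩
  rw [ofReal_integral_eq_lintegral_ofReal hi']
  · refine setLIntegral_congr_fun measurableSet_Ioo fun t ht => ?_
    simp only
    rw [ofReal_integral_eq_lintegral_ofReal
      ((integrableOn_of_continuousOn (hc t ht)).mono_set hY)]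
    exact Filter.Eventually.of_forall fun x => h0 t ht x
  · filter_upwards [ae_restrict_mem measurableSet_Ioo] with t ht
    exact setIntegral_nonneg hYm fun x _ => h0 t ht x

theorem carleman_flow {L l₁ l₂ B κ₀ m T : ℝ} {ψ p₁ p₂ p₃ : ℝ → ℝ} (hL : 0 < L) (hT : 0 < T)
    (hω : Ioo l₁ l₂ ⊆ Ioo (-L) L) (hψ : WeightData L l₁ l₂ B κ₀ m ψ p₁ p₂ p₃) :
    ∃ s₀ C : ℝ, 1 ≤ s₀ ∧ 0 < C ∧ ∀ s : ℝ, s₀ ≤ s → ∀ (A : ℝ) (U₀ U₁ U₂ W₀ W₁ : ℝ → ℝ → ℝ),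
      IsFlow L T A U₀ U₁ U₂ W₀ W₁ →
      (∫⁻ t in Ioo 0 T, ∫⁻ x in Ioo l₁ l₂, ENNReal.ofReal
        (weightedNorm (ψ x) (rate s T t) (U₀ t x) (U₁ t x) (U₂ t x))) < ⊤ ∧
      (∫⁻ t in Ioo 0 T, ∫⁻ x in Ioo (-L) L, ENNReal.ofReal
        (weightedNorm (ψ x) (rate s T t) (U₀ t x) (U₁ t x) (U₂ t x)))
      + (∫⁻ t in Ioo 0 T, ENNReal.ofReal
        (weightedNorm (ψ (-L)) (rate s T t) 0 (U₁ t (-L)) (U₂ t (-L)))) ≤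
      ENNReal.ofReal C * ∫⁻ t in Ioo 0 T, ∫⁻ x in Ioo l₁ l₂, ENNReal.ofReal
        (weightedNorm (ψ x) (rate s T t) (U₀ t x) (U₁ t x) (U₂ t x)) := by
  obtain ⟨ρ₀, c, C, hρ₀, hc, hC, hslice⟩ := carleman_slice hL hω hψ
  obtain ⟨D, hD, hdens⟩ := abs_carlemanDensity_le hψ.one_le
  have hle : -L ≤ L := by linarith
  -- `s ≥ ρ₀ T²` forces `rate ≥ ρ₀`, since `t (T - t) ≤ T²`; `s ≥ T` gives `|rate'| ≤ rate²`; `s ≥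
  -- 1` serves the comparisons of the rate with `t` and `T - t`.
  refine ⟨max (max 1 T) (ρ₀ * T ^ 2), C / c, (le_max_left _ _).trans (le_max_left _ _),
    by positivity, ?_⟩
  intro s hs A U₀ U₁ U₂ W₀ W₁ hU
  have hs1 : 1 ≤ s := ((le_max_left _ _).trans (le_max_left _ _)).trans hs
  have hsT : T ≤ s := ((le_max_right _ _).trans (le_max_left _ _)).trans hs
  have hsρ : ρ₀ * T ^ 2 ≤ s := (le_max_right _ _).trans hs
  have hρ : ∀ t ∈ Ioo 0 T, ρ₀ ≤ rate s T t := fun t ht => le_rate (by linarith) hsρ ht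
  have hρ1 : ∀ t ∈ Ioo 0 T, 1 ≤ rate s T t := fun t ht => hρ₀.trans (hρ t ht)
  set F : ℝ → ℝ → ℝ := fun t x => weightedNorm (ψ x) (rate s T t) (U₀ t x) (U₁ t x) (U₂ t x) with hF
  set b : ℝ → ℝ := fun t => weightedNorm (ψ (-L)) (rate s T t) 0 (U₁ t (-L)) (U₂ t (-L)) with hb
  set h : ℝ → ℝ → ℝ := fun t x => densityDeriv (ψ x) (p₁ x) (rate s T t) (rateDeriv s T t)
    (U₀ t x) (U₁ t x) (W₀ t x) (W₁ t x) with hh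
  set g : ℝ → ℝ → ℝ := fun t x => carlemanDensity (rate s T t * p₁ x)
    (Real.exp (-(rate s T t * ψ x)) * U₀ t x)
    (Real.exp (-(rate s T t * ψ x)) * conj₁ (rate s T t * p₁ x) (U₀ t x) (U₁ t x)) with hg
  set M : ℝ := 3 * A ^ 2 * T ^ 8 * ((Nat.factorial 14 : ℝ) / (2 * m) ^ 14) with hM
  have hM0 : 0 ≤ M := by have := hψ.m_pos; positivity
  obtain ⟨cU₀, cU₁, cU₂, cW₀, cW₁, hsl, ht₀, ht₁, g₀, g₁, g₂⟩ := hU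
  -- joint continuity
  have mfst : MapsTo (fun p : ℝ × ℝ => p.1) (Ioo 0 T ×ˢ Icc (-L) L) (Ioo 0 T) := fun p hp => hp.1
  have msnd : MapsTo (fun p : ℝ × ℝ => p.2) (Ioo 0 T ×ˢ Icc (-L) L) (Icc (-L) L) := fun p hp => hp.2
  have cr : ContinuousOn (fun p : ℝ × ℝ => rate s T p.1) (Ioo 0 T ×ˢ Icc (-L) L) :=
    continuousOn_rate.comp continuousOn_fst mfst
  have cr' : ContinuousOn (fun p : ℝ × ℝ => rateDeriv s T p.1) (Ioo 0 T ×ˢ Icc (-L) L) :=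
    continuousOn_rateDeriv.comp continuousOn_fst mfst
  have cψ : ContinuousOn (fun p : ℝ × ℝ => ψ p.2) (Ioo 0 T ×ˢ Icc (-L) L) :=
    hψ.cont₀.comp continuousOn_snd msnd
  have cp₁ : ContinuousOn (fun p : ℝ × ℝ => p₁ p.2) (Ioo 0 T ×ˢ Icc (-L) L) :=
    hψ.cont₁.comp continuousOn_snd msnd
  have cF : ContinuousOn (fun p : ℝ × ℝ => F p.1 p.2) (Ioo 0 T ×ˢ Icc (-L) L) := by
    exact continuousOn_weightedNorm cψ cr cU₀ cU₁ cU₂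
  have ch : ContinuousOn (fun p : ℝ × ℝ => h p.1 p.2) (Ioo 0 T ×ˢ Icc (-L) L) := by
    exact continuousOn_densityDeriv cψ cp₁ cr cr' cU₀ cU₁ cW₀ cW₁
  have cFx : ∀ t ∈ Ioo 0 T, ContinuousOn (F t) (Icc (-L) L) := fun t ht =>
    cF.comp (f := fun x => (t, x)) (by fun_prop) fun x hx => ⟨ht, hx⟩
  have ch1 : ∀ t ∈ Ioo 0 T, ContinuousOn (h t) (Icc (-L) L) := fun t ht =>
    ch.comp (f := fun x => (t, x)) (by fun_prop) fun x hx => ⟨ht, hx⟩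
  -- bounds
  have hF0 : ∀ t ∈ Ioo 0 T, ∀ x, 0 ≤ F t x := fun t ht x =>
    weightedNorm_nonneg (by linarith [hρ1 t ht])
  have hb0 : ∀ t ∈ Ioo 0 T, 0 ≤ b t := fun t ht => weightedNorm_nonneg (by linarith [hρ1 t ht])
  have hFle : ∀ t ∈ Ioo 0 T, ∀ x ∈ Icc (-L) L, F t x ≤ M * (1 / rate s T t) := fun t ht x hx =>
    weightedNorm_le hψ.m_pos (hψ.m_le x hx) (hρ1 t ht) hT ht.1 (inv_le_rate hs1 ht)
      (g₀ t ht x hx) (g₁ t ht x hx) (g₂ t ht x hx)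
  have hr1 : ∀ t ∈ Ioo 0 T, 1 / rate s T t ≤ 1 := fun t ht => by
    rw [div_le_one (by linarith [hρ1 t ht])]; exact hρ1 t ht
  have hFM : ∀ t ∈ Ioo 0 T, ∀ x ∈ Icc (-L) L, |F t x| ≤ M := fun t ht x hx => by
    rw [abs_of_nonneg (hF0 t ht x)]
    exact (hFle t ht x hx).trans (mul_le_of_le_one_right hM0 (hr1 t ht))
  have hbF : ∀ t ∈ Ioo 0 T, b t = F t (-L) := fun t ht => by
    simp only [hb, hF, (hsl t ht).left]
  have hgF : ∀ t ∈ Ioo 0 T, ∀ x ∈ Icc (-L) L, |g t x| ≤ D * (M * (1 / rate s T t)) :=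
    fun t ht x hx => (hdens (ψ x) (p₁ x) (rate s T t) (U₀ t x) (U₁ t x) (U₂ t x)
      (hψ.le₁ x hx) (hρ1 t ht)).trans (mul_le_mul_of_nonneg_left (hFle t ht x hx) hD.le)
  -- integrability
  have iF := integrableOn_of_bounded cF hFM
  obtain ⟨iΩ, eΩ⟩ := lintegral_ofReal_eq subset_rfl measurableSet_Ioo iF cFx hF0
  obtain ⟨iω, eω⟩ := lintegral_ofReal_eq hω measurableSet_Ioo iF cFx hF0
  have ib : IntegrableOn b (Ioo 0 T) := by
    refine IntegrableOn.of_bound (C := M) measure_Ioo_lt_top ?_ ?_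
    · refine ContinuousOn.aestronglyMeasurable (ContinuousOn.congr ?_ hbF) measurableSet_Ioo
      exact cF.comp (f := fun t => (t, -L)) (by fun_prop) fun t ht => ⟨ht, le_rfl, hle⟩
    · filter_upwards [ae_restrict_mem measurableSet_Ioo] with t ht
      rw [hbF t ht]
      exact hFM t ht _ ⟨le_rfl, hle⟩
  have eb : ∫⁻ t in Ioo 0 T, ENNReal.ofReal (b t) = ENNReal.ofReal (∫ t in Ioo 0 T, b t) := by
    rw [ofReal_integral_eq_lintegral_ofReal ib]
    filter_upwards [ae_restrict_mem measurableSet_Ioo] with t ht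
    exact hb0 t ht
  -- the integrated inequality
  have key : ∫ t in Ioo 0 T, (c * (∫ x in Ioo (-L) L, F t x) + c * b t
      - C * (∫ x in Ioo l₁ l₂, F t x)) ≤ 0 := by
    have iJ : IntegrableOn (fun t => c * (∫ x in Ioo (-L) L, F t x) + c * b t
      - C * (∫ x in Ioo l₁ l₂, F t x)) (Ioo 0 T) :=
      ((iΩ.const_mul c).add (ib.const_mul c)).sub (iω.const_mul C)
    -- The density is at most `D M T δ` at both times `δ` and `T - δ`, and the space interval has
    -- length `2L`.
    refine integral_le_zero_of_interval_le (M := 2 * (D * (M * T)) * (2 * L)) hT iJ fun δ hδ => ?_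
    have hδ1 : δ ∈ Ioo 0 T := ⟨hδ.1, by linarith [hδ.2]⟩
    have hδ2 : T - δ ∈ Ioo 0 T := ⟨by linarith [hδ.2], by linarith [hδ.1]⟩
    have hδδ : δ ≤ T - δ := by linarith [hδ.2]
    have hsub : Icc δ (T - δ) ⊆ Ioo 0 T := fun t ht =>
      ⟨hδ.1.trans_le ht.1, ht.2.trans_lt hδ2.2⟩
    have e := integral_integral_deriv (g := g) hδ.1 hδδ hδ2.2 ch fun t ht x hx =>
      hasDerivAt_density ht (ht₀ t ht x hx) (ht₁ t ht x hx)
    have ih : IntervalIntegrable (fun t => ∫ x in Ioo (-L) L, h t x) volume δ (T - δ) := by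
      rw [intervalIntegrable_iff_integrableOn_Ioo_of_le hδδ]
      have : IntegrableOn (fun p : ℝ × ℝ => h p.1 p.2) (Ioo δ (T - δ) ×ˢ Ioo (-L) L) :=
        ((ch.mono (prod_mono hsub subset_rfl)).integrableOn_compact
          (isCompact_Icc.prod isCompact_Icc)).mono_set
          (prod_mono Ioo_subset_Icc_self Ioo_subset_Icc_self)
      have h2 : Integrable (fun p : ℝ × ℝ => h p.1 p.2)
          ((volume.restrict (Ioo δ (T - δ))).prod (volume.restrict (Ioo (-L) L))) := by
        rw [Measure.prod_restrict]; exact this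
      exact h2.integral_prod_left
    have iJ' : IntervalIntegrable (fun t => c * (∫ x in Ioo (-L) L, F t x) + c * b t
        - C * (∫ x in Ioo l₁ l₂, F t x)) volume δ (T - δ) := by
      rw [intervalIntegrable_iff_integrableOn_Ioo_of_le hδδ]
      exact iJ.mono_set (Ioo_subset_Icc_self.trans hsub)
    have step : ∫ t in δ..(T - δ), (c * (∫ x in Ioo (-L) L, F t x) + c * b t
        - C * (∫ x in Ioo l₁ l₂, F t x)) ≤ ∫ t in δ..(T - δ), -∫ x in Ioo (-L) L, h t x := by
      refine intervalIntegral.integral_mono_on hδδ iJ' ih.neg fun t ht => ?_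
      have ht' := hsub ht
      have := hslice (rate s T t) (rateDeriv s T t) (hρ t ht') (abs_rateDeriv_le hsT ht') (U₀ t)
        (U₁ t) (U₂ t) (W₀ t) (W₁ t) (hsl t ht')
      change (∫ x in Ioo (-L) L, h t x) ≤ C * (∫ x in Ioo l₁ l₂, F t x)
        - c * (∫ x in Ioo (-L) L, F t x) - c * b t at this
      linarith
    refine step.trans ?_
    rw [intervalIntegral.integral_neg, e]
    have gδ : ∀ t ∈ Ioo 0 T, min t (T - t) = δ → ∀ x ∈ Icc (-L) L, |g t x| ≤ D * (M * T) * δ := by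
      intro t ht hm x hx
      have k := inv_rate_le hs1 ht
      rw [hm] at k
      refine (hgF t ht x hx).trans ?_
      calc D * (M * (1 / rate s T t)) ≤ D * (M * (T * δ)) := by gcongr
        _ = _ := by ring
    have bd : ‖∫ x in Ioo (-L) L, (g (T - δ) x - g δ x)‖ ≤
        (2 * (D * (M * T)) * δ) * volume.real (Ioo (-L) L) := by
      refine norm_setIntegral_le_of_norm_le_const measure_Ioo_lt_top fun x hx => ?_
      have hx' := Ioo_subset_Icc_self hx
      have k1 := gδ (T - δ) hδ2 (by rw [sub_sub_cancel]; exact min_eq_right hδδ) x hx'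
      have k2 := gδ δ hδ1 (min_eq_left hδδ) x hx'
      rw [Real.norm_eq_abs]
      linarith [abs_sub (g (T - δ) x) (g δ x)]
    rw [Real.norm_eq_abs, Real.volume_real_Ioo_of_le hle] at bd
    have := (abs_le.1 bd).1
    linarith
  have i1 := iΩ.const_mul c
  have i2 := ib.const_mul c
  have i3 := iω.const_mul C
  have i12 : IntegrableOn (fun t => c * (∫ x in Ioo (-L) L, F t x) + c * b t) (Ioo 0 T) := i1.add i2
  rw [integral_sub i12 i3, integral_add i1 i2, integral_const_mul, integral_const_mul,
    integral_const_mul] at key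
  rw [eΩ, eω, eb]
  refine ⟨ENNReal.ofReal_lt_top, ?_⟩
  have n1 : 0 ≤ ∫ t in Ioo 0 T, ∫ x in Ioo (-L) L, F t x :=
    setIntegral_nonneg measurableSet_Ioo fun t ht =>
      setIntegral_nonneg measurableSet_Ioo fun x _ => hF0 t ht x
  have n2 : 0 ≤ ∫ t in Ioo 0 T, b t := setIntegral_nonneg measurableSet_Ioo hb0
  rw [← ENNReal.ofReal_add n1 n2, ← ENNReal.ofReal_mul (by positivity)]
  refine ENNReal.ofReal_le_ofReal ?_
  rw [div_mul_eq_mul_div, le_div_iff₀ hc]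
  linarith

/-! ### The weight -/

theorem IsWeight.exists_weightData {L l₁ l₂ : ℝ} {ψ : ℝ → ℝ} (hl₁ : -L < l₁) (hl : l₁ < l₂)
    (hl₂ : l₂ < L) (hψ : IsWeight L l₁ l₂ ψ) :
    ∃ B κ₀ m : ℝ, WeightData L l₁ l₂ B κ₀ m ψ (D L 1 ψ) (D L 2 ψ) (D L 3 ψ) := by
  have hLL : -L < L := by linarith
  have hs : UniqueDiffOn ℝ (Icc (-L) L) := uniqueDiffOn_Icc hLL
  have hc : ∀ k : ℕ, k ≤ 3 → ContinuousOn (D L k ψ) (Icc (-L) L) := fun k hk =>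
    hψ.contDiffOn.continuousOn_iteratedDerivWithin (by exact_mod_cast hk) hs
  have hd : ∀ k : ℕ, k < 3 → ∀ x ∈ Ioo (-L) L, HasDerivAt (D L k ψ) (D L (k + 1) ψ x) x := by
    intro k hk x hx
    have h1 := (hψ.contDiffOn.differentiableOn_iteratedDerivWithin (m := k) (by exact_mod_cast hk)
      hs x (Ioo_subset_Icc_self hx)).hasDerivWithinAt.hasDerivAt (Icc_mem_nhds hx.1 hx.2)
    rw [← iteratedDerivWithin_succ] at h1
    exact h1
  have h0 : D L 0 ψ = ψ := funext fun x => by rw [D, iteratedDerivWithin_zero]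
  have hb : ∀ k : ℕ, k ≤ 3 → ∃ b, ∀ x ∈ Icc (-L) L, |D L k ψ x| ≤ b := fun k hk =>
    isCompact_Icc.exists_bound_of_continuousOn (hc k hk)
  obtain ⟨b₀, hb₀⟩ := hb 0 (by norm_num)
  obtain ⟨b₁, hb₁⟩ := hb 1 (by norm_num)
  obtain ⟨b₂, hb₂⟩ := hb 2 (by norm_num)
  obtain ⟨b₃, hb₃⟩ := hb 3 le_rfl
  have hleft : -L ∈ Icc (-L) L := ⟨le_rfl, hLL.le⟩
  have n₀ := (abs_nonneg _).trans (hb₀ _ hleft)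
  have n₁ := (abs_nonneg _).trans (hb₁ _ hleft)
  have n₂ := (abs_nonneg _).trans (hb₂ _ hleft)
  have n₃ := (abs_nonneg _).trans (hb₃ _ hleft)
  rw [h0] at hb₀
  set E := Icc (-L) L \ Ioo l₁ l₂ with hE
  -- Compactness of the complement of `ω` turns the strict signs there into a uniform `κ₀`.
  have hEc : IsCompact E := isCompact_Icc.diff isOpen_Ioo
  have hEl : -L ∈ E := ⟨hleft, fun h => by linarith [h.1]⟩
  obtain ⟨x₁, hx₁, hm₁⟩ := hEc.exists_isMinOn ⟨_, hEl⟩ ((hc 1 (by norm_num)).abs.mono sdiff_subset)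
  obtain ⟨x₂, hx₂, hm₂⟩ := hEc.exists_isMaxOn ⟨_, hEl⟩ ((hc 2 (by norm_num)).mono sdiff_subset)
  obtain ⟨x₀, hx₀, hm₀⟩ := isCompact_Icc.exists_isMinOn ⟨_, hleft⟩ (hψ.contDiffOn.continuousOn)
  set κ₀ := min |D L 1 ψ x₁| (-D L 2 ψ x₂) with hκ
  have hoff : ∀ x ∈ E, κ₀ ≤ |D L 1 ψ x| ∧ D L 2 ψ x ≤ -κ₀ := fun x hx =>
    ⟨(min_le_left _ _).trans (hm₁ hx), by
      have h1 : D L 2 ψ x ≤ D L 2 ψ x₂ := hm₂ hx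
      have h2 : κ₀ ≤ -D L 2 ψ x₂ := min_le_right _ _
      linarith⟩
  refine ⟨1 + b₀ + b₁ + b₂ + b₃, κ₀, ψ x₀, ?_⟩
  exact
    { one_le := by linarith
      κ_pos := lt_min (hψ.off_omega x₁ hx₁).1 (neg_pos.2 (hψ.off_omega x₂ hx₂).2.1)
      m_pos := hψ.pos x₀ hx₀
      cont₀ := hψ.contDiffOn.continuousOn
      cont₁ := hc 1 (by norm_num)
      cont₂ := hc 2 (by norm_num)
      cont₃ := hc 3 le_rfl
      deriv₀ := fun x hx => by simpa only [h0] using hd 0 (by norm_num) x hx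
      deriv₁ := hd 1 (by norm_num)
      deriv₂ := hd 2 (by norm_num)
      le₀ := fun x hx => (hb₀ x hx).trans (by linarith)
      le₁ := fun x hx => (hb₁ x hx).trans (by linarith)
      le₂ := fun x hx => (hb₂ x hx).trans (by linarith)
      le₃ := fun x hx => (hb₃ x hx).trans (by linarith)
      m_le := fun x hx => hm₀ hx
      off := hoff
      left := by
        have := (hoff _ hEl).1
        rw [abs_of_neg hψ.deriv_left] at this
        linarith
      right := hψ.deriv_right.le }

/-! ### Classical representatives -/

theorem isWeakDeriv_of_hasDerivAt {a b : ℝ} (hab : a ≤ b) {F F' : ℝ → ℝ}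
    (hF : ContinuousOn F (Icc a b)) (hF' : ContinuousOn F' (Icc a b))
    (hd : ∀ x ∈ Ioo a b, HasDerivAt F (F' x) x) : IsWeakDeriv a b F F' := by
  intro η hη _ hs
  have cη := hη.continuous
  have cη' : Continuous (deriv η) := hη.continuous_deriv (by simp)
  have := integral_eq_sub (f := fun x => F x * η x) (f' := fun x => F' x * η x + F x * deriv η x) hab
    (hF.mul cη.continuousOn)
    (fun x hx => (hd x hx).mul ((hη.differentiable (by simp)) x).hasDerivAt)
    ((hF'.mul cη.continuousOn).add (hF.mul cη'.continuousOn))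
  have i1 : IntegrableOn (fun x => F' x * η x) (Ioo a b) :=
    (hF'.mul cη.continuousOn).integrableOn_Icc.mono_set Ioo_subset_Icc_self
  have i2 : IntegrableOn (fun x => F x * deriv η x) (Ioo a b) :=
    (hF.mul cη'.continuousOn).integrableOn_Icc.mono_set Ioo_subset_Icc_self
  rw [← setIntegral_Ioo_eq hab, integral_add i1 i2,
    eq_zero_of_tsupport_subset hs (x := a) (fun h => lt_irrefl _ h.1),
    eq_zero_of_tsupport_subset hs (x := b) (fun h => lt_irrefl _ h.2)] at this
  linarith

theorem weakDeriv_spec {L : ℝ} {f g : L2 L} (h : HasWeakDeriv L f g) :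
    HasWeakDeriv L f (weakDeriv L f) := by
  have hex : ∃ g, HasWeakDeriv L f g := ⟨g, h⟩
  rw [weakDeriv, dif_pos hex]
  exact hex.choose_spec

/-- The weak derivative is picked by choice; a.e. uniqueness identifies it with the classical one.
-/
theorem hasWeakDeriv_and_weakDeriv_ae_eq {L : ℝ} (hL : 0 < L) {f : L2 L} {F F' : ℝ → ℝ}
    (hf : ∀ᵐ x ∂(volume.restrict (Ioo (-L) L)), f x = F x)
    (hF : ContinuousOn F (Icc (-L) L)) (hF' : ContinuousOn F' (Icc (-L) L))
    (hd : ∀ x ∈ Ioo (-L) L, HasDerivAt F (F' x) x) :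
    HasWeakDeriv L f (weakDeriv L f) ∧
      ∀ᵐ x ∂(volume.restrict (Ioo (-L) L)), weakDeriv L f x = F' x := by
  have h1 : IsWeakDeriv (-L) L f F' := by
    intro η hη hc hs
    rw [← isWeakDeriv_of_hasDerivAt (by linarith) hF hF' hd η hη hc hs]
    refine integral_congr_ae ?_
    filter_upwards [hf] with x hx
    rw [hx]
  have h2 : HasWeakDeriv L f ((memLp_of_continuousOn hF').toLp F') := by
    intro η hη hc hs
    rw [h1 η hη hc hs]
    congr 1
    refine integral_congr_ae ?_
    filter_upwards [(memLp_of_continuousOn hF').coeFn_toLp] with x hx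
    rw [hx]
  have h3 := weakDeriv_spec h2
  exact ⟨h3, IsWeakDeriv.ae_unique (f := f) h3 h1 (integrableOn_L2 _)
    (integrableOn_of_continuousOn hF')⟩

theorem trace_eq {L : ℝ} (hL : 0 < L) {f : L2 L} {F : ℝ → ℝ} {a : ℝ} (ha : a ∈ Icc (-L) L)
    (hf : ∀ᵐ x ∂(volume.restrict (Ioo (-L) L)), f x = F x) (hF : ContinuousOn F (Icc (-L) L)) :
    trace L f a = F a := by
  have hex : ∃ c, HasTrace L f a c := ⟨F a, F, hF, hf, rfl⟩
  rw [trace, dif_pos hex]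
  obtain ⟨g, hg, hfg, e⟩ := hex.choose_spec
  rw [← e]
  refine Measure.eqOn_Icc_of_ae_eq volume (by linarith : (-L) ≠ L) ?_ hg hF ha
  rw [← restrict_Ioo_eq_restrict_Icc]
  filter_upwards [hf, hfg] with x h1 h2
  rw [← h1, h2]

/-! ### The flow of a regular solution -/

/-- Split `Φ (w t) x = Φ (w t - w t₀) x + Φ (w t₀) x`: the first term is small uniformly in `x`, the
second is continuous in `x`. -/
theorem continuousOn_eval {E : Type*} [NormedAddCommGroup E] {Φ : E → ℝ → ℝ} {I J : Set ℝ} {C : ℝ}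
    (hΦ : ∀ h, ∀ x ∈ J, |Φ h x| ≤ C * ‖h‖) (hadd : ∀ h k, ∀ x ∈ J, Φ (h + k) x = Φ h x + Φ k x)
    (hc : ∀ h, ContinuousOn (Φ h) J) {w : ℝ → E} (hw : ContinuousOn w I) :
    ContinuousOn (fun p : ℝ × ℝ => Φ (w p.1) p.2) (I ×ˢ J) := by
  rintro ⟨t₀, x₀⟩ ⟨ht₀, hx₀⟩
  have mfst : MapsTo (fun p : ℝ × ℝ => p.1) (I ×ˢ J) I := fun p hp => hp.1
  have msnd : MapsTo (fun p : ℝ × ℝ => p.2) (I ×ˢ J) J := fun p hp => hp.2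
  have c1 : ContinuousOn (fun p : ℝ × ℝ => C * ‖w p.1 - w t₀‖) (I ×ˢ J) :=
    ((hw.comp continuousOn_fst mfst).sub continuousOn_const).norm.const_mul C
  have c2 : ContinuousOn (fun p : ℝ × ℝ => Φ (w t₀) p.2) (I ×ˢ J) :=
    (hc (w t₀)).comp continuousOn_snd msnd
  have l1 := (c1 (t₀, x₀) ⟨ht₀, hx₀⟩).tendsto
  simp only [sub_self, norm_zero, mul_zero] at l1
  have l2 := (c2 (t₀, x₀) ⟨ht₀, hx₀⟩).tendsto
  have l3 : Filter.Tendsto (fun p : ℝ × ℝ => Φ (w p.1 - w t₀) p.2)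
      (nhdsWithin (t₀, x₀) (I ×ˢ J)) (nhds 0) := by
    refine squeeze_zero_norm' ?_ l1
    filter_upwards [self_mem_nhdsWithin] with p hp
    exact hΦ _ _ hp.2
  have l4 := l3.add l2
  rw [zero_add] at l4
  refine l4.congr' ?_
  filter_upwards [self_mem_nhdsWithin] with p hp
  rw [← hadd _ _ _ hp.2, sub_add_cancel]

/-- As `u = K w`, the functions `G0`, `G1`, `G2` of `w` represent `u`, `u_x`, `u_xx`. As `w' = z`
and `w = K z`, those of `z` represent `u_t = w` and `u_tx`, so one time derivative of `w` suffices.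
-/
theorem isFlow_of_regular {L T B : ℝ} (hL : 0 < L) {w z : ℝ → L2 L}
    (hwc : ContinuousOn w (Ioo 0 T)) (hzc : ContinuousOn z (Ioo 0 T))
    (hwz : ∀ t ∈ Ioo 0 T, w t = K hL (z t)) (hd : ∀ t ∈ Ioo 0 T, HasDerivAt w (z t) t)
    (hB : ∀ t ∈ Ioo 0 T, ‖w t‖ ≤ B / t ^ 4) :
    ∃ A, IsFlow L T A (fun t => G0 L (w t)) (fun t => G1 L (w t)) (fun t => G2 L (w t))
      (fun t => G0 L (z t)) (fun t => G1 L (z t)) := by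
  obtain ⟨C, hC, hG⟩ := exists_G_bound hL
  have hi := fun h : L2 L => integrableOn_L2 h
  have add0 : ∀ h k : L2 L, ∀ x ∈ Icc (-L) L, G0 L (h + k : L2 L) x = G0 L h x + G0 L k x :=
    fun h k x hx => by simpa using G0_smul_add hL 1 h k hx
  have add1 : ∀ h k : L2 L, ∀ x ∈ Icc (-L) L, G1 L (h + k : L2 L) x = G1 L h x + G1 L k x :=
    fun h k x hx => by simpa using G1_smul_add hL 1 h k hx
  have add2 : ∀ h k : L2 L, ∀ x ∈ Icc (-L) L, G2 L (h + k : L2 L) x = G2 L h x + G2 L k x :=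
    fun h k x hx => by simpa using G2_smul_add hL 1 h k hx
  have growth : ∀ t ∈ Ioo 0 T, C * ‖w t‖ ≤ C * B / t ^ 4 := fun t ht => by
    rw [mul_div_assoc]
    exact mul_le_mul_of_nonneg_left (hB t ht) hC.le
  refine ⟨C * B, ?_⟩
  exact
    { cont₀ := continuousOn_eval (Φ := fun h : L2 L => G0 L h) (fun h x hx => (hG h x hx).1) add0
        (fun h => continuousOn_G0 hL (hi h)) hwc
      cont₁ := continuousOn_eval (Φ := fun h : L2 L => G1 L h) (fun h x hx => (hG h x hx).2.1) add1
        (fun h => continuousOn_G1 hL (hi h)) hwc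
      cont₂ := continuousOn_eval (Φ := fun h : L2 L => G2 L h) (fun h x hx => (hG h x hx).2.2) add2
        (fun h => continuousOn_G2 hL (hi h)) hwc
      contw₀ := continuousOn_eval (Φ := fun h : L2 L => G0 L h) (fun h x hx => (hG h x hx).1) add0
        (fun h => continuousOn_G0 hL (hi h)) hzc
      contw₁ := continuousOn_eval (Φ := fun h : L2 L => G1 L h) (fun h x hx => (hG h x hx).2.1)
        add1 (fun h => continuousOn_G1 hL (hi h)) hzc
      slice := fun t ht =>
        { cont₀ := continuousOn_G0 hL (hi _)
          cont₁ := continuousOn_G1 hL (hi _)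
          cont₂ := continuousOn_G2 hL (hi _)
          contw₀ := continuousOn_G0 hL (hi _)
          contw₁ := continuousOn_G1 hL (hi _)
          deriv₀ := fun x hx => hasDerivAt_G0 hL (hi _) hx
          deriv₁ := fun x hx => hasDerivAt_G1 hL (hi _) hx
          deriv₂ := fun x hx => by rw [hwz t ht]; exact hasDerivAt_G2_K hL (z t) hx
          derivw := fun x hx => hasDerivAt_G0 hL (hi _) hx
          left := G0_left hL (hi _)
          right := by simp
          right₁ := by simp
          leftw := G0_left hL (hi _)
          rightw := by simp }
      time₀ := fun t ht x hx => by
        obtain ⟨ℓ, hℓ⟩ := exists_eval_G0 hL hx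
        simpa only [Function.comp_def, hℓ] using ℓ.hasFDerivAt.comp_hasDerivAt t (hd t ht)
      time₁ := fun t ht x hx => by
        obtain ⟨ℓ, hℓ⟩ := exists_eval_G1 hL hx
        simpa only [Function.comp_def, hℓ] using ℓ.hasFDerivAt.comp_hasDerivAt t (hd t ht)
      growth₀ := fun t ht x hx => (hG _ x hx).1.trans (growth t ht)
      growth₁ := fun t ht x hx => (hG _ x hx).2.1.trans (growth t ht)
      growth₂ := fun t ht x hx => (hG _ x hx).2.2.trans (growth t ht) }

/-! ### Comparison of the weighted integrals -/

/-- The stated weights carry the powers `ψ⁵`, `ψ³`, `ψ`, which `weightedNorm` omits; `a ≤ 1 ≤ b`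
lets the fifth powers bound all three. -/
theorem weightedNorm_bounds {a b q s T t U₀ U₁ U₂ : ℝ} (ha : 0 < a) (ha1 : a ≤ 1) (hb : 1 ≤ b)
    (hq : a ≤ q) (hq' : q ≤ b) (hs : 0 ≤ s) (ht : t ∈ Ioo 0 T) :
    a ^ 5 * weightedNorm q (rate s T t) U₀ U₁ U₂ ≤
      (s ^ 5 * q ^ 5 / (t ^ 5 * (T - t) ^ 5) * |U₀| ^ 2
        + s ^ 3 * q ^ 3 / (t ^ 3 * (T - t) ^ 3) * |U₁| ^ 2
        + s * q / (t * (T - t)) * |U₂| ^ 2) * Real.exp (-(2 * s * q / (t * (T - t)))) ∧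
    (s ^ 5 * q ^ 5 / (t ^ 5 * (T - t) ^ 5) * |U₀| ^ 2
        + s ^ 3 * q ^ 3 / (t ^ 3 * (T - t) ^ 3) * |U₁| ^ 2
        + s * q / (t * (T - t)) * |U₂| ^ 2) * Real.exp (-(2 * s * q / (t * (T - t)))) ≤
      b ^ 5 * weightedNorm q (rate s T t) U₀ U₁ U₂ := by
  have hρ : 0 ≤ rate s T t := div_nonneg hs (mul_sub_pos ht).le
  have hq0 : 0 < q := by linarith
  have e1 : Real.exp (-(2 * s * q / (t * (T - t)))) = Real.exp (-(rate s T t * q)) ^ 2 := by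
    rw [← Real.exp_nat_mul, rate]
    congr 1
    push_cast
    ring
  have e2 : s ^ 5 * q ^ 5 / (t ^ 5 * (T - t) ^ 5) * |U₀| ^ 2
        + s ^ 3 * q ^ 3 / (t ^ 3 * (T - t) ^ 3) * |U₁| ^ 2 + s * q / (t * (T - t)) * |U₂| ^ 2 =
      q ^ 5 * (rate s T t ^ 5 * U₀ ^ 2) + q ^ 3 * (rate s T t ^ 3 * U₁ ^ 2)
        + q * (rate s T t * U₂ ^ 2) := by
    simp only [rate, sq_abs, div_pow, mul_pow]
    ring
  rw [e1, e2, weightedNorm, carlemanNorm]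
  generalize rate s T t = ρ at hρ
  set e := Real.exp (-(ρ * q)) ^ 2 with he
  have he0 : 0 ≤ e := sq_nonneg _
  have n0 : 0 ≤ ρ ^ 5 * U₀ ^ 2 := by positivity
  have n1 : 0 ≤ ρ ^ 3 * U₁ ^ 2 := by positivity
  have n2 : 0 ≤ ρ * U₂ ^ 2 := by positivity
  have a5 : a ^ 5 ≤ q ^ 5 := pow_le_pow_left₀ ha.le hq 5
  have a3 : a ^ 5 ≤ q ^ 3 :=
    (pow_le_pow_of_le_one ha.le ha1 (by norm_num)).trans (pow_le_pow_left₀ ha.le hq 3)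
  have a1 : a ^ 5 ≤ q := (pow_le_of_le_one ha.le ha1 (by norm_num)).trans hq
  have b5 : q ^ 5 ≤ b ^ 5 := pow_le_pow_left₀ hq0.le hq' 5
  have b3 : q ^ 3 ≤ b ^ 5 :=
    (pow_le_pow_left₀ hq0.le hq' 3).trans (pow_le_pow_right₀ hb (by norm_num))
  have b1 : q ≤ b ^ 5 := hq'.trans (le_self_pow₀ hb (by norm_num))
  constructor
  · have := mul_le_mul_of_nonneg_right (add_le_add (add_le_add (mul_le_mul_of_nonneg_right a5 n0)
      (mul_le_mul_of_nonneg_right a3 n1)) (mul_le_mul_of_nonneg_right a1 n2)) he0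
    linarith
  · have := mul_le_mul_of_nonneg_right (add_le_add (add_le_add (mul_le_mul_of_nonneg_right b5 n0)
      (mul_le_mul_of_nonneg_right b3 n1)) (mul_le_mul_of_nonneg_right b1 n2)) he0
    linarith

theorem setLIntegral_le_const_mul {X : Type*} [MeasurableSpace X] {μ : Measure X} {F G : X → ℝ}
    {c : ℝ} (hc : 0 ≤ c) (h : ∀ᵐ x ∂μ, F x ≤ c * G x) :
    ∫⁻ x, ENNReal.ofReal (F x) ∂μ ≤ ENNReal.ofReal c * ∫⁻ x, ENNReal.ofReal (G x) ∂μ := by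
  rw [← lintegral_const_mul' _ _ ENNReal.ofReal_ne_top]
  refine lintegral_mono_ae ?_
  filter_upwards [h] with x hx
  rw [← ENNReal.ofReal_mul hc]
  exact ENNReal.ofReal_le_ofReal hx

theorem lintegral_lintegral_le_const_mul {T : ℝ} {μ : Measure ℝ} {F G : ℝ → ℝ → ℝ} {c : ℝ}
    (hc : 0 ≤ c) (h : ∀ t ∈ Ioo 0 T, ∀ᵐ x ∂μ, F t x ≤ c * G t x) :
    ∫⁻ t in Ioo 0 T, ∫⁻ x, ENNReal.ofReal (F t x) ∂μ ≤
      ENNReal.ofReal c * ∫⁻ t in Ioo 0 T, ∫⁻ x, ENNReal.ofReal (G t x) ∂μ := by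
  rw [← lintegral_const_mul' _ _ ENNReal.ofReal_ne_top]
  refine setLIntegral_mono_ae' measurableSet_Ioo (Filter.Eventually.of_forall fun t ht => ?_)
  exact setLIntegral_le_const_mul hc (h t ht)

end KdVB

/-! ### The Carleman inequality for mild solutions. -/

theorem mainTheorem4 (L l₁ l₂ : ℝ) (hl₁ : -L < l₁) (hl : l₁ < l₂) (hl₂ : l₂ < L)
    (ψ : ℝ → ℝ) (hψ : KdVB.IsWeight L l₁ l₂ ψ) (T : ℝ) (hT : 0 < T) :
    ∃ s₀ : ℝ, 0 < s₀ ∧ ∃ C : ℝ, 0 < C ∧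
      ∀ s : ℝ, s₀ ≤ s → ∀ (u₀ : KdVB.L2 L) (u : ℝ → KdVB.L2 L), KdVB.IsSolution L T u₀ u →
        (∀ᵐ t ∂(volume.restrict (Ioo 0 T)), KdVB.MemH3 L (u t)) ∧
        KdVB.interiorIntegral L T ψ s u (Ioo l₁ l₂) < ⊤ ∧
        KdVB.interiorIntegral L T ψ s u (Ioo (-L) L) + KdVB.boundaryIntegral L T ψ s u
          ≤ ENNReal.ofReal C * KdVB.interiorIntegral L T ψ s u (Ioo l₁ l₂) := by
  have hL : 0 < L := by linarith
  have hω : Ioo l₁ l₂ ⊆ Ioo (-L) L := Ioo_subset_Ioo hl₁.le hl₂.le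
  obtain ⟨B, κ₀, m, hW⟩ := hψ.exists_weightData hl₁ hl hl₂
  obtain ⟨s₀, C, hs₀, hC, main⟩ := KdVB.carleman_flow hL hT hω hW
  set a : ℝ := min 1 m with ha
  have ha0 : 0 < a := lt_min one_pos hW.m_pos
  have ha1 : a ≤ 1 := min_le_left _ _
  have hB := hW.one_le
  -- `B⁵` comes from inserting the powers of `ψ` on the left, `1/a⁵` from inserting them on the
  -- right.
  refine ⟨s₀, by linarith, B ^ 5 * C * (1 / a ^ 5), by positivity, fun s hs u₀ u hu => ?_⟩
  have hs0 : 0 ≤ s := by linarith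
  obtain ⟨w, z, M, -, hwc, hzc, huw, hwz, hwd, hM⟩ := hu.exists_regular hL hT
  obtain ⟨A, hflow⟩ := KdVB.isFlow_of_regular hL hwc hzc hwz hwd hM
  obtain ⟨hfin, hmain⟩ := main s hs A _ _ _ _ _ hflow
  have hi := fun h : KdVB.L2 L => KdVB.integrableOn_L2 h
  have r0 : ∀ t ∈ Ioo 0 T, ∀ᵐ x ∂(volume.restrict (Ioo (-L) L)), u t x = KdVB.G0 L (w t) x :=
    fun t ht => by rw [huw t ht]; exact KdVB.K_ae_eq hL (w t)
  have r1 := fun t ht => KdVB.hasWeakDeriv_and_weakDeriv_ae_eq hL (r0 t ht)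
    (KdVB.continuousOn_G0 hL (hi _)) (KdVB.continuousOn_G1 hL (hi _))
    (fun x hx => KdVB.hasDerivAt_G0 hL (hi _) hx)
  have r2 := fun t ht => KdVB.hasWeakDeriv_and_weakDeriv_ae_eq hL (r1 t ht).2
    (KdVB.continuousOn_G1 hL (hi _)) (KdVB.continuousOn_G2 hL (hi _))
    (fun x hx => KdVB.hasDerivAt_G1 hL (hi _) hx)
  have r3 := fun t ht => KdVB.hasWeakDeriv_and_weakDeriv_ae_eq hL (r2 t ht).2
    (KdVB.continuousOn_G2 hL (hi _))
    ((KdVB.continuousOn_G2 hL (hi _)).sub (KdVB.continuousOn_G0 hL (hi _)))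
    (fun x hx => (hflow.slice t ht).deriv₂ x hx)
  have hleft : -L ∈ Icc (-L) L := ⟨le_rfl, by linarith⟩
  have bounds : ∀ x ∈ Icc (-L) L, a ≤ ψ x ∧ ψ x ≤ B := fun x hx =>
    ⟨(min_le_right _ _).trans (hW.m_le x hx), (le_abs_self _).trans (hW.le₀ x hx)⟩
  have upper : ∀ Y : Set ℝ, Y ⊆ Ioo (-L) L → MeasurableSet Y →
      KdVB.interiorIntegral L T ψ s u Y ≤ ENNReal.ofReal (B ^ 5) *
        ∫⁻ t in Ioo 0 T, ∫⁻ x in Y, ENNReal.ofReal (KdVB.weightedNorm (ψ x) (KdVB.rate s T t)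
          (KdVB.G0 L (w t) x) (KdVB.G1 L (w t) x) (KdVB.G2 L (w t) x)) := by
    intro Y hY hYm
    refine KdVB.lintegral_lintegral_le_const_mul (by positivity) fun t ht => ?_
    filter_upwards [ae_restrict_of_ae_restrict_of_subset hY (r0 t ht),
      ae_restrict_of_ae_restrict_of_subset hY (r1 t ht).2,
      ae_restrict_of_ae_restrict_of_subset hY (r2 t ht).2, ae_restrict_mem hYm] with x e0 e1 e2 hx
    have hx' := bounds x (Ioo_subset_Icc_self (hY hx))
    rw [e0, e1, e2]
    exact (KdVB.weightedNorm_bounds ha0 ha1 hB hx'.1 hx'.2 hs0 ht).2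
  have lower : (∫⁻ t in Ioo 0 T, ∫⁻ x in Ioo l₁ l₂, ENNReal.ofReal (KdVB.weightedNorm (ψ x)
      (KdVB.rate s T t) (KdVB.G0 L (w t) x) (KdVB.G1 L (w t) x) (KdVB.G2 L (w t) x))) ≤
      ENNReal.ofReal (1 / a ^ 5) * KdVB.interiorIntegral L T ψ s u (Ioo l₁ l₂) := by
    refine KdVB.lintegral_lintegral_le_const_mul (by positivity) fun t ht => ?_
    filter_upwards [ae_restrict_of_ae_restrict_of_subset hω (r0 t ht),
      ae_restrict_of_ae_restrict_of_subset hω (r1 t ht).2,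
      ae_restrict_of_ae_restrict_of_subset hω (r2 t ht).2,
      ae_restrict_mem measurableSet_Ioo] with x e0 e1 e2 hx
    have hx' := bounds x (Ioo_subset_Icc_self (hω hx))
    rw [e0, e1, e2, one_div_mul_eq_div, le_div_iff₀' (by positivity)]
    exact (KdVB.weightedNorm_bounds ha0 ha1 hB hx'.1 hx'.2 hs0 ht).1
  have boundary : KdVB.boundaryIntegral L T ψ s u ≤ ENNReal.ofReal (B ^ 5) *
      ∫⁻ t in Ioo 0 T, ENNReal.ofReal (KdVB.weightedNorm (ψ (-L)) (KdVB.rate s T t) 0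
        (KdVB.G1 L (w t) (-L)) (KdVB.G2 L (w t) (-L))) := by
    refine KdVB.setLIntegral_le_const_mul (by positivity) ?_
    filter_upwards [ae_restrict_mem measurableSet_Ioo] with t ht
    have hx' := bounds (-L) hleft
    -- The flux produces the weight `ψ(-L)`; the boundary integral has `ψ(L)`, which is equal to it.
    rw [KdVB.trace_eq hL hleft (r1 t ht).2 (KdVB.continuousOn_G1 hL (hi _)),
      KdVB.trace_eq hL hleft (r2 t ht).2 (KdVB.continuousOn_G2 hL (hi _)), ← hψ.max_all.2]
    have := (KdVB.weightedNorm_bounds (U₀ := 0) (U₁ := KdVB.G1 L (w t) (-L))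
      (U₂ := KdVB.G2 L (w t) (-L)) ha0 ha1 hB hx'.1 hx'.2 hs0 ht).2
    simpa using this
  refine ⟨?_, ?_, ?_⟩
  · filter_upwards [ae_restrict_mem measurableSet_Ioo] with t ht
    exact ⟨_, _, _, (r1 t ht).1, (r2 t ht).1, (r3 t ht).1⟩
  · exact (upper _ hω measurableSet_Ioo).trans_lt (ENNReal.mul_lt_top ENNReal.ofReal_lt_top hfin)
  · refine (add_le_add (upper _ subset_rfl measurableSet_Ioo) boundary).trans ?_
    rw [← mul_add, ENNReal.ofReal_mul (by positivity), ENNReal.ofReal_mul (by positivity),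
      mul_assoc, mul_assoc]
    refine mul_le_mul_right (hmain.trans (mul_le_mul_right lower _)) _
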